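/- **Proposition 3.5.** Let $n\ge 2$ and let $\Omega\subset\mathbb R^n$ be a bounded open set with Lipschitz boundary. Let $\alpha\in W^{1,n}(\Omega)\cap L^\infty(\Omega)$ and let $u\in BD(\Omega)$, i.e. $u\in L^1(\Omega;\mathbb R^n)$ and the distribution $\mathrm Eu$ with components $\mathrm E_{ij}u=\tfrac12(D_ju^i+D_iu^j)$ is a bounded Radon measure on $\Omega$ with values in the symmetric matrices $\mathbb M^{n\times n}_{\rm sym}$. For $A\subset\Omega$ let $$\operatorname{Cap}_n(A,\Omega)=\inf\Big\{\int_\Omega|\nabla v|^n\,dx:\ v\in W^{1,n}_0(\Omega),\ v\ge 1\text{ a.e. in a neighbourhood of }A\Big\},$$ and let $\widetilde\alpha$ be a $\operatorname{Cap}_n$-quasicontinuous representative of $\alpha$, that is, a function $\widetilde\alpha:\Omega\to\mathbb R$ with $\widetilde\alpha=\alpha$ a.e. in $\Omega$ such that for every $\varepsilon>0$ there is $A\subset\Omega$ with $\operatorname{Cap}_n(A,\Omega)<\varepsilon$ for which the restriction $\widetilde\alpha|_{\Omega\setminus A}$ is continuous; such a representative exists. Then $\alpha u\in BD(\Omega)$,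 $\widetilde\alpha$ is $|\mathrm Eu|$-integrable, $\nabla\alpha\odot u\in L^1(\Omega;\mathbb M^{n\times n}_{\rm sym})$, and $$\mathrm E(\alpha u)=\widetilde\alpha\,\mathrm Eu+\nabla\alpha\odot u\qquad\text{as bounded }\mathbb M^{n\times n}_{\rm sym}\text{-valued Radon measures on }\Omega,$$ where $a\odot b$ is the symmetric matrix with entries $(a_ib_j+a_jb_i)/2$ and $\nabla\alpha\odot u$ is identified with the measure $(\nabla\alpha\odot u)\,\mathcal L^n$ on $\Omega$. -/

import Mathlib

open MeasureTheory Filter Topology TopologicalSpace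
open scoped ENNReal NNReal Distributions Gradient

noncomputable section

namespace BDProduct

/-- Euclidean `n`-space. -/
abbrev Space (n : ℕ) : Type := EuclideanSpace ℝ (Fin n)

/-- Real `n × n` matrices, with the Euclidean scalar product `A : B = tr (A Bᵀ)` and its norm;
the entries of `A` are `A (i, j)`. -/
abbrev Mat (n : ℕ) : Type := EuclideanSpace ℝ (Fin n × Fin n)

variable {n : ℕ}

/-- Symmetrised tensor product `a ⊙ b`, with entries `(a_i b_j + a_j b_i) / 2`. -/
def symTensor (a b : Space n) : Mat n :=
  WithLp.toLp 2 fun p => (a p.1 * b p.2 + a p.2 * b p.1) / 2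

/-- `Ω` has Lipschitz boundary: near every boundary point, in a suitable orthonormal frame with
"vertical" unit vector `e`, `Ω` is the region strictly above the graph of a Lipschitz function.
The point `y - ⟪e, y⟫ e` is the orthogonal projection of `y` onto the hyperplane `e^⊥`, so only
the values of `γ` on `e^⊥` matter. -/
def HasLipschitzBoundary (Ω : Set (Space n)) : Prop :=
  ∀ x ∈ frontier Ω, ∃ (e : Space n) (r : ℝ) (K : ℝ≥0) (γ : Space n → ℝ),
    ‖e‖ = 1 ∧ 0 < r ∧ LipschitzWith K γ ∧
      ∀ y ∈ Metric.ball x r, y ∈ Ω ↔ γ (y - inner ℝ e y • e) < inner ℝ e y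

/-- `v ∈ W^{1,q}(Ω)` with weak gradient `∇v = g`. Only the values on `Ω` matter. -/
structure IsSobolev (Ω : Opens (Space n)) (q : ℝ≥0∞) (v : Space n → ℝ)
    (g : Space n → Space n) : Prop where
  memLp : MemLp v q (volume.restrict Ω)
  memLp_grad : MemLp g q (volume.restrict Ω)
  integral_eq : ∀ φ : 𝓓(Ω, ℝ), ∀ i : Fin n,
    ∫ x in Ω, v x * (∇ φ x) i = - ∫ x in Ω, g x i * φ x

/-- `v ∈ W^{1,q}_0(Ω)` with weak gradient `g`: `v` is the limit in `W^{1,q}(Ω)` of smooth functions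
with compact support in `Ω`. -/
structure IsSobolevZero (Ω : Opens (Space n)) (q : ℝ≥0∞) (v : Space n → ℝ)
    (g : Space n → Space n) : Prop extends IsSobolev Ω q v g where
  exists_approx : ∃ φ : ℕ → 𝓓(Ω, ℝ),
    Tendsto (fun k => eLpNorm (fun x => φ k x - v x) q (volume.restrict Ω)) atTop (𝓝 0) ∧
    Tendsto (fun k => eLpNorm (fun x => ∇ (φ k) x - g x) q (volume.restrict Ω)) atTop (𝓝 0)

/-- The `q`-capacity `Cap_q(A, Ω)` of `A` in `Ω`: the infimum of `∫_Ω |∇v|^q` over all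
`v ∈ W^{1,q}_0(Ω)` with `v ≥ 1` a.e. in a neighbourhood of `A` (`∞` if there is no such `v`). -/
def capacity (q : ℝ≥0∞) (A : Set (Space n)) (Ω : Opens (Space n)) : ℝ≥0∞ :=
  ⨅ (v : Space n → ℝ) (g : Space n → Space n) (_ : IsSobolevZero Ω q v g)
    (_ : ∃ U : Set (Space n), IsOpen U ∧ A ⊆ U ∧ U ⊆ Ω ∧ ∀ᵐ x ∂(volume.restrict U), 1 ≤ v x),
    ∫⁻ x in Ω, ‖g x‖ₑ ^ q.toReal

/-- `f` is `Cap_q`-quasicontinuous on `Ω`. -/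
def IsQuasicontinuous (q : ℝ≥0∞) (Ω : Opens (Space n)) (f : Space n → ℝ) : Prop :=
  ∀ ε : ℝ≥0∞, 0 < ε → ∃ A : Set (Space n), A ⊆ Ω ∧ capacity q A Ω < ε ∧
    ContinuousOn f ((Ω : Set (Space n)) \ A)

/-- `f` is a `Cap_q`-quasicontinuous representative of `α` on `Ω`. -/
def IsQuasicontinuousRep (q : ℝ≥0∞) (Ω : Opens (Space n)) (α f : Space n → ℝ) : Prop :=
  IsQuasicontinuous q Ω f ∧ f =ᵐ[volume.restrict Ω] α

/-- The distribution `Eu` on `Ω`, with components `E_{ij} u = (D_j u^i + D_i u^j) / 2`, is the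
bounded measure `μ ∈ M_b(Ω; M_sym^{n×n})`. A measure on `Ω` is regarded as a Borel measure on `ℝⁿ`
that is concentrated on `Ω`. -/
structure HasStrain (Ω : Opens (Space n)) (u : Space n → Space n)
    (μ : VectorMeasure (Space n) (Mat n)) : Prop where
  restrict_eq : μ.restrict Ω = μ
  variation_lt_top : μ.variation Set.univ < ∞
  isSymm : ∀ (s : Set (Space n)) (i j : Fin n), μ s (i, j) = μ s (j, i)
  integral_eq : ∀ φ : 𝓓(Ω, ℝ), ∀ i j : Fin n,
    (∫ᵛ x, φ x ∂•μ) (i, j) = - ∫ x in Ω, (u x i * (∇ φ x) j + u x j * (∇ φ x) i) / 2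

/-- `u ∈ BD(Ω)`: `u ∈ L¹(Ω; ℝⁿ)` and the distribution `Eu` is a bounded measure. -/
def MemBD (Ω : Opens (Space n)) (u : Space n → Space n) : Prop :=
  MemLp u 1 (volume.restrict Ω) ∧ ∃ μ : VectorMeasure (Space n) (Mat n), HasStrain Ω u μ

/-- The matrix-valued measure `f μ` with density `f` with respect to `μ`. -/
def scalarMul (f : Space n → ℝ) (μ : VectorMeasure (Space n) (Mat n)) :
    VectorMeasure (Space n) (Mat n) :=
  μ.withDensity f (ContinuousLinearMap.lsmul ℝ ℝ)

/-- The measure `F 𝓛ⁿ` on `Ω` associated with an integrable matrix field `F` on `Ω`. -/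
def lebesgueDensity (Ω : Opens (Space n)) (F : Space n → Mat n) :
    VectorMeasure (Space n) (Mat n) :=
  (volume.restrict (Ω : Set (Space n))).withDensityᵥ F

end BDProduct

end

/-!
Two facts about a field `u` with bounded strain `Eu` carry the proof.

* `u ∈ L^{n/(n-1)}(Ω)`. Near a point of the closure of `Ω` there is an open cone of directions that
  stay inside `Ω`. For `ξ` in this cone `∂_ξ ⟪u, ξ⟫ = ⟪(Eu) ξ, ξ⟫` is a bounded measure, and
  mollifying with a kernel supported in the opposite cone keeps every line integral inside `Ω`. The
  Gagliardo argument along the vectors `b i` of a basis taken from the cone shows that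
  `∏ i, |⟪u, b i⟫|^{1/(n-1)}` is locally integrable up to the boundary, and finitely many generic
  bases make the sum of these products comparable to `|u|^{n/(n-1)}`. By Hölder's inequality,
  `∇α ⊙ u ∈ L¹`.

* `|Eu|` is small on sets of small `n`-capacity. Let `0 ≤ ψ ≤ 1` be a test function that is small in
  `W^{1,n}`, and `χ` a test function approximating the sign of the `(i, j)` entry of `Eu`. Testing
  the strain with `ψ χ` bounds `∫ ψ d|E_{ij} u|` by `‖u‖_{n/(n-1)} ‖∇(ψ χ)‖_n`, up to the error of
  the approximation. Smooth truncation extends this to `|Eu| {1 ≤ v} → 0` as `v → 0` in `W_0^{1,n}`.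

The identity holds for the mollifications `α_k` of `α`. By the second fact a subsequence converges
`|Eu|`-almost everywhere to the quasicontinuous representative, and it is bounded by `‖α‖_∞`, so
the first fact and dominated convergence give the identity in the limit.
-/

open scoped Convolution

noncomputable section

namespace BDProduct

section VectorMeasure

variable {X E : Type*} {mX : MeasurableSpace X} {ν : Measure X} [NormedAddCommGroup E]
  [NormedSpace ℝ E] {F : X → E}

theorem integrable_smul_of_integrable_withDensity_enorm (hF : AEStronglyMeasurable F ν)
    {φ : X → ℝ} (hφ : Integrable φ (ν.withDensity fun x => ‖F x‖ₑ)) :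
    Integrable (fun x => φ x • F x) ν := by
  have hae : (fun x => φ x • F x) =ᵐ[ν] fun x => hφ.1.mk φ x • F x := by
    filter_upwards [(ae_withDensity_iff' hF.enorm).1 hφ.1.ae_eq_mk] with x hx
    by_cases h0 : F x = 0
    · simp [h0]
    · rw [hx (by simpa using h0)]
  refine Integrable.congr ⟨hφ.1.stronglyMeasurable_mk.aestronglyMeasurable.smul hF, ?_⟩ hae.symm
  have hfin := (hφ.congr hφ.1.ae_eq_mk).2
  rw [HasFiniteIntegral, lintegral_withDensity_eq_lintegral_mul₀ hF.enorm
    hφ.1.stronglyMeasurable_mk.enorm.aemeasurable] at hfin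
  simpa only [HasFiniteIntegral, Pi.smul_apply', enorm_smul, Pi.mul_apply, mul_comm] using hfin

theorem continuous_integral_smul_withDensity_enorm (hF : AEStronglyMeasurable F ν) :
    Continuous fun φ : X →₁[ν.withDensity fun x => ‖F x‖ₑ] ℝ => ∫ x, φ x • F x ∂ν := by
  refine LipschitzWith.continuous (K := 1) fun φ ψ => ?_
  have hint (χ : X →₁[ν.withDensity fun x => ‖F x‖ₑ] ℝ) :=
    integrable_smul_of_integrable_withDensity_enorm hF (L1.integrable_coeFn χ)
  calc edist (∫ x, φ x • F x ∂ν) (∫ x, ψ x • F x ∂ν)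
      = ‖∫ x, (φ x • F x - ψ x • F x) ∂ν‖ₑ := by
        rw [edist_eq_enorm_sub, integral_sub (hint φ) (hint ψ)]
    _ ≤ ∫⁻ x, ‖F x‖ₑ * edist (φ x) (ψ x) ∂ν := by
        refine (enorm_integral_le_lintegral_enorm _).trans_eq (lintegral_congr fun x => ?_)
        rw [← sub_smul, enorm_smul, edist_eq_enorm_sub, mul_comm]
    _ = 1 * edist φ ψ := by
        rw [one_mul, L1.edist_def, lintegral_withDensity_eq_lintegral_mul₀ hF.enorm
          ((Lp.stronglyMeasurable φ).edist (Lp.stronglyMeasurable ψ)).aemeasurable]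
        rfl

variable [CompleteSpace E]

theorem isFiniteMeasure_variation_withDensityᵥ (hF : Integrable F ν) :
    IsFiniteMeasure (ν.withDensityᵥ F).variation := by
  rw [Measure.variation_withDensityᵥ hF]
  exact isFiniteMeasure_withDensity hF.2.ne

theorem integral_withDensityᵥ (hF : Integrable F ν) {φ : X → ℝ}
    (hφ : (ν.withDensityᵥ F).Integrable φ) :
    ∫ᵛ x, φ x ∂•(ν.withDensityᵥ F) = ∫ x, φ x • F x ∂ν := by
  have hvar := Measure.variation_withDensityᵥ hF
  have := isFiniteMeasure_variation_withDensityᵥ hF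
  have hint {ψ : X → ℝ} (hψ : (ν.withDensityᵥ F).Integrable ψ) :
      Integrable (fun x => ψ x • F x) ν := by
    rw [VectorMeasure.Integrable, hvar] at hψ
    exact integrable_smul_of_integrable_withDensity_enorm hF.1 hψ
  refine Integrable.induction
    (fun φ => ∫ᵛ x, φ x ∂•(ν.withDensityᵥ F) = ∫ x, φ x • F x ∂ν)
    (fun c s hs _ => ?_) (fun φ ψ _ hφ hψ ihφ ihψ => ?_) ?_ (fun φ ψ hφψ _ ih => ?_) hφ
  · rw [VectorMeasure.integral_indicator hs, VectorMeasure.setIntegral_const,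
      withDensityᵥ_apply hF hs, ContinuousLinearMap.lsmul_apply, ← integral_smul,
      ← integral_indicator hs]
    exact integral_congr_ae (ae_of_all _ fun x => Set.indicator_smul_apply_left s (fun _ => c) F x)
  · rw [VectorMeasure.integral_add hφ hψ, ihφ, ihψ, ← integral_add (hint hφ) (hint hψ)]
    simp only [Pi.add_apply, add_smul]
  · refine isClosed_eq VectorMeasure.continuous_integral ?_
    rw [hvar]
    exact continuous_integral_smul_withDensity_enorm hF.1
  · rw [← VectorMeasure.integral_congr_ae hφψ, ih]
    rw [hvar] at hφψ
    refine integral_congr_ae ?_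
    filter_upwards [(ae_withDensity_iff' hF.1.enorm).1 hφψ] with x hx
    by_cases h0 : F x = 0
    · simp [h0]
    · rw [hx (by simpa using h0)]

theorem withDensity_withDensityᵥ (hF : Integrable F ν) {f : X → ℝ}
    (hf : (ν.withDensityᵥ F).Integrable f) :
    (ν.withDensityᵥ F).withDensity f (ContinuousLinearMap.lsmul ℝ ℝ) =
      ν.withDensityᵥ fun x => f x • F x := by
  ext s hs
  have hfF : Integrable (fun x => f x • F x) ν := by
    rw [VectorMeasure.Integrable, Measure.variation_withDensityᵥ hF] at hf
    exact integrable_smul_of_integrable_withDensity_enorm hF.1 hf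
  rw [VectorMeasure.withDensity_apply hf, withDensityᵥ_apply hfF hs,
    ← VectorMeasure.integral_indicator hs, integral_withDensityᵥ hF ?_, ← integral_indicator hs]
  · exact integral_congr_ae (ae_of_all _ fun x => (Set.indicator_smul_apply_left s f F x).symm)
  · exact (Integrable.indicator hf hs)

end VectorMeasure

theorem exists_integrable_withDensityᵥ_variation_eq {X ι : Type*} [MeasurableSpace X] [Fintype ι]
    (μ : VectorMeasure X (EuclideanSpace ℝ ι)) [IsFiniteMeasure μ.variation] :
    ∃ σ : X → EuclideanSpace ℝ ι, Measurable σ ∧ Integrable σ μ.variation ∧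
      μ.variation.withDensityᵥ σ = μ := by
  let μi (i : ι) : SignedMeasure X :=
    μ.mapRange (EuclideanSpace.projₗ (𝕜 := ℝ) i).toAddMonoidHom (EuclideanSpace.proj i).continuous
  have hμi (i : ι) : μ.variation.withDensityᵥ ((μi i).rnDeriv μ.variation) = μi i := by
    refine (SignedMeasure.absolutelyContinuous_iff_withDensityᵥ_rnDeriv_eq _ _).1
      (VectorMeasure.AbsolutelyContinuous.mk fun s hs h0 => ?_)
    rw [Measure.toENNRealVectorMeasure_apply_measurable hs] at h0
    have : μ s = 0 := by simpa [h0] using VectorMeasure.enorm_measure_le_variation μ s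
    change μ s i = 0
    rw [this, PiLp.zero_apply]
  let σ : X → EuclideanSpace ℝ ι := fun x => WithLp.toLp 2 fun i => (μi i).rnDeriv μ.variation x
  have hσ : Integrable σ μ.variation := by
    simp_rw [← memLp_one_iff_integrable, memLp_piLp_iff, memLp_one_iff_integrable]
    exact fun i => SignedMeasure.integrable_rnDeriv _ _
  refine ⟨σ, (WithLp.measurable_toLp 2 _).comp
    (measurable_pi_lambda _ fun i => SignedMeasure.measurable_rnDeriv _ _), hσ, ?_⟩
  ext s hs i
  rw [withDensityᵥ_apply hσ hs]
  calc (∫ x in s, σ x ∂μ.variation) i = ∫ x in s, σ x i ∂μ.variation :=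
        ((EuclideanSpace.proj (𝕜 := ℝ) i).integral_comp_comm hσ.integrableOn).symm
    _ = μi i s := by
        rw [← hμi, withDensityᵥ_apply (SignedMeasure.integrable_rnDeriv _ _) hs]
    _ = μ s i := rfl

/-! ### Mollification -/

section Mollify

variable {E F : Type*} [NormedAddCommGroup E] [NormedSpace ℝ E] [NormedAddCommGroup F]
  [NormedSpace ℝ F] {g : E → ℝ} {δ : ℝ}

theorem fderiv_kernel_sub_apply (hg : ContDiff ℝ (⊤ : ℕ∞) g) (x y v : E) :
    fderiv ℝ (fun z => g (x - z)) y v = -fderiv ℝ g (x - y) v := by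
  have hd := (hg.differentiable (by simp) (x - y)).hasFDerivAt.comp y
    ((hasFDerivAt_id y).const_sub x)
  have : fderiv ℝ (fun z => g (x - z)) y = _ := hd.fderiv
  simp [this]

variable [MeasureSpace E]

/-- A smooth nonnegative kernel of integral one that vanishes off the ball of radius `δ` about the
origin. It need not be radial: one-sided kernels are used near the boundary of a domain. -/
structure IsMollifier (g : E → ℝ) (δ : ℝ) : Prop where
  contDiff : ContDiff ℝ (⊤ : ℕ∞) g
  nonneg : ∀ x, 0 ≤ g x
  support_subset : Function.support g ⊆ Metric.ball 0 δ
  integral_eq_one : ∫ x, g x = 1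

/-- The convolution `g * f` of a function `f` with a scalar kernel `g`. -/
def mollify (g : E → ℝ) (f : E → F) : E → F :=
  g ⋆[ContinuousLinearMap.lsmul ℝ ℝ, volume] f

/-- The test function `y ↦ g (x - y) * φ y`. -/
def kernelTest {Ω : Opens E} {φ : E → ℝ} (hg : ContDiff ℝ (⊤ : ℕ∞) g) (hgc : HasCompactSupport g)
    (hφ : ContDiff ℝ (⊤ : ℕ∞) φ) (x : E)
    (hx : ∀ y, x - y ∈ tsupport g → y ∈ tsupport φ → y ∈ Ω) : 𝓓(Ω, ℝ) where
  toFun y := g (x - y) * φ y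
  contDiff' := (hg.comp (contDiff_const.sub contDiff_id)).mul hφ
  hasCompactSupport' := (hgc.comp_homeomorph (Homeomorph.subLeft x)).mul_right
  tsupport_subset' y hy := by
    have hy_left : y ∈ tsupport (g ∘ Homeomorph.subLeft x) :=
      closure_mono (Function.support_mul_subset_left _ _) hy
    rw [tsupport_comp_eq_preimage] at hy_left
    exact hx y hy_left (closure_mono (Function.support_mul_subset_right _ _) hy)

namespace IsMollifier

section Basic

theorem continuous (hg : IsMollifier g δ) : Continuous g := hg.contDiff.continuous

theorem tsupport_subset (hg : IsMollifier g δ) : tsupport g ⊆ Metric.closedBall 0 δ :=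
  closure_minimal (hg.support_subset.trans Metric.ball_subset_closedBall) Metric.isClosed_closedBall

theorem eq_zero (hg : IsMollifier g δ) {x : E} (hx : δ ≤ ‖x‖) : g x = 0 := by
  by_contra h
  exact absurd (mem_ball_zero_iff.1 (hg.support_subset h)) hx.not_gt

theorem mono (hg : IsMollifier g δ) {δ' : ℝ} (h : δ ≤ δ') : IsMollifier g δ' where
  __ := hg
  support_subset := hg.support_subset.trans (Metric.ball_subset_ball h)

variable [FiniteDimensional ℝ E]

theorem hasCompactSupport (hg : IsMollifier g δ) : HasCompactSupport g :=
  (isCompact_closedBall 0 δ).of_isClosed_subset (isClosed_tsupport g) hg.tsupport_subset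

variable [BorelSpace E] [(volume : Measure E).IsAddHaarMeasure]

theorem integrable (hg : IsMollifier g δ) : Integrable g :=
  hg.continuous.integrable_of_hasCompactSupport hg.hasCompactSupport

theorem integral_sub (hg : IsMollifier g δ) (x : E) : ∫ y, g (x - y) = 1 := by
  rw [integral_sub_left_eq_self g volume x, hg.integral_eq_one]

theorem lintegral_enorm (hg : IsMollifier g δ) : ∫⁻ x, ‖g x‖ₑ = 1 := by
  rw [← ofReal_integral_norm_eq_lintegral_enorm hg.integrable,
    integral_congr_ae (ae_of_all _ fun x => Real.norm_of_nonneg (hg.nonneg x)),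
    hg.integral_eq_one, ENNReal.ofReal_one]

end Basic

end IsMollifier

variable [FiniteDimensional ℝ E] [BorelSpace E] [(volume : Measure E).IsAddHaarMeasure]

theorem exists_isMollifier (c : E) {ρ : ℝ} (hρ : 0 < ρ) :
    ∃ g : E → ℝ, IsMollifier g (ρ + ‖c‖) ∧ tsupport g ⊆ Metric.closedBall c ρ := by
  let b : ContDiffBump c := ⟨ρ / 2, ρ, half_pos hρ, half_lt_self hρ⟩
  refine ⟨b.normed volume, ⟨b.contDiff_normed, b.nonneg_normed, ?_, b.integral_normed⟩,
    b.tsupport_normed_eq.le⟩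
  rw [b.support_normed_eq]
  exact Metric.ball_subset_ball' (by rw [dist_zero_right])

theorem mollify_apply (g : E → ℝ) (f : E → F) (x : E) : mollify g f x = ∫ y, g (x - y) • f y :=
  convolution_eq_swap _

namespace IsMollifier

theorem integrable_smul (hg : IsMollifier g δ) {f : E → F} (hf : LocallyIntegrable f) (x : E) :
    Integrable fun y => g (x - y) • f y := by
  have h := (hg.hasCompactSupport.convolutionExists_left (ContinuousLinearMap.lsmul ℝ ℝ)
    hg.continuous hf x).integrable_swap
  exact h

theorem contDiff_mollify (hg : IsMollifier g δ) {f : E → F} (hf : LocallyIntegrable f) :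
    ContDiff ℝ (⊤ : ℕ∞) (mollify g f) :=
  hg.hasCompactSupport.contDiff_convolution_left _ hg.contDiff hf

theorem fderiv_mollify (hg : IsMollifier g δ) {f : E → F}
    (hf : LocallyIntegrable f) (x v : E) :
    fderiv ℝ (mollify g f) x v = ∫ y, fderiv ℝ g (x - y) v • f y := by
  have hderiv : fderiv ℝ (mollify g f) x = _ :=
    (hg.hasCompactSupport.hasFDerivAt_convolution_left (ContinuousLinearMap.lsmul ℝ ℝ)
      (hg.contDiff.of_le (by simp)) hf x).fderiv
  have hint := ((hg.hasCompactSupport.fderiv ℝ).convolutionExists_left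
    ((ContinuousLinearMap.lsmul ℝ ℝ : ℝ →L[ℝ] F →L[ℝ] F).precompL E)
    (hg.contDiff.continuous_fderiv (by simp)) hf x).integrable_swap
  rw [hderiv, convolution_eq_swap, ContinuousLinearMap.integral_apply hint]
  rfl

theorem mollify_sub (hg : IsMollifier g δ) {f f' : E → F} (hf : LocallyIntegrable f)
    (hf' : LocallyIntegrable f') : mollify g (f - f') = mollify g f - mollify g f' := by
  ext x
  simp only [mollify_apply, Pi.sub_apply, smul_sub]
  exact MeasureTheory.integral_sub (hg.integrable_smul hf x) (hg.integrable_smul hf' x)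

theorem norm_mollify_le (hg : IsMollifier g δ) {f : E → F} {M : ℝ} (hM : ∀ᵐ x, ‖f x‖ ≤ M)
    (x : E) : ‖mollify g f x‖ ≤ M := by
  rw [mollify_apply]
  calc ‖∫ y, g (x - y) • f y‖ ≤ ∫ y, g (x - y) * M := by
        refine norm_integral_le_of_norm_le ((hg.integrable.comp_sub_left x).mul_const M) ?_
        filter_upwards [hM] with y hy
        rw [norm_smul, Real.norm_of_nonneg (hg.nonneg _)]
        exact mul_le_mul_of_nonneg_left hy (hg.nonneg _)
    _ = M := by rw [integral_mul_const, hg.integral_sub, one_mul]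

theorem le_mollify (hg : IsMollifier g δ) {f : E → ℝ} (hf : LocallyIntegrable f) {x : E} {c : ℝ}
    (hc : ∀ᵐ y, y ∈ Metric.ball x δ → c ≤ f y) : c ≤ mollify g f x := by
  rw [mollify_apply]
  calc c = ∫ y, g (x - y) * c := by rw [integral_mul_const, hg.integral_sub, one_mul]
    _ ≤ ∫ y, g (x - y) • f y := by
      refine integral_mono_ae ((hg.integrable.comp_sub_left x).mul_const c)
        (hg.integrable_smul hf x) ?_
      filter_upwards [hc] with y hy
      by_cases hyx : y ∈ Metric.ball x δ
      · exact mul_le_mul_of_nonneg_left (hy hyx) (hg.nonneg _)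
      · rw [hg.eq_zero (by simpa [dist_comm, dist_eq_norm] using hyx), zero_mul, zero_smul]

/-- Jensen's inequality for the probability measure `g (x - y) dy`. -/
theorem enorm_mollify_rpow_le (hg : IsMollifier g δ) {f : E → F} (hf : AEStronglyMeasurable f)
    {p : ℝ} (hp : 1 ≤ p) (x : E) :
    ‖mollify g f x‖ₑ ^ p ≤ ∫⁻ y, ‖g (x - y)‖ₑ * ‖f y‖ₑ ^ p := by
  let ν : Measure E := volume.withDensity fun y => ‖g (x - y)‖ₑ
  have hgm : AEMeasurable fun y => ‖g (x - y)‖ₑ :=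
    (hg.continuous.comp (continuous_const.sub continuous_id)).enorm.measurable.aemeasurable
  have hν : IsProbabilityMeasure ν := ⟨by
    rw [withDensity_apply _ MeasurableSet.univ, Measure.restrict_univ,
      lintegral_sub_left_eq_self (fun y => ‖g y‖ₑ) x, hg.lintegral_enorm]⟩
  have hmean : ‖mollify g f x‖ₑ ≤ eLpNorm f 1 ν := by
    rw [eLpNorm_one_eq_lintegral_enorm, lintegral_withDensity_eq_lintegral_mul₀ hgm hf.enorm,
      mollify_apply]
    refine (enorm_integral_le_lintegral_enorm _).trans_eq (lintegral_congr fun y => ?_)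
    rw [enorm_smul, Pi.mul_apply]
  have hp0 : 0 < p := by positivity
  have hle := hmean.trans (eLpNorm_le_eLpNorm_of_exponent_le
    (ENNReal.one_le_ofReal.2 hp) (hf.mono_ac (withDensity_absolutelyContinuous _ _)))
  rw [eLpNorm_eq_lintegral_rpow_enorm_toReal (by simpa using hp0) ENNReal.ofReal_ne_top,
    ENNReal.toReal_ofReal hp0.le, one_div, ← ENNReal.rpow_inv_le_iff (inv_pos.2 hp0),
    inv_inv, lintegral_withDensity_eq_lintegral_mul₀ hgm (hf.enorm.pow_const _)] at hle
  exact hle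

theorem eLpNorm_mollify_le (hg : IsMollifier g δ) {f : E → F} (hf : AEStronglyMeasurable f)
    {p : ℝ≥0∞} (hp1 : 1 ≤ p) (hp : p ≠ ∞) :
    eLpNorm (mollify g f) p volume ≤ eLpNorm f p volume := by
  have hp0 : p ≠ 0 := (zero_lt_one.trans_le hp1).ne'
  have hpr : 1 ≤ p.toReal := by simpa using ENNReal.toReal_mono hp hp1
  rw [eLpNorm_eq_lintegral_rpow_enorm_toReal hp0 hp, eLpNorm_eq_lintegral_rpow_enorm_toReal hp0 hp]
  gcongr ?_ ^ _
  have hgm : Measurable fun z => ‖g z‖ₑ := hg.continuous.enorm.measurable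
  calc ∫⁻ x, ‖mollify g f x‖ₑ ^ p.toReal
      ≤ ∫⁻ x, ∫⁻ y, ‖g (x - y)‖ₑ * ‖f y‖ₑ ^ p.toReal :=
        lintegral_mono fun x => hg.enorm_mollify_rpow_le hf hpr x
    _ = ∫⁻ y, ∫⁻ x, ‖g (x - y)‖ₑ * ‖f y‖ₑ ^ p.toReal :=
        lintegral_lintegral_swap <| (hgm.comp (measurable_fst.sub measurable_snd)).aemeasurable.mul
          (hf.enorm.pow_const _).comp_snd
    _ = ∫⁻ y, ‖f y‖ₑ ^ p.toReal := by
        refine lintegral_congr fun y => ?_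
        have hgy : Measurable fun x => ‖g (x - y)‖ₑ :=
          hgm.comp (measurable_id.sub measurable_const)
        rw [lintegral_mul_const _ hgy,
          lintegral_sub_right_eq_self (fun z => ‖g z‖ₑ) y, hg.lintegral_enorm, one_mul]

theorem tsupport_mollify_subset (hg : IsMollifier g δ) (f : E → F) :
    tsupport (mollify g f) ⊆ Metric.cthickening δ (tsupport f) := by
  refine closure_minimal (fun x hx => ?_) Metric.isClosed_cthickening
  obtain ⟨y, hy⟩ : ∃ y, g (x - y) • f y ≠ 0 := by
    by_contra! h
    exact hx (by simp [mollify_apply, h])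
  have hxy : dist x y ≤ δ := by
    rw [dist_eq_norm]
    exact (not_le.1 fun h => (smul_ne_zero_iff.1 hy).1 (hg.eq_zero h)).le
  exact Metric.mem_cthickening_of_dist_le x y δ _
    (subset_tsupport f (smul_ne_zero_iff.1 hy).2) hxy

end IsMollifier

variable {g : ℕ → E → ℝ} {δ : ℕ → ℝ} [CompleteSpace F]

theorem tendstoUniformly_mollify (hg : ∀ k, IsMollifier (g k) (δ k))
    (hδ : Tendsto δ atTop (𝓝 0)) {f : E → F} (hf : UniformContinuous f) :
    TendstoUniformly (fun k => mollify (g k) f) f atTop := by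
  refine Metric.tendstoUniformly_iff.2 fun ε hε => ?_
  obtain ⟨ρ, hρ, hfρ⟩ := Metric.uniformContinuous_iff.1 hf (ε / 2) (half_pos hε)
  filter_upwards [hδ.eventually_lt_const hρ] with k hk x
  rw [dist_comm]
  refine (dist_convolution_le (half_pos hε).le (hg k).support_subset (hg k).nonneg
    (hg k).integral_eq_one hf.continuous.aestronglyMeasurable fun y hy => ?_).trans_lt
    (half_lt_self hε)
  exact (hfρ ((Metric.mem_ball.1 hy).trans hk)).le

theorem tendsto_eLpNorm_mollify_sub_of_hasCompactSupport (hg : ∀ k, IsMollifier (g k) (δ k))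
    (hδ : Tendsto δ atTop (𝓝 0)) {f : E → F} (hf : Continuous f) (hfc : HasCompactSupport f)
    (p : ℝ≥0∞) : Tendsto (fun k => eLpNorm (mollify (g k) f - f) p volume) atTop (𝓝 0) := by
  let K := Metric.cthickening 1 (tsupport f)
  have hK : IsCompact K := hfc.isCompact.cthickening
  have : IsFiniteMeasure (volume.restrict K) := ⟨by simpa using hK.measure_lt_top⟩
  have hsupp : ∀ᶠ k in atTop, K.indicator (mollify (g k) f - f) = mollify (g k) f - f := by
    filter_upwards [hδ.eventually_lt_const one_pos] with k hk
    refine Set.indicator_eq_self.2 ((Function.support_sub _ _).trans (Set.union_subset ?_ ?_))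
    · exact (subset_tsupport _).trans <| ((hg k).tsupport_mollify_subset f).trans
        (Metric.cthickening_mono hk.le _)
    · exact (subset_tsupport f).trans (Metric.self_subset_cthickening _)
  have hunif := tendstoUniformly_mollify hg hδ (hfc.uniformContinuous_of_continuous hf)
  have hK_lim : Tendsto (fun k => eLpNorm (mollify (g k) f - f) p (volume.restrict K))
      atTop (𝓝 0) := by
    have hfin : volume K ^ p.toReal⁻¹ ≠ ∞ :=
      ENNReal.rpow_ne_top_of_nonneg (by positivity) hK.measure_lt_top.ne
    rw [ENNReal.tendsto_nhds_zero]
    intro η hη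
    obtain ⟨ε, hε, hεη⟩ : ∃ ε : ℝ≥0, 0 < ε ∧ ε * volume K ^ p.toReal⁻¹ < η :=
      ENNReal.exists_nnreal_pos_mul_lt hfin hη.ne'
    filter_upwards [Metric.tendstoUniformly_iff.1 hunif ε hε] with k hk
    refine (eLpNorm_le_of_ae_bound (C := ε) (ae_of_all _ fun x => ?_)).trans ?_
    · rw [Pi.sub_apply, ← dist_eq_norm, dist_comm]
      exact (hk x).le
    · simpa [mul_comm] using hεη.le
  refine hK_lim.congr' ?_
  filter_upwards [hsupp] with k hk
  rw [← eLpNorm_indicator_eq_eLpNorm_restrict hK.measurableSet, hk]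

theorem tendsto_eLpNorm_mollify_sub (hg : ∀ k, IsMollifier (g k) (δ k))
    (hδ : Tendsto δ atTop (𝓝 0)) {f : E → F} {p : ℝ≥0∞} (hp1 : 1 ≤ p) (hp : p ≠ ∞)
    (hf : MemLp f p) : Tendsto (fun k => eLpNorm (mollify (g k) f - f) p volume) atTop (𝓝 0) := by
  rw [ENNReal.tendsto_nhds_zero]
  intro η hη
  have hη3 : η / 3 ≠ 0 := (ENNReal.div_pos hη.ne' (by simp)).ne'
  obtain ⟨h, hc, hfh, hh, hhp⟩ := hf.exists_hasCompactSupport_eLpNorm_sub_le hp hη3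
  have hfl : LocallyIntegrable f := hf.locallyIntegrable hp1
  have hhl : LocallyIntegrable h := hh.locallyIntegrable
  have hm (k : ℕ) {f : E → F} (hf : LocallyIntegrable f) :
      AEStronglyMeasurable (mollify (g k) f) :=
    ((hg k).contDiff_mollify hf).continuous.aestronglyMeasurable
  filter_upwards [ENNReal.tendsto_nhds_zero.1
    (tendsto_eLpNorm_mollify_sub_of_hasCompactSupport hg hδ hh hc p) (η / 3) hη3.bot_lt] with k hk
  calc eLpNorm (mollify (g k) f - f) p volume
      = eLpNorm (mollify (g k) (f - h) + (mollify (g k) h - h) + (h - f)) p volume := by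
        rw [(hg k).mollify_sub hfl hhl]
        congr 1
        abel
    _ ≤ eLpNorm (mollify (g k) (f - h) + (mollify (g k) h - h)) p volume
        + eLpNorm (h - f) p volume :=
        eLpNorm_add_le ((hm k (hfl.sub hhl)).add ((hm k hhl).sub hhp.1)) (hhp.1.sub hf.1) hp1
    _ ≤ eLpNorm (mollify (g k) (f - h)) p volume + eLpNorm (mollify (g k) h - h) p volume
        + eLpNorm (h - f) p volume := by
        gcongr
        exact eLpNorm_add_le (hm k (hfl.sub hhl)) ((hm k hhl).sub hhp.1) hp1
    _ ≤ η / 3 + η / 3 + η / 3 := by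
        gcongr
        · exact ((hg k).eLpNorm_mollify_le (hf.1.sub hhp.1) hp1 hp).trans hfh
        · rwa [eLpNorm_sub_comm]
    _ = η := ENNReal.add_thirds η

variable {n : ℕ}

theorem gradient_apply (f : Space n → ℝ) (x : Space n) (i : Fin n) :
    (∇ f x) i = fderiv ℝ f x (EuclideanSpace.single i 1) := by
  have h := EuclideanSpace.inner_single_right (𝕜 := ℝ) i 1 (∇ f x)
  rw [gradient, InnerProductSpace.toDual_symm_apply] at h
  simpa [gradient] using h.symm

theorem mollify_apply_coord {G : Space n → Space n} (hG : LocallyIntegrable G) {g : Space n → ℝ}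
    {δ : ℝ} (hg : IsMollifier g δ) (x : Space n) (i : Fin n) :
    mollify g G x i = ∫ y, g (x - y) * G y i := by
  rw [mollify_apply]
  exact ((EuclideanSpace.proj (𝕜 := ℝ) i).integral_comp_comm (hg.integrable_smul hG x)).symm

theorem IsSobolev.gradient_mollify {Ω : Opens (Space n)} {q : ℝ≥0∞} (hq : 1 ≤ q)
    {v : Space n → ℝ} {G : Space n → Space n} (hv : IsSobolev Ω q v G) {g : Space n → ℝ} {δ : ℝ}
    (hg : IsMollifier g δ) {x : Space n} (hx : Metric.closedBall x δ ⊆ Ω) :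
    ∇ (mollify g ((Ω : Set (Space n)).indicator v)) x =
      mollify g ((Ω : Set (Space n)).indicator G) x := by
  have hΩ : MeasurableSet (Ω : Set (Space n)) := Ω.isOpen.measurableSet
  have hvl : LocallyIntegrable ((Ω : Set (Space n)).indicator v) :=
    ((memLp_indicator_iff_restrict hΩ).2 hv.memLp).locallyIntegrable hq
  have hGl : LocallyIntegrable ((Ω : Set (Space n)).indicator G) :=
    ((memLp_indicator_iff_restrict hΩ).2 hv.memLp_grad).locallyIntegrable hq
  let ψ : 𝓓(Ω, ℝ) := kernelTest hg.contDiff hg.hasCompactSupport contDiff_const x (φ := fun _ => 1)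
    fun y hy _ => hx <| by
      rw [Metric.mem_closedBall, dist_comm, dist_eq_norm]
      simpa using hg.tsupport_subset hy
  have hψ : (ψ : Space n → ℝ) = fun y => g (x - y) := funext fun y => mul_one _
  ext i
  have hψ' (y : Space n) : (∇ (fun z => g (x - z)) y) i =
      -fderiv ℝ g (x - y) (EuclideanSpace.single i 1) := by
    rw [gradient_apply, fderiv_kernel_sub_apply hg.contDiff]
  have h := hv.integral_eq ψ i
  simp only [hψ, hψ', mul_neg, integral_neg, neg_inj] at h
  rw [gradient_apply, hg.fderiv_mollify hvl, mollify_apply_coord hGl hg]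
  rw [← integral_indicator hΩ, ← integral_indicator hΩ] at h
  refine (integral_congr_ae (.of_forall fun y => ?_)).trans
    (h.trans (integral_congr_ae (.of_forall fun y => ?_))) <;>
    by_cases hy : y ∈ (Ω : Set (Space n)) <;> simp [hy, mul_comm]

end Mollify

section Strain

variable {n : ℕ}

theorem continuous_gradient {φ : Space n → ℝ} (hφ : ContDiff ℝ (⊤ : ℕ∞) φ) : Continuous (∇ φ) :=
  (InnerProductSpace.toDual ℝ (Space n)).symm.continuous.comp (hφ.continuous_fderiv (by simp))

theorem continuous_gradient_coord {φ : Space n → ℝ} (hφ : ContDiff ℝ (⊤ : ℕ∞) φ) (i : Fin n) :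
    Continuous fun x => (∇ φ x) i :=
  (EuclideanSpace.proj (𝕜 := ℝ) i).continuous.comp (continuous_gradient hφ)

theorem hasCompactSupport_gradient {φ : Space n → ℝ} (hφ : HasCompactSupport φ) :
    HasCompactSupport (∇ φ) :=
  (hφ.fderiv ℝ).comp_left (map_zero _)

theorem hasCompactSupport_gradient_coord {φ : Space n → ℝ} (hφ : HasCompactSupport φ)
    (i : Fin n) : HasCompactSupport fun x => (∇ φ x) i :=
  (hasCompactSupport_gradient hφ).comp_left (g := fun ξ : Space n => ξ i) rfl

theorem fderiv_eq_inner_gradient (φ : Space n → ℝ) (x ξ : Space n) :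
    fderiv ℝ φ x ξ = inner ℝ (∇ φ x) ξ := by
  rw [gradient, InnerProductSpace.toDual_symm_apply]

theorem integrable_mul_of_hasCompactSupport {X : Type*} [TopologicalSpace X] [MeasurableSpace X]
    [OpensMeasurableSpace X] {μ : Measure X} {f φ : X → ℝ} (hf : Integrable f μ)
    (hφ : Continuous φ) (hc : HasCompactSupport φ) : Integrable (fun x => f x * φ x) μ :=
  have ⟨_, hC⟩ := hφ.bounded_above_of_compact_support hc
  hf.mul_bdd (hφ.aestronglyMeasurable) (ae_of_all _ hC)

theorem integrable_indicator_mul_inner {Ω : Opens (Space n)} {u : Space n → Space n}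
    (hu : MemLp u 1 (volume.restrict Ω)) {φ : Space n → ℝ} (hφ : Continuous φ)
    (hc : HasCompactSupport φ) (ξ : Space n) :
    Integrable ((Ω : Set (Space n)).indicator fun y => φ y * inner ℝ (u y) ξ) := by
  refine (integrable_indicator_iff Ω.isOpen.measurableSet).2 ?_
  simp_rw [mul_comm (φ _)]
  exact integrable_mul_of_hasCompactSupport ((memLp_one_iff_integrable.1 hu).inner_const ξ) hφ hc

/-- The density `σ` of the strain `Eu` with respect to a measure `m` on `Ω`. Only the strain
identity is kept, so that the values of `σ` need not be symmetric. -/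
structure IsStrainDensity (Ω : Opens (Space n)) (u : Space n → Space n) (m : Measure (Space n))
    (σ : Space n → Mat n) : Prop where
  measurable : Measurable σ
  integrable : Integrable σ m
  measure_compl : m (Ω : Set (Space n))ᶜ = 0
  integral_eq : ∀ φ : 𝓓(Ω, ℝ), ∀ i j : Fin n,
    ∫ x, φ x * σ x (i, j) ∂m = - ∫ x in Ω, (u x i * (∇ φ x) j + u x j * (∇ φ x) i) / 2

variable {Ω : Opens (Space n)} {u : Space n → Space n}

theorem HasStrain.variation_compl {μ : VectorMeasure (Space n) (Mat n)} (h : HasStrain Ω u μ) :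
    μ.variation (Ω : Set (Space n))ᶜ = 0 := by
  have hΩ : MeasurableSet (Ω : Set (Space n)) := Ω.isOpen.measurableSet
  have hvar := VectorMeasure.variation_restrict (μ := μ) hΩ
  rw [h.restrict_eq] at hvar
  rw [hvar, Measure.restrict_apply hΩ.compl, Set.compl_inter_self, measure_empty]

theorem HasStrain.exists_isStrainDensity {μ : VectorMeasure (Space n) (Mat n)}
    (h : HasStrain Ω u μ) :
    ∃ σ, IsStrainDensity Ω u μ.variation σ ∧ μ.variation.withDensityᵥ σ = μ := by
  have : IsFiniteMeasure μ.variation := ⟨h.variation_lt_top⟩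
  obtain ⟨σ, hσm, hσi, hσ⟩ := exists_integrable_withDensityᵥ_variation_eq μ
  refine ⟨σ, ⟨hσm, hσi, h.variation_compl, fun φ i j => ?_⟩, hσ⟩
  obtain ⟨C, hC⟩ := φ.continuous.bounded_above_of_compact_support φ.hasCompactSupport
  have hφσ : Integrable (fun x => φ x • σ x) μ.variation :=
    hσi.bdd_smul (φ := φ) C φ.aestronglyMeasurable (ae_of_all _ hC)
  have hφμ : (μ.variation.withDensityᵥ σ).Integrable φ := by
    rw [hσ]
    exact (integrable_const C).mono' φ.aestronglyMeasurable (ae_of_all _ hC)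
  calc ∫ x, φ x * σ x (i, j) ∂μ.variation
      = (∫ x, φ x • σ x ∂μ.variation) (i, j) :=
        (EuclideanSpace.proj (𝕜 := ℝ) (i, j)).integral_comp_comm hφσ
    _ = (∫ᵛ x, φ x ∂•μ) (i, j) := by rw [← integral_withDensityᵥ hσi hφμ, hσ]
    _ = _ := h.integral_eq φ i j

/-- The quadratic form `ξ ↦ A ξ · ξ` of a matrix `A`. -/
def quadForm (A : Mat n) (ξ : Space n) : ℝ := ∑ i, ∑ j, ξ i * ξ j * A (i, j)

theorem integrable_mul_gradient {μ : Measure (Space n)} (hu : Integrable u μ) {φ : Space n → ℝ}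
    (hφ : ContDiff ℝ (⊤ : ℕ∞) φ) (hc : HasCompactSupport φ) (i j : Fin n) :
    Integrable (fun x => u x i * (∇ φ x) j) μ :=
  integrable_mul_of_hasCompactSupport (integrable_piLp_iff.1 hu i)
    (continuous_gradient_coord hφ j) (hasCompactSupport_gradient_coord hc j)

theorem inner_mul_inner_eq_sum (a b ξ : Space n) :
    inner ℝ a ξ * inner ℝ b ξ = ∑ i, ∑ j, ξ i * ξ j * ((a i * b j + a j * b i) / 2) := by
  have hsum : inner ℝ a ξ * inner ℝ b ξ = ∑ i, ∑ j, ξ i * ξ j * (a i * b j) := by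
    simp only [PiLp.inner_apply, RCLike.inner_apply, conj_trivial, Finset.sum_mul_sum]
    exact Finset.sum_congr rfl fun i _ => Finset.sum_congr rfl fun j _ => by ring
  have hsymm : ∑ i, ∑ j, ξ i * ξ j * (a j * b i) = ∑ i, ∑ j, ξ i * ξ j * (a i * b j) := by
    rw [Finset.sum_comm]
    exact Finset.sum_congr rfl fun i _ => Finset.sum_congr rfl fun j _ => by ring
  calc inner ℝ a ξ * inner ℝ b ξ
      = (∑ i, ∑ j, ξ i * ξ j * (a i * b j) + ∑ i, ∑ j, ξ i * ξ j * (a j * b i)) / 2 := by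
        rw [hsymm, hsum]
        ring
    _ = _ := by
        simp only [← Finset.sum_add_distrib, Finset.sum_div]
        exact Finset.sum_congr rfl fun i _ => Finset.sum_congr rfl fun j _ => by ring

namespace IsStrainDensity

variable {m : Measure (Space n)} {σ : Space n → Mat n}

theorem integral_quadForm (h : IsStrainDensity Ω u m σ) (hu : MemLp u 1 (volume.restrict Ω))
    (φ : 𝓓(Ω, ℝ)) (ξ : Space n) :
    ∫ x, φ x * quadForm (σ x) ξ ∂m = - ∫ x in Ω, inner ℝ (u x) ξ * fderiv ℝ φ x ξ := by
  have hσ (i j : Fin n) : Integrable (fun x => φ x * σ x (i, j)) m := by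
    simpa only [mul_comm] using integrable_mul_of_hasCompactSupport
      (integrable_piLp_iff.1 h.integrable (i, j)) φ.continuous φ.hasCompactSupport
  have hmul := integrable_mul_gradient (memLp_one_iff_integrable.1 hu) φ.contDiff
    φ.hasCompactSupport
  have hu' (i j : Fin n) : Integrable (fun x => (u x i * (∇ φ x) j + u x j * (∇ φ x) i) / 2)
      (volume.restrict (Ω : Set (Space n))) :=
    ((hmul i j).add (hmul j i)).div_const 2
  have hφσ (x : Space n) : φ x * quadForm (σ x) ξ =
      ∑ i, ∑ j, ξ i * ξ j * (φ x * σ x (i, j)) := by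
    simp only [quadForm, Finset.mul_sum]
    exact Finset.sum_congr rfl fun i _ => Finset.sum_congr rfl fun j _ => by ring
  simp_rw [hφσ, fderiv_eq_inner_gradient, inner_mul_inner_eq_sum]
  rw [integral_finsetSum _ fun i _ => integrable_finsetSum _ fun j _ => (hσ i j).const_mul _,
    integral_finsetSum _ fun i _ => integrable_finsetSum _ fun j _ => (hu' i j).const_mul _,
    ← Finset.sum_neg_distrib]
  refine Finset.sum_congr rfl fun i _ => ?_
  rw [integral_finsetSum _ fun j _ => (hσ i j).const_mul _,
    integral_finsetSum _ fun j _ => (hu' i j).const_mul _, ← Finset.sum_neg_distrib]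
  refine Finset.sum_congr rfl fun j _ => ?_
  rw [integral_const_mul, integral_const_mul, h.integral_eq, mul_neg]

theorem fderiv_mollify (h : IsStrainDensity Ω u m σ) (hu : MemLp u 1 (volume.restrict Ω))
    {φ : Space n → ℝ} (hφ : ContDiff ℝ (⊤ : ℕ∞) φ) (hc : HasCompactSupport φ)
    {g : Space n → ℝ} {δ : ℝ} (hg : IsMollifier g δ) (ξ : Space n) {x : Space n}
    (hx : ∀ y, x - y ∈ tsupport g → y ∈ tsupport φ → y ∈ Ω) :
    fderiv ℝ (mollify g ((Ω : Set (Space n)).indicator fun y => φ y * inner ℝ (u y) ξ)) x ξ =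
      ∫ y, g (x - y) * (φ y * quadForm (σ y) ξ) ∂m +
        ∫ y in Ω, g (x - y) * (inner ℝ (u y) ξ * fderiv ℝ φ y ξ) := by
  have hΩ : MeasurableSet (Ω : Set (Space n)) := Ω.isOpen.measurableSet
  have huξ : Integrable (fun y => inner ℝ (u y) ξ) (volume.restrict (Ω : Set (Space n))) :=
    (memLp_one_iff_integrable.1 hu).inner_const ξ
  have hgx : ContDiff ℝ (⊤ : ℕ∞) fun y => g (x - y) :=
    hg.contDiff.comp (contDiff_const.sub contDiff_id)
  have hdg : Continuous fun y => fderiv ℝ g (x - y) ξ :=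
    ((hg.contDiff.continuous_fderiv (by simp)).comp (continuous_const.sub continuous_id)).clm_apply
      continuous_const
  have hdφ : Continuous fun y => fderiv ℝ φ y ξ :=
    (hφ.continuous_fderiv (by simp)).clm_apply continuous_const
  let ψ : 𝓓(Ω, ℝ) := kernelTest hg.contDiff hg.hasCompactSupport hφ x hx
  have hψ : (ψ : Space n → ℝ) = fun y => g (x - y) * φ y := rfl
  have hdψ (y : Space n) : fderiv ℝ (fun y => g (x - y) * φ y) y ξ =
      fderiv ℝ φ y ξ * g (x - y) - fderiv ℝ g (x - y) ξ * φ y := by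
    rw [fderiv_fun_mul (hgx.differentiable (by simp) y) (hφ.differentiable (by simp) y)]
    simp only [add_apply, _root_.smul_apply, fderiv_kernel_sub_apply hg.contDiff, smul_eq_mul]
    ring
  have hφ_int : Integrable (fun y => inner ℝ (u y) ξ * (fderiv ℝ φ y ξ * g (x - y)))
      (volume.restrict (Ω : Set (Space n))) :=
    integrable_mul_of_hasCompactSupport huξ (hdφ.mul hgx.continuous)
      ((hc.fderiv_apply ℝ ξ).mul_right)
  have hg_int : Integrable (fun y => inner ℝ (u y) ξ * (fderiv ℝ g (x - y) ξ * φ y))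
      (volume.restrict (Ω : Set (Space n))) :=
    integrable_mul_of_hasCompactSupport huξ (hdg.mul hφ.continuous) hc.mul_left
  have hstrain := h.integral_quadForm hu ψ ξ
  simp_rw [hψ, hdψ, mul_sub, integral_sub hφ_int hg_int] at hstrain
  have hconv : ∫ y, fderiv ℝ g (x - y) ξ •
      (Ω : Set (Space n)).indicator (fun y => φ y * inner ℝ (u y) ξ) y =
        ∫ y in Ω, inner ℝ (u y) ξ * (fderiv ℝ g (x - y) ξ * φ y) := by
    rw [← integral_indicator hΩ]
    congr with y
    by_cases hy : y ∈ (Ω : Set (Space n)) <;> simp [hy]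
    ring
  have hcomm (y : Space n) : g (x - y) * (inner ℝ (u y) ξ * fderiv ℝ φ y ξ) =
      inner ℝ (u y) ξ * (fderiv ℝ φ y ξ * g (x - y)) := by ring
  have hf := (integrable_indicator_mul_inner hu hφ.continuous hc ξ).locallyIntegrable
  simp_rw [hg.fderiv_mollify hf, hconv, hcomm, ← mul_assoc (g _) (φ _), hstrain]
  ring

end IsStrainDensity

end Strain

/-! ### The Gagliardo inequality along a basis -/

section Gagliardo

variable {E ι : Type*} [NormedAddCommGroup E] [NormedSpace ℝ E]

theorem enorm_le_lintegral_Iic_fderiv {f : E → ℝ} (hf : ContDiff ℝ 1 f)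
    (hc : HasCompactSupport f) {v : E} (hv : v ≠ 0) (x : E) :
    ‖f x‖ₑ ≤ ∫⁻ t in Set.Iic (0 : ℝ), ‖fderiv ℝ f (x - t • v) v‖ₑ := by
  have hline (t : ℝ) : HasDerivAt (fun t : ℝ => x - t • v) (-v) t := by
    simpa using ((hasDerivAt_id t).smul_const v).const_sub x
  have hderiv (t : ℝ) : deriv (fun t : ℝ => f (x - t • v)) t = -fderiv ℝ f (x - t • v) v := by
    have hcomp := (hf.differentiable (by simp) (x - t • v)).hasFDerivAt.comp_hasDerivAt t (hline t)
    simpa [Function.comp_def] using hcomp.deriv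
  have hclosed : IsClosedEmbedding fun t : ℝ => x - t • v :=
    (Homeomorph.subLeft x).isClosedEmbedding.comp (isClosedEmbedding_smul_left hv)
  have h := HasCompactSupport.enorm_le_lintegral_Ici_deriv (f := fun t : ℝ => f (x - t • v))
    (hf.comp (contDiff_const.sub (contDiff_id.smul contDiff_const)))
    (hc.comp_isClosedEmbedding hclosed) 0
  simpa [hderiv] using h

variable [MeasurableSpace E] [BorelSpace E] [Fintype ι] [Nontrivial ι]

theorem exists_lintegral_prod_lintegral_rpow_le (μ : Measure E) [μ.IsAddHaarMeasure]
    (b : Module.Basis ι ℝ E) :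
    ∃ C : ℝ≥0∞, C ≠ ∞ ∧ ∀ F : E → ℝ≥0∞, Measurable F →
      ∫⁻ x, ∏ i, (∫⁻ t : ℝ, F (x - t • b i)) ^ ((1 : ℝ) / (Fintype.card ι - 1)) ∂μ ≤
        C * (∫⁻ x, F x ∂μ) ^ ((Fintype.card ι : ℝ) / (Fintype.card ι - 1)) := by
  classical
  have : FiniteDimensional ℝ E := b.finiteDimensional_of_finite
  have hcard : (1 : ℝ) < Fintype.card ι := by exact_mod_cast Fintype.one_lt_card
  set p := (Fintype.card ι : ℝ) / (Fintype.card ι - 1)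
  have hp : Real.HolderConjugate (Fintype.card ι) p :=
    (Real.holderConjugate_iff_eq_conjExponent hcard).2 rfl
  let T : (ι → ℝ) ≃L[ℝ] E := b.equivFunL.symm
  have hT_update (y : ι → ℝ) (i : ι) (t : ℝ) :
      T (Function.update y i t) = T y - (y i - t) • b i := by
    have hupdate : Function.update y i t = y - (y i - t) • Pi.single i 1 := by
      ext j
      rcases eq_or_ne j i with rfl | hj <;> simp [*]
    have hTi : T (Pi.single i 1) = b i :=
      b.equivFun.symm_apply_eq.2 <| funext fun j => by
        simp [Module.Basis.equivFun_self, Pi.single_apply, eq_comm]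
    rw [hupdate, map_sub, map_smul, hTi]
  obtain ⟨c, hc⟩ : ∃ c : ℝ≥0, μ = c • (volume : Measure (ι → ℝ)).map T :=
    ⟨_, Measure.isAddLeftInvariant_eq_smul _ _⟩
  have hc0 : c ≠ 0 := by
    rintro rfl
    exact NeZero.ne μ (by rw [hc, zero_smul])
  have hμ (F : E → ℝ≥0∞) : ∫⁻ x, F x ∂μ = c * ∫⁻ y, F (T y) := by
    conv_lhs => rw [hc]
    rw [lintegral_smul_measure]
    exact congrArg (c • ·) (T.toHomeomorph.measurableEmbedding.lintegral_map F)
  refine ⟨c * (c : ℝ≥0∞)⁻¹ ^ p, ENNReal.mul_ne_top (by simp)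
    (ENNReal.rpow_ne_top_of_nonneg hp.symm.nonneg (by simpa using hc0)), fun F hF => ?_⟩
  calc ∫⁻ x, ∏ i, (∫⁻ t : ℝ, F (x - t • b i)) ^ ((1 : ℝ) / (Fintype.card ι - 1)) ∂μ
      = c * ∫⁻ y, ∏ i, (∫⁻ t, F (T (Function.update y i t))) ^
          ((1 : ℝ) / (Fintype.card ι - 1)) := by
        simp_rw [hμ, hT_update]
        congr 1
        refine lintegral_congr fun y => Finset.prod_congr rfl fun i _ => ?_
        rw [lintegral_sub_left_eq_self (fun t => F (T y - t • b i)) (y i)]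
    _ ≤ c * (∫⁻ y, F (T y)) ^ p := by
        gcongr
        exact lintegral_prod_lintegral_pow_le (fun _ : ι => (volume : Measure ℝ)) hp
          (f := fun y => F (T y)) (hF.comp T.continuous.measurable)
    _ = c * (c : ℝ≥0∞)⁻¹ ^ p * (∫⁻ x, F x ∂μ) ^ p := by
        rw [hμ F, mul_assoc, ← ENNReal.mul_rpow_of_nonneg _ _ hp.symm.nonneg, ← mul_assoc,
          ENNReal.inv_mul_cancel (by simpa using hc0) (by simp), one_mul]

/-- The point of restricting to `S` is that `F` needs to dominate the derivatives on `S` only: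
a ray in direction `b i` that starts in `S` stays in `S` as long as it is in `B`. -/
theorem exists_lintegral_prod_rpow_le (μ : Measure E) [μ.IsAddHaarMeasure]
    (b : Module.Basis ι ℝ E) :
    ∃ C : ℝ≥0∞, C ≠ ∞ ∧ ∀ (S B : Set E), MeasurableSet S →
      (∀ x ∈ S, ∀ i, ∀ t : ℝ, 0 ≤ t → x + t • b i ∈ B → x + t • b i ∈ S) →
      ∀ H : ι → E → ℝ, (∀ i, ContDiff ℝ 1 (H i)) → (∀ i, HasCompactSupport (H i)) →
      ∀ F : E → ℝ≥0∞, Measurable F →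
      (∀ i, ∀ x ∈ S, ‖fderiv ℝ (H i) x (b i)‖ₑ ≤ F x) → (∀ i, ∀ x ∉ B, fderiv ℝ (H i) x = 0) →
      ∫⁻ x in S, ∏ i, ‖H i x‖ₑ ^ ((1 : ℝ) / (Fintype.card ι - 1)) ∂μ ≤
        C * (∫⁻ x, F x ∂μ) ^ ((Fintype.card ι : ℝ) / (Fintype.card ι - 1)) := by
  have hcard : (1 : ℝ) < Fintype.card ι := by exact_mod_cast Fintype.one_lt_card
  obtain ⟨C, hC, hle⟩ := exists_lintegral_prod_lintegral_rpow_le μ b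
  refine ⟨C, hC, fun S B hS hray H hH hHc F hF hHF hHB => le_trans ?_ (hle F hF)⟩
  refine (setLIntegral_mono' hS fun x hx => ?_).trans (setLIntegral_le_lintegral S _)
  refine Finset.prod_le_prod' fun i _ => ENNReal.rpow_le_rpow ?_ (by simpa using hcard.le)
  calc ‖H i x‖ₑ ≤ ∫⁻ t in Set.Iic (0 : ℝ), ‖fderiv ℝ (H i) (x - t • b i) (b i)‖ₑ :=
        enorm_le_lintegral_Iic_fderiv (hH i) (hHc i) (b.ne_zero i) x
    _ ≤ ∫⁻ t in Set.Iic (0 : ℝ), F (x - t • b i) := by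
        refine setLIntegral_mono' measurableSet_Iic fun t ht => ?_
        by_cases hB : x - t • b i ∈ B
        · refine hHF i _ ?_
          rw [sub_eq_add_neg, ← neg_smul] at hB ⊢
          exact hray x hx i _ (neg_nonneg.2 ht) hB
        · simp [hHB i _ hB]
    _ ≤ ∫⁻ t : ℝ, F (x - t • b i) := setLIntegral_le_lintegral _ _

end Gagliardo

section Bases

variable {n : ℕ} [NeZero n]

theorem eq_zero_of_forall_inner_add_pow_eq_zero {e : Space n} {s : ℝ} (hs : s ≠ 0)
    (hes : e 0 + s ≠ 0) {τ : Fin n → ℝ} (hτ : Function.Injective τ) {w : Space n}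
    (hw : ∀ k, inner ℝ w (e + s • WithLp.toLp 2 fun j : Fin n => τ k ^ (j : ℕ)) = 0) : w = 0 := by
  have hcoeff : (fun j => (if j = 0 then inner ℝ w e else 0) + s * w j) = 0 := by
    refine Matrix.eq_zero_of_forall_index_sum_pow_mul_eq_zero hτ fun k => ?_
    have hinner : inner ℝ w (WithLp.toLp 2 fun j : Fin n => τ k ^ (j : ℕ)) =
        ∑ j : Fin n, τ k ^ (j : ℕ) * w j := by simp [PiLp.inner_apply]
    calc ∑ j : Fin n, τ k ^ (j : ℕ) * ((if j = 0 then inner ℝ w e else 0) + s * w j)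
        = inner ℝ w e + s * ∑ j : Fin n, τ k ^ (j : ℕ) * w j := by
          simp [mul_add, Finset.sum_add_distrib, Finset.mul_sum, mul_left_comm s]
      _ = 0 := by rw [← hinner, ← inner_smul_right, ← inner_add_right, hw k]
  have hw_succ (j : Fin n) (hj : j ≠ 0) : w j = 0 := by
    simpa [hj, hs] using congrFun hcoeff j
  have hwe : inner ℝ w e = w 0 * e 0 := by
    rw [PiLp.inner_apply, Finset.sum_eq_single 0 (fun j _ hj => by simp [hw_succ j hj]) (by simp)]
    simp [mul_comm]
  have hw_zero : w 0 = 0 := by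
    have h : w 0 * (e 0 + s) = 0 := by
      have := congrFun hcoeff 0
      simp only [if_true, hwe, Pi.zero_apply] at this
      linarith
    exact (mul_eq_zero.1 h).resolve_right hes
  ext j
  by_cases hj : j = 0
  · rw [hj, hw_zero, PiLp.zero_apply]
  · rw [hw_succ j hj, PiLp.zero_apply]

theorem exists_generic_family (e : Space n) {κ : ℝ} (hκ : 0 < κ) (ι : Type*) [Finite ι] :
    ∃ v : ι → Space n, (∀ k, ‖v k - e‖ < κ) ∧ ∀ f : Fin n → ι, Function.Injective f →
      ∀ w, (∀ i, inner ℝ w (v (f i)) = 0) → w = 0 := by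
  have := Fintype.ofFinite ι
  let τ : ι → ℝ := fun k => (Fintype.equivFin ι k : ℕ)
  have hτ : Function.Injective τ := fun k k' h =>
    (Fintype.equivFin ι).injective (Fin.ext (Nat.cast_injective h))
  let z : ι → Space n := fun k => WithLp.toLp 2 fun j : Fin n => τ k ^ (j : ℕ)
  obtain ⟨M, hM⟩ := (Set.finite_range fun k => ‖z k‖).bddAbove
  obtain ⟨s, ⟨hs0, hsκ⟩, hse⟩ :=
    (Set.Ioo_infinite (show 0 < κ / (|M| + 1) by positivity)).exists_notMem_finset {-e 0}
  refine ⟨fun k => e + s • z k, fun k => ?_, fun f hf w hw => ?_⟩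
  · rw [add_sub_cancel_left, norm_smul, Real.norm_of_nonneg hs0.le]
    calc s * ‖z k‖ ≤ s * (|M| + 1) := by
          gcongr
          linarith [hM ⟨k, rfl⟩, le_abs_self M]
      _ < κ := (lt_div_iff₀ (by positivity)).1 hsκ
  · refine eq_zero_of_forall_inner_add_pow_eq_zero hs0.ne' (fun h => hse ?_) (hτ.comp hf) hw
    rw [Finset.mem_singleton]
    linarith

theorem exists_bases_near (e : Space n) {κ : ℝ} (hκ : 0 < κ) :
    ∃ b : Fin n → Module.Basis (Fin n) ℝ (Space n), (∀ k i, ‖b k i - e‖ < κ) ∧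
      ∀ w : Space n, w ≠ 0 → ∃ k, ∀ i, inner ℝ w (b k i) ≠ 0 := by
  obtain ⟨v, hv_near, hv⟩ := exists_generic_family e hκ (Fin n × Fin n)
  have hspan (k : Fin n) : Submodule.span ℝ (Set.range fun i => v (k, i)) = ⊤ := by
    rw [← Submodule.orthogonal_eq_bot_iff, Submodule.eq_bot_iff]
    refine fun w hw => hv (fun i => (k, i)) (Prod.mk_right_injective k) w fun i => ?_
    rw [real_inner_comm]
    exact (Submodule.mem_orthogonal _ _).1 hw _ (Submodule.subset_span ⟨i, rfl⟩)
  let b (k : Fin n) := basisOfTopLeSpanOfCardEqFinrank (fun i => v (k, i)) (hspan k).ge (by simp)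
  have hb (k i : Fin n) : b k i = v (k, i) := by simp [b]
  refine ⟨b, fun k i => hb k i ▸ hv_near (k, i), fun w hw => ?_⟩
  by_contra! hcon
  choose j hj using hcon
  exact hw (hv (fun k => (k, j k)) (fun _ _ h => (Prod.ext_iff.1 h).1) w fun k => hb k (j k) ▸ hj k)

end Bases

theorem exists_pos_mul_norm_rpow_le {E : Type*} [NormedAddCommGroup E] [NormedSpace ℝ E]
    [FiniteDimensional ℝ E] {f : E → ℝ} (hf : Continuous f) (hpos : ∀ x, x ≠ 0 → 0 < f x) {p : ℝ}
    (hp : 0 < p) (hhom : ∀ (r : ℝ) (x : E), 0 ≤ r → f (r • x) = r ^ p * f x) :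
    ∃ c : ℝ, 0 < c ∧ ∀ x, c * ‖x‖ ^ p ≤ f x := by
  have hzero : f 0 = 0 := by simpa [Real.zero_rpow hp.ne'] using hhom 0 0 le_rfl
  rcases subsingleton_or_nontrivial E with _ | _
  · exact ⟨1, one_pos, fun x => by simp [Subsingleton.elim x 0, Real.zero_rpow hp.ne', hzero]⟩
  have hne : (Metric.sphere (0 : E) 1).Nonempty := NormedSpace.sphere_nonempty.2 zero_le_one
  obtain ⟨x₀, hx₀, hmin⟩ := (isCompact_sphere (0 : E) 1).exists_isMinOn hne hf.continuousOn
  refine ⟨f x₀, hpos x₀ (Metric.ne_of_mem_sphere hx₀ one_ne_zero), fun x => ?_⟩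
  rcases eq_or_ne x 0 with rfl | hx
  · simp [Real.zero_rpow hp.ne', hzero]
  have hunit : ‖x‖⁻¹ • x ∈ Metric.sphere (0 : E) 1 := by simp [norm_smul, hx]
  calc f x₀ * ‖x‖ ^ p ≤ f (‖x‖⁻¹ • x) * ‖x‖ ^ p := by
        gcongr
        exact hmin hunit
    _ = f x := by
        rw [mul_comm, ← hhom _ _ (norm_nonneg x), smul_inv_smul₀ (norm_ne_zero_iff.2 hx)]

theorem exists_pos_mul_norm_rpow_le_sum_prod {n : ℕ} (hn : 2 ≤ n) {κ : Type*} [Fintype κ]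
    {ξ : κ → Fin n → Space n} (hξ : ∀ w : Space n, w ≠ 0 → ∃ k, ∀ i, inner ℝ w (ξ k i) ≠ 0) :
    ∃ c : ℝ, 0 < c ∧ ∀ w : Space n, c * ‖w‖ ^ ((n : ℝ) / (n - 1)) ≤
      ∑ k, ∏ i, |inner ℝ w (ξ k i)| ^ ((1 : ℝ) / (n - 1)) := by
  have hn1 : (0 : ℝ) < n - 1 := by
    have : (2 : ℝ) ≤ n := by exact_mod_cast hn
    linarith
  refine exists_pos_mul_norm_rpow_le ?_ (fun w hw => ?_) (by positivity) fun r w hr => ?_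
  · refine continuous_finsetSum _ fun k _ => continuous_finsetProd _ fun i _ => ?_
    exact Continuous.rpow_const (by fun_prop) fun _ => Or.inr (by positivity)
  · obtain ⟨k, hk⟩ := hξ w hw
    refine Finset.sum_pos' (fun k _ => Finset.prod_nonneg fun i _ => by positivity)
      ⟨k, Finset.mem_univ k, Finset.prod_pos fun i _ => ?_⟩
    exact Real.rpow_pos_of_pos (abs_pos.2 (hk i)) _
  · simp only [Finset.mul_sum, inner_smul_left, RCLike.conj_to_real, abs_mul, abs_of_nonneg hr]
    refine Finset.sum_congr rfl fun k _ => ?_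
    simp_rw [Real.mul_rpow hr (abs_nonneg _)]
    rw [Finset.prod_mul_distrib, Finset.prod_const, Finset.card_univ, Fintype.card_fin,
      ← Real.rpow_mul_natCast hr]
    congr 2
    field_simp

/-! ### The embedding of `BD(Ω)` into `L^{n/(n-1)}` -/

section ConvergenceInMeasure

variable {X ι : Type*} [MeasurableSpace X] {μ : Measure X} [Fintype ι]

theorem tendstoInMeasure_pi {κ : Type*} {l : Filter κ} {Y : ι → Type*}
    [∀ i, PseudoEMetricSpace (Y i)] {f : κ → X → ∀ i, Y i} {g : X → ∀ i, Y i}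
    (h : ∀ i, TendstoInMeasure μ (fun k x => f k x i) l fun x => g x i) :
    TendstoInMeasure μ f l g := by
  intro ε hε
  have hsum : Tendsto (fun k => ∑ i, μ {x | ε ≤ edist (f k x i) (g x i)}) l (𝓝 0) := by
    simpa using tendsto_finsetSum Finset.univ fun i _ => h i ε hε
  refine tendsto_of_tendsto_of_tendsto_of_le_of_le tendsto_const_nhds hsum (fun _ => zero_le)
    fun k => (measure_mono fun x hx => ?_).trans (measure_iUnion_fintype_le _ _)
  by_contra hlt
  simp only [Set.mem_iUnion, Set.mem_ofPred_eq, not_exists, not_le] at hlt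
  exact ((edist_pi_def _ _).trans_lt ((Finset.sup_lt_iff hε).2 fun i _ => hlt i)).not_ge hx

theorem lintegral_prod_enorm_rpow_le_of_tendstoInMeasure {H : ℕ → ι → X → ℝ} {f : ι → X → ℝ}
    (hH : ∀ k i, AEMeasurable (H k i) μ)
    (hlim : ∀ i, TendstoInMeasure μ (fun k => H k i) atTop (f i)) {s : ℝ} (hs : 0 ≤ s) {C : ℝ≥0∞}
    (hC : ∀ k, ∫⁻ x, ∏ i, ‖H k i x‖ₑ ^ s ∂μ ≤ C) : ∫⁻ x, ∏ i, ‖f i x‖ₑ ^ s ∂μ ≤ C := by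
  obtain ⟨ns, -, hns⟩ := (tendstoInMeasure_pi (f := fun k x i => H k i x)
    (g := fun x i => f i x) hlim).exists_seq_tendsto_ae
  have hprod : ∀ᵐ x ∂μ, Tendsto (fun k => ∏ i, ‖H (ns k) i x‖ₑ ^ s) atTop
      (𝓝 (∏ i, ‖f i x‖ₑ ^ s)) := by
    filter_upwards [hns] with x hx
    exact ENNReal.tendsto_finsetProd_of_ne_top _
      (fun i _ => ((tendsto_pi_nhds.1 hx i).enorm).ennrpow_const _)
      fun i _ => ENNReal.rpow_ne_top_of_nonneg hs enorm_ne_top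
  calc ∫⁻ x, ∏ i, ‖f i x‖ₑ ^ s ∂μ
      = ∫⁻ x, liminf (fun k => ∏ i, ‖H (ns k) i x‖ₑ ^ s) atTop ∂μ :=
        lintegral_congr_ae (hprod.mono fun x hx => hx.liminf_eq.symm)
    _ ≤ liminf (fun k => ∫⁻ x, ∏ i, ‖H (ns k) i x‖ₑ ^ s ∂μ) atTop :=
        lintegral_liminf_le' fun k =>
          Finset.aemeasurable_fun_prod _ fun i _ => ((hH _ i).enorm.pow_const _)
    _ ≤ C := liminf_le_of_le ⟨0, by simp⟩ fun b hb => by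
        obtain ⟨k, hk⟩ := hb.exists
        exact hk.trans (hC _)

end ConvergenceInMeasure

section Cone

variable {n : ℕ}

/-- The uniform interior cone condition for `Ω` near `x₀`: inside the ball of radius `r` about
`x₀`, moving from a point of `Ω` in a direction at distance less than `κ` from `e` does not leave
`Ω`. -/
def ConeCondition (Ω : Set (Space n)) (x₀ e : Space n) (r κ : ℝ) : Prop :=
  ∀ x ∈ Ω, x ∈ Metric.ball x₀ r → ∀ z, ‖z - e‖ < κ → ∀ t : ℝ, 0 ≤ t →
    x + t • z ∈ Metric.ball x₀ r → x + t • z ∈ Ω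

theorem norm_sub_inner_smul_le {E : Type*} [NormedAddCommGroup E] [InnerProductSpace ℝ E] {e : E}
    (he : ‖e‖ = 1) (w : E) : ‖w - inner ℝ e w • e‖ ≤ ‖w‖ := by
  refine le_of_sq_le_sq ?_ (norm_nonneg _)
  rw [norm_sub_sq_real, inner_smul_right, norm_smul, he, Real.norm_eq_abs, mul_one, sq_abs,
    real_inner_comm e w]
  nlinarith [sq_nonneg (inner ℝ e w)]

theorem coneCondition_of_supergraph {Ω : Set (Space n)} {x₀ e : Space n} (he : ‖e‖ = 1) {r : ℝ}
    {K : ℝ≥0} {γ : Space n → ℝ} (hγ : LipschitzWith K γ)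
    (hΩ : ∀ y ∈ Metric.ball x₀ r, y ∈ Ω ↔ γ (y - inner ℝ e y • e) < inner ℝ e y) :
    ConeCondition Ω x₀ e r (1 / (K + 1)) := by
  intro x hxΩ hxr z hz t ht hxt
  rw [hΩ _ hxt]
  obtain ⟨w, rfl⟩ : ∃ w, z = e + w := ⟨z - e, by abel⟩
  rw [add_sub_cancel_left, lt_div_iff₀ (by positivity)] at hz
  have hee : inner ℝ e e = (1 : ℝ) := by rw [real_inner_self_eq_norm_sq, he, one_pow]
  have hew : -‖w‖ ≤ inner ℝ e w := neg_le_of_abs_le (by simpa [he] using abs_real_inner_le_norm e w)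
  have hvert : inner ℝ e (x + t • (e + w)) = inner ℝ e x + t * (1 + inner ℝ e w) := by
    rw [inner_add_right, inner_smul_right, inner_add_right, hee]
  have hhor : x + t • (e + w) - inner ℝ e (x + t • (e + w)) • e - (x - inner ℝ e x • e) =
      t • (w - inner ℝ e w • e) := by
    rw [hvert]
    module
  calc γ (x + t • (e + w) - inner ℝ e (x + t • (e + w)) • e)
      ≤ γ (x - inner ℝ e x • e) + K * ‖t • (w - inner ℝ e w • e)‖ := by
        rw [← hhor, ← dist_eq_norm]
        exact hγ.le_add_mul _ _
    _ ≤ γ (x - inner ℝ e x • e) + K * (t * ‖w‖) := by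
        rw [norm_smul, Real.norm_of_nonneg ht]
        gcongr
        exact norm_sub_inner_smul_le he w
    _ < inner ℝ e x + K * (t * ‖w‖) := by
        gcongr
        exact (hΩ x hxr).1 hxΩ
    _ ≤ inner ℝ e x + t * (1 + inner ℝ e w) := by nlinarith
    _ = inner ℝ e (x + t • (e + w)) := hvert.symm

theorem HasLipschitzBoundary.exists_coneCondition {Ω : Set (Space n)} (hΩ : IsOpen Ω)
    (hL : HasLipschitzBoundary Ω) {x₀ : Space n} (hx₀ : x₀ ∈ closure Ω) :
    ∃ (e : Space n) (r κ : ℝ), 0 < r ∧ 0 < κ ∧ ConeCondition Ω x₀ e r κ := by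
  by_cases hx : x₀ ∈ Ω
  · obtain ⟨r, hr, hball⟩ := Metric.isOpen_iff.1 hΩ x₀ hx
    exact ⟨0, r, 1, hr, one_pos, fun _ _ _ _ _ _ _ h => hball h⟩
  · obtain ⟨e, r, K, γ, he, hr, hγ, hgraph⟩ := hL x₀ ⟨hx₀, by rwa [hΩ.interior_eq]⟩
    exact ⟨e, r, 1 / (K + 1), hr, by positivity, coneCondition_of_supergraph he hγ hgraph⟩

theorem exists_isMollifier_tsupport_subset_cone (e : Space n) {κ δ : ℝ} (hκ : 0 < κ) (hδ : 0 < δ) :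
    ∃ g, IsMollifier g δ ∧ ∀ z ∈ tsupport g, ∃ t : ℝ, 0 ≤ t ∧ ∃ w, ‖w - e‖ < κ ∧ z = -(t • w) := by
  set ε := δ / (‖e‖ + κ)
  have hε : 0 < ε := by positivity
  obtain ⟨g, hg, hgs⟩ := exists_isMollifier (-(ε • e)) (mul_pos hε (half_pos hκ))
  have hle : ε * (κ / 2) + ‖-(ε • e)‖ ≤ δ := by
    have hδε : δ = ε * (‖e‖ + κ) := (div_mul_cancel₀ δ (by positivity)).symm
    rw [norm_neg, norm_smul, Real.norm_of_nonneg hε.le]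
    nlinarith
  refine ⟨g, hg.mono hle, fun z hz => ⟨ε, hε.le, -(ε⁻¹ • z), ?_, ?_⟩⟩
  · have hdist : -(ε⁻¹ • z) - e = -(ε⁻¹ • (z - -(ε • e))) := by
      rw [smul_sub, smul_neg, inv_smul_smul₀ hε.ne']
      abel
    rw [hdist, norm_neg, norm_smul, norm_inv, Real.norm_of_nonneg hε.le, inv_mul_lt_iff₀ hε,
      ← dist_eq_norm]
    exact (Metric.mem_closedBall.1 (hgs hz)).trans_lt (by nlinarith [mul_pos hε hκ])
  · rw [smul_neg, smul_inv_smul₀ hε.ne', neg_neg]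

end Cone

theorem lintegral_lintegral_enorm_sub {E : Type*} [NormedAddCommGroup E] [NormedSpace ℝ E]
    [FiniteDimensional ℝ E] [MeasureSpace E] [BorelSpace E] [(volume : Measure E).IsAddHaarMeasure]
    {g : E → ℝ} {δ : ℝ} (hg : IsMollifier g δ) (M : Measure E) [SFinite M] :
    ∫⁻ x, ∫⁻ y, ‖g (x - y)‖ₑ ∂M = M Set.univ := by
  have hmeas : Measurable fun z : E × E => ‖g (z.1 - z.2)‖ₑ :=
    (hg.continuous.comp continuous_sub).enorm.measurable
  rw [lintegral_lintegral_swap hmeas.aemeasurable]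
  calc ∫⁻ y, (∫⁻ x, ‖g (x - y)‖ₑ) ∂M = ∫⁻ _, 1 ∂M :=
        lintegral_congr fun y => by
          rw [lintegral_sub_right_eq_self (fun x => ‖g x‖ₑ) y, hg.lintegral_enorm]
    _ = M Set.univ := lintegral_one

section Embedding

variable {n : ℕ} {Ω : Opens (Space n)} {u : Space n → Space n} {m : Measure (Space n)}
  {σ : Space n → Mat n}

namespace IsStrainDensity

theorem exists_enorm_fderiv_mollify_le (h : IsStrainDensity Ω u m σ)
    (hu : MemLp u 1 (volume.restrict Ω)) {φ : Space n → ℝ} (hφ : ContDiff ℝ (⊤ : ℕ∞) φ)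
    (hc : HasCompactSupport φ) (ξ : Space n) :
    ∃ M : Measure (Space n), IsFiniteMeasure M ∧ ∀ (g : Space n → ℝ) (δ : ℝ), IsMollifier g δ →
      ∀ x, (∀ y, x - y ∈ tsupport g → y ∈ tsupport φ → y ∈ Ω) →
      ‖fderiv ℝ (mollify g ((Ω : Set (Space n)).indicator fun y => φ y * inner ℝ (u y) ξ)) x ξ‖ₑ ≤
        ∫⁻ y, ‖g (x - y)‖ₑ ∂M := by
  have hquad : Integrable (fun y => φ y * quadForm (σ y) ξ) m := by
    simp_rw [mul_comm (φ _)]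
    refine integrable_mul_of_hasCompactSupport ?_ hφ.continuous hc
    exact integrable_finsetSum _ fun i _ => integrable_finsetSum _ fun j _ =>
      (integrable_piLp_iff.1 h.integrable (i, j)).const_mul _
  have hgrad : Integrable (fun y => inner ℝ (u y) ξ * fderiv ℝ φ y ξ)
      (volume.restrict (Ω : Set (Space n))) :=
    integrable_mul_of_hasCompactSupport ((memLp_one_iff_integrable.1 hu).inner_const ξ)
      ((hφ.continuous_fderiv (by simp)).clm_apply continuous_const)
      ((hc.fderiv ℝ).comp_left (g := fun L : Space n →L[ℝ] ℝ => L ξ) rfl)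
  refine ⟨m.withDensity (fun y => ‖φ y * quadForm (σ y) ξ‖ₑ) +
    (volume.restrict (Ω : Set (Space n))).withDensity fun y => ‖inner ℝ (u y) ξ * fderiv ℝ φ y ξ‖ₑ,
    ?_, fun g δ hg x hx => ?_⟩
  · have := isFiniteMeasure_withDensity hquad.2.ne
    have := isFiniteMeasure_withDensity hgrad.2.ne
    infer_instance
  · have hgx : Measurable fun y => ‖g (x - y)‖ₑ :=
      (hg.continuous.comp (continuous_const.sub continuous_id)).enorm.measurable
    rw [h.fderiv_mollify hu hφ hc hg ξ hx, lintegral_add_measure,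
      lintegral_withDensity_eq_lintegral_mul₀ hquad.1.enorm hgx.aemeasurable,
      lintegral_withDensity_eq_lintegral_mul₀ hgrad.1.enorm hgx.aemeasurable]
    refine (enorm_add_le _ _).trans (add_le_add ?_ ?_)
    all_goals
      refine (enorm_integral_le_lintegral_enorm _).trans (lintegral_mono fun y => ?_)
      rw [enorm_mul, mul_comm, Pi.mul_apply]

variable {x₀ e : Space n} {r κ : ℝ} {φ : Space n → ℝ}

theorem exists_lintegral_prod_mollify_le [Nontrivial (Fin n)] (h : IsStrainDensity Ω u m σ)
    (hu : MemLp u 1 (volume.restrict Ω)) (hcone : ConeCondition (Ω : Set (Space n)) x₀ e r κ)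
    (hφ : ContDiff ℝ (⊤ : ℕ∞) φ) (hφs : tsupport φ ⊆ Metric.closedBall x₀ (r / 2))
    (b : Module.Basis (Fin n) ℝ (Space n)) (hb : ∀ i, ‖b i - e‖ < κ) :
    ∃ C : ℝ≥0∞, C ≠ ∞ ∧ ∀ (g : Space n → ℝ) (δ : ℝ), IsMollifier g δ → 0 < δ → δ < r / 2 →
      (∀ z ∈ tsupport g, ∃ t : ℝ, 0 ≤ t ∧ ∃ w, ‖w - e‖ < κ ∧ z = -(t • w)) →
      ∫⁻ x in (Ω : Set (Space n)) ∩ Metric.ball x₀ r, ∏ i, ‖mollify g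
          ((Ω : Set (Space n)).indicator fun y => φ y * inner ℝ (u y) (b i)) x‖ₑ ^
            ((1 : ℝ) / (n - 1)) ≤ C := by
  have hΩ : MeasurableSet (Ω : Set (Space n)) := Ω.isOpen.measurableSet
  have hc : HasCompactSupport φ :=
    (isCompact_closedBall x₀ (r / 2)).of_isClosed_subset (isClosed_tsupport φ) hφs
  have hcard : (0 : ℝ) ≤ (n : ℝ) / (n - 1) := by
    have : (1 : ℝ) < n := by simpa using (Fintype.one_lt_card (α := Fin n))
    exact div_nonneg (by positivity) (by linarith)
  let f (i : Fin n) : Space n → ℝ :=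
    (Ω : Set (Space n)).indicator fun y => φ y * inner ℝ (u y) (b i)
  have hf_int (i : Fin n) : Integrable (f i) :=
    integrable_indicator_mul_inner hu hφ.continuous hc (b i)
  have hf_supp (i : Fin n) : tsupport (f i) ⊆ Metric.closedBall x₀ (r / 2) := by
    refine (closure_mono fun y hy => ?_).trans hφs
    exact left_ne_zero_of_mul (Set.indicator_apply_ne_zero.1 hy).2
  choose M hMfin hM using fun i => h.exists_enorm_fderiv_mollify_le hu hφ hc (b i)
  obtain ⟨C, hC, hprod⟩ := exists_lintegral_prod_rpow_le volume b
  simp only [Fintype.card_fin] at hprod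
  refine ⟨C * (∑ i, M i) Set.univ ^ ((n : ℝ) / (n - 1)),
    ENNReal.mul_ne_top hC (ENNReal.rpow_ne_top_of_nonneg hcard (measure_ne_top _ _)),
    fun g δ hg hδ hδr hgs => ?_⟩
  have hsupp (i : Fin n) : tsupport (mollify g (f i)) ⊆ Metric.closedBall x₀ (δ + r / 2) :=
    (hg.tsupport_mollify_subset (f i)).trans <| (Metric.cthickening_subset_of_subset δ
      (hf_supp i)).trans (cthickening_closedBall hδ.le (by linarith) x₀).le
  rw [← lintegral_lintegral_enorm_sub hg]
  refine hprod _ (Metric.ball x₀ r) (hΩ.inter Metric.isOpen_ball.measurableSet)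
    (fun x hx i t ht hxt => ⟨hcone x hx.1 hx.2 (b i) (hb i) t ht hxt, hxt⟩)
    (fun i => mollify g (f i))
    (fun i => (hg.contDiff_mollify (hf_int i).locallyIntegrable).of_le (by simp))
    (fun i => (isCompact_closedBall x₀ _).of_isClosed_subset (isClosed_tsupport _) (hsupp i))
    _ (Measurable.lintegral_prod_right' (f := fun z : Space n × Space n => ‖g (z.1 - z.2)‖ₑ)
      (hg.continuous.comp continuous_sub).enorm.measurable) (fun i x hx => ?_) fun i x hx => ?_
  · refine (hM i g δ hg x fun y hyg hyφ => ?_).trans (lintegral_mono' ?_ le_rfl)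
    · obtain ⟨t, ht, w, hw, hxy⟩ := hgs _ hyg
      obtain rfl : y = x + t • w := by rw [← neg_neg (t • w), ← hxy]; abel
      have hr : r / 2 < r := by linarith
      exact hcone x hx.1 hx.2 w hw t ht (Metric.closedBall_subset_ball hr (hφs hyφ))
    · exact Finset.single_le_sum (fun j _ => Measure.zero_le (M j)) (Finset.mem_univ i)
  · refine image_eq_zero_of_notMem_tsupport fun hmem => hx ?_
    exact Metric.closedBall_subset_ball (by linarith) (hsupp i (tsupport_fderiv_subset ℝ hmem))

theorem lintegral_prod_lt_top [Nontrivial (Fin n)] (h : IsStrainDensity Ω u m σ)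
    (hu : MemLp u 1 (volume.restrict Ω)) (hcone : ConeCondition (Ω : Set (Space n)) x₀ e r κ)
    (hr : 0 < r) (hκ : 0 < κ) (hφ : ContDiff ℝ (⊤ : ℕ∞) φ)
    (hφs : tsupport φ ⊆ Metric.closedBall x₀ (r / 2)) (b : Module.Basis (Fin n) ℝ (Space n))
    (hb : ∀ i, ‖b i - e‖ < κ) :
    ∫⁻ x in (Ω : Set (Space n)) ∩ Metric.ball x₀ r,
      ∏ i, ‖φ x * inner ℝ (u x) (b i)‖ₑ ^ ((1 : ℝ) / (n - 1)) < ∞ := by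
  have hΩ : MeasurableSet (Ω : Set (Space n)) := Ω.isOpen.measurableSet
  have hc : HasCompactSupport φ :=
    (isCompact_closedBall x₀ (r / 2)).of_isClosed_subset (isClosed_tsupport φ) hφs
  have hexp : (0 : ℝ) ≤ 1 / (n - 1) := by
    have : (1 : ℝ) < n := by simpa using (Fintype.one_lt_card (α := Fin n))
    exact div_nonneg zero_le_one (by linarith)
  let f (i : Fin n) : Space n → ℝ :=
    (Ω : Set (Space n)).indicator fun y => φ y * inner ℝ (u y) (b i)
  have hf (i : Fin n) : Integrable (f i) :=
    integrable_indicator_mul_inner hu hφ.continuous hc (b i)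
  obtain ⟨C, hC, hle⟩ := h.exists_lintegral_prod_mollify_le hu hcone hφ hφs b hb
  have hδ (k : ℕ) : 0 < r / 4 / (k + 1) := by positivity
  have hδr (k : ℕ) : r / 4 / (k + 1) < r / 2 :=
    (div_le_self (by positivity) (by linarith [k.cast_nonneg (α := ℝ)])).trans_lt (by linarith)
  have hδlim : Tendsto (fun k : ℕ => r / 4 / ((k : ℝ) + 1)) atTop (𝓝 0) := by
    simpa [div_eq_mul_inv] using tendsto_one_div_add_atTop_nhds_zero_nat.const_mul (r / 4)
  choose g hg hgs using fun k => exists_isMollifier_tsupport_subset_cone e hκ (hδ k)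
  have hlim (i : Fin n) : TendstoInMeasure
      (volume.restrict ((Ω : Set (Space n)) ∩ Metric.ball x₀ r))
      (fun k => mollify (g k) (f i)) atTop (f i) := by
    refine tendstoInMeasure_of_tendsto_eLpNorm one_ne_zero
      (fun k => ((hg k).contDiff_mollify (hf i).locallyIntegrable).continuous.aestronglyMeasurable)
      (hf i).1.restrict (tendsto_of_tendsto_of_tendsto_of_le_of_le tendsto_const_nhds
        (tendsto_eLpNorm_mollify_sub hg hδlim le_rfl (by simp)
          (memLp_one_iff_integrable.2 (hf i)))
        (fun _ => zero_le) fun k => eLpNorm_mono_measure _ Measure.restrict_le_self)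
  calc ∫⁻ x in (Ω : Set (Space n)) ∩ Metric.ball x₀ r,
        ∏ i, ‖φ x * inner ℝ (u x) (b i)‖ₑ ^ ((1 : ℝ) / (n - 1))
      = ∫⁻ x in (Ω : Set (Space n)) ∩ Metric.ball x₀ r,
          ∏ i, ‖f i x‖ₑ ^ ((1 : ℝ) / (n - 1)) :=
        setLIntegral_congr_fun (hΩ.inter Metric.isOpen_ball.measurableSet) fun x hx => by
          simp only [f, Set.indicator_of_mem hx.1]
    _ ≤ C := lintegral_prod_enorm_rpow_le_of_tendstoInMeasure
        (fun k i => ((hg k).contDiff_mollify (hf i).locallyIntegrable).continuous.aemeasurable)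
        hlim hexp fun k => hle (g k) _ (hg k) (hδ k) (hδr k) (hgs k)
    _ < ∞ := hC.lt_top

theorem exists_lintegral_ball_lt_top (hn : 2 ≤ n) (h : IsStrainDensity Ω u m σ)
    (hu : MemLp u 1 (volume.restrict Ω)) (hL : HasLipschitzBoundary (Ω : Set (Space n)))
    (hx₀ : x₀ ∈ closure (Ω : Set (Space n))) :
    ∃ r > 0, ∫⁻ x in (Ω : Set (Space n)) ∩ Metric.ball x₀ r,
      ‖u x‖ₑ ^ ((n : ℝ) / (n - 1)) < ∞ := by
  have hn1 : (0 : ℝ) < n - 1 := by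
    have : (2 : ℝ) ≤ n := by exact_mod_cast hn
    linarith
  have : NeZero n := ⟨by omega⟩
  have : Nontrivial (Fin n) := Fin.nontrivial_iff_two_le.2 hn
  have hΩ : MeasurableSet (Ω : Set (Space n)) := Ω.isOpen.measurableSet
  obtain ⟨e, r, κ, hr, hκ, hcone⟩ := hL.exists_coneCondition Ω.isOpen hx₀
  obtain ⟨b, hb, hb0⟩ := exists_bases_near e hκ
  obtain ⟨c, hc0, hc⟩ := exists_pos_mul_norm_rpow_le_sum_prod hn hb0
  let φ : ContDiffBump x₀ := ⟨r / 4, r / 2, by linarith, by linarith⟩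
  have hprod (k : Fin n) := h.lintegral_prod_lt_top hu hcone hr hκ φ.contDiff φ.tsupport_eq.le
    (b k) (hb k)
  have hmeas (k i : Fin n) : AEMeasurable
      (fun y => ‖φ y * inner ℝ (u y) (b k i)‖ₑ ^ ((1 : ℝ) / (n - 1)))
      (volume.restrict ((Ω : Set (Space n)) ∩ Metric.ball x₀ r)) :=
    ((φ.continuous.aestronglyMeasurable.mul
      ((memLp_one_iff_integrable.1 hu).inner_const (b k i)).1).enorm.pow_const _).mono_measure
        (Measure.restrict_mono Set.inter_subset_left le_rfl)
  have hpt : ∀ x ∈ (Ω : Set (Space n)) ∩ Metric.ball x₀ (r / 4),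
      ENNReal.ofReal c * ‖u x‖ₑ ^ ((n : ℝ) / (n - 1)) ≤
        ∑ k, ∏ i, ‖φ x * inner ℝ (u x) (b k i)‖ₑ ^ ((1 : ℝ) / (n - 1)) := by
    intro x hx
    simp_rw [φ.one_of_mem_closedBall (Metric.ball_subset_closedBall hx.2), one_mul,
      ← ofReal_norm, Real.norm_eq_abs, ENNReal.ofReal_rpow_of_nonneg (norm_nonneg (u x))
        (show (0 : ℝ) ≤ n / (n - 1) by positivity),
      ENNReal.ofReal_rpow_of_nonneg (abs_nonneg _) (show (0 : ℝ) ≤ 1 / (n - 1) by positivity)]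
    simp_rw [← ENNReal.ofReal_prod_of_nonneg fun _ _ => Real.rpow_nonneg (abs_nonneg _) _]
    rw [← ENNReal.ofReal_sum_of_nonneg fun k _ => Finset.prod_nonneg fun i _ => by positivity,
      ← ENNReal.ofReal_mul hc0.le]
    exact ENNReal.ofReal_le_ofReal (hc (u x))
  have hle : ENNReal.ofReal c * ∫⁻ x in (Ω : Set (Space n)) ∩ Metric.ball x₀ (r / 4),
      ‖u x‖ₑ ^ ((n : ℝ) / (n - 1)) < ∞ := by
    rw [← lintegral_const_mul' _ _ ENNReal.ofReal_ne_top]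
    refine (setLIntegral_mono' (hΩ.inter Metric.isOpen_ball.measurableSet) hpt).trans_lt ?_
    refine (lintegral_mono_set (Set.inter_subset_inter_right _
      (Metric.ball_subset_ball (show r / 4 ≤ r by linarith)))).trans_lt ?_
    rw [lintegral_finsetSum' _ fun k _ => Finset.aemeasurable_fun_prod _ fun i _ => hmeas k i]
    exact ENNReal.sum_lt_top.2 fun k _ => hprod k
  exact ⟨r / 4, by linarith, ENNReal.lt_top_of_mul_ne_top_right hle.ne (by simpa using hc0)⟩

theorem memLp (hn : 2 ≤ n) (h : IsStrainDensity Ω u m σ) (hu : MemLp u 1 (volume.restrict Ω))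
    (hb : Bornology.IsBounded (Ω : Set (Space n)))
    (hL : HasLipschitzBoundary (Ω : Set (Space n))) :
    MemLp u (ENNReal.ofReal ((n : ℝ) / (n - 1))) (volume.restrict Ω) := by
  have hp : 0 < (n : ℝ) / (n - 1) := by
    have : (2 : ℝ) ≤ n := by exact_mod_cast hn
    exact div_pos (by linarith) (by linarith)
  refine ⟨hu.1, ?_⟩
  rw [eLpNorm_lt_top_iff_lintegral_rpow_enorm_lt_top (by simpa using hp) ENNReal.ofReal_ne_top,
    ENNReal.toReal_ofReal hp.le]
  have hfin : ∫⁻ x in (Ω : Set (Space n)) ∩ closure Ω, ‖u x‖ₑ ^ ((n : ℝ) / (n - 1)) < ∞ := by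
    refine hb.isCompact_closure.induction_on (p := fun s => ∫⁻ x in (Ω : Set (Space n)) ∩ s,
      ‖u x‖ₑ ^ ((n : ℝ) / (n - 1)) < ∞) (by simp) (fun s t hst ht =>
        (lintegral_mono_set (Set.inter_subset_inter_right _ hst)).trans_lt ht)
      (fun s t hs ht => ?_) fun x hx => ?_
    · rw [Set.inter_union_distrib_left]
      exact (lintegral_union_le _ _ _).trans_lt (ENNReal.add_lt_top.2 ⟨hs, ht⟩)
    · obtain ⟨r, hr, hball⟩ := h.exists_lintegral_ball_lt_top hn hu hL hx
      exact ⟨Metric.ball x r, mem_nhdsWithin_of_mem_nhds (Metric.ball_mem_nhds x hr), hball⟩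
  rwa [Set.inter_eq_left.2 subset_closure] at hfin

end IsStrainDensity

end Embedding

section TestFunctions

variable {n : ℕ} {Ω : Opens (Space n)}

theorem exists_testFunction_eventually_eq_one {K : Set (Space n)} (hK : IsCompact K)
    (hKΩ : K ⊆ Ω) :
    ∃ χ : 𝓓(Ω, ℝ), (∀ᶠ x in 𝓝ˢ K, χ x = 1) ∧ ∀ x, χ x ∈ Set.Icc (0 : ℝ) 1 := by
  obtain ⟨ρ, hρ, hρΩ⟩ := hK.exists_cthickening_subset_open Ω.isOpen hKΩ
  obtain ⟨χ, hχ_one, hχ_zero, hχ⟩ := exists_contMDiffMap_one_nhds_of_subset_interior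
    (modelWithCornersSelf ℝ (Space n)) (n := (⊤ : ℕ∞)) hK.isClosed
    ((Metric.self_subset_thickening hρ K).trans
      (interior_maximal (Metric.thickening_subset_cthickening ρ K) Metric.isOpen_thickening))
  have hsupp : tsupport χ ⊆ Metric.cthickening ρ K :=
    closure_minimal (fun x hx => not_not.1 fun hxρ => hx (hχ_zero x hxρ))
      Metric.isClosed_cthickening
  exact ⟨⟨χ, contMDiff_iff_contDiff.1 χ.contMDiff, HasCompactSupport.of_support_subset_isCompact
    hK.cthickening ((subset_tsupport _).trans hsupp), hsupp.trans hρΩ⟩, hχ_one, hχ⟩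

theorem exists_contDiff_lintegral_sub_le (M : Measure (Space n)) [IsFiniteMeasure M]
    {f : Space n → ℝ} (hf : Integrable f M) {ε : ℝ≥0∞} (hε : ε ≠ 0) :
    ∃ h : Space n → ℝ, ContDiff ℝ (⊤ : ℕ∞) h ∧ ∫⁻ x, ‖f x - h x‖ₑ ∂M ≤ ε := by
  obtain ⟨f', hf'c, hff', hf', -⟩ :=
    (memLp_one_iff_integrable.2 hf).exists_hasCompactSupport_eLpNorm_sub_le (by simp)
      (ENNReal.half_pos hε).ne'
  rw [eLpNorm_one_eq_lintegral_enorm] at hff'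
  obtain ⟨δ, hδ, hδM⟩ := ENNReal.exists_nnreal_pos_mul_lt (measure_ne_top M Set.univ)
    (ENNReal.half_pos hε).ne'
  obtain ⟨h, hh, hf'h⟩ := (hf'c.uniformContinuous_of_continuous hf').exists_contDiff_dist_le
    (NNReal.coe_pos.2 hδ)
  refine ⟨h, hh, ?_⟩
  calc ∫⁻ x, ‖f x - h x‖ₑ ∂M
      ≤ ∫⁻ x, (‖(f - f') x‖ₑ + δ) ∂M := by
        refine lintegral_mono fun x => ?_
        have hδx : ‖f' x - h x‖ₑ ≤ δ := by
          rw [← edist_eq_enorm_sub, edist_comm, edist_le_coe, ← NNReal.coe_le_coe, coe_nndist]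
          exact (hf'h x).le
        calc ‖f x - h x‖ₑ = ‖(f - f') x + (f' x - h x)‖ₑ := by simp
          _ ≤ _ := (enorm_add_le _ _).trans (by gcongr)
    _ = ∫⁻ x, ‖(f - f') x‖ₑ ∂M + δ * M Set.univ := by
        rw [lintegral_add_right _ measurable_const, lintegral_const]
    _ ≤ ε / 2 + ε / 2 := add_le_add hff' hδM.le
    _ = ε := ENNReal.add_halves ε

theorem exists_testFunction_lintegral_sub_le (M : Measure (Space n)) [IsFiniteMeasure M]
    (hM : M (Ω : Set (Space n))ᶜ = 0) {f : Space n → ℝ} (hf : Integrable f M) {ε : ℝ≥0∞}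
    (hε : ε ≠ 0) : ∃ φ : 𝓓(Ω, ℝ), ∫⁻ x, ‖f x - φ x‖ₑ ∂M ≤ ε := by
  have hΩ : MeasurableSet (Ω : Set (Space n)) := Ω.isOpen.measurableSet
  have hε2 : ε / 2 ≠ 0 := (ENNReal.half_pos hε).ne'
  obtain ⟨h, hh, hfh⟩ := exists_contDiff_lintegral_sub_le M hf hε2
  let N := M.withDensity fun x => ‖f x‖ₑ
  have : IsFiniteMeasure N := isFiniteMeasure_withDensity hf.2.ne
  obtain ⟨K, hKΩ, hK, hNK⟩ : ∃ K ⊆ (Ω : Set (Space n)), IsCompact K ∧ N (Ω \ K) < ε / 2 :=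
    hΩ.exists_isCompact_sdiff_lt (measure_ne_top N _) hε2
  obtain ⟨χ, hχ_one, hχ⟩ := exists_testFunction_eventually_eq_one hK hKΩ
  let φ : 𝓓(Ω, ℝ) := ⟨fun x => χ x * h x, χ.contDiff.mul hh, χ.hasCompactSupport.mul_right,
    (closure_mono (Function.support_mul_subset_left _ _)).trans χ.tsupport_subset⟩
  refine ⟨φ, ?_⟩
  have hbound : ∀ᵐ x ∂M, ‖f x - φ x‖ₑ ≤
      ‖f x - h x‖ₑ + ((Ω : Set (Space n)) \ K).indicator (fun x => ‖f x‖ₑ) x := by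
    filter_upwards [mem_ae_iff.2 hM] with x hx
    have hχx : ‖χ x * (f x - h x)‖ₑ ≤ ‖f x - h x‖ₑ := by
      rw [enorm_mul]
      refine mul_le_of_le_one_left' ?_
      rw [Real.enorm_of_nonneg (hχ x).1]
      exact ENNReal.ofReal_le_one.2 (hχ x).2
    calc ‖f x - φ x‖ₑ = ‖χ x * (f x - h x) + (1 - χ x) * f x‖ₑ := by
          congr 1
          change f x - χ x * h x = _
          ring
      _ ≤ ‖f x - h x‖ₑ + ‖(1 - χ x) * f x‖ₑ := (enorm_add_le _ _).trans (by gcongr)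
      _ ≤ _ := by
          gcongr
          by_cases hxK : x ∈ K
          · simp [hχ_one.self_of_nhdsSet x hxK]
          · rw [Set.indicator_of_mem (Set.mem_sdiff_of_mem hx hxK), enorm_mul]
            refine mul_le_of_le_one_left' ?_
            rw [Real.enorm_of_nonneg (by linarith [(hχ x).2])]
            exact ENNReal.ofReal_le_one.2 (by linarith [(hχ x).1])
  refine (lintegral_mono_ae hbound).trans ?_
  have hfh_meas : AEMeasurable (fun x => ‖f x - h x‖ₑ) M :=
    (hf.1.sub hh.continuous.aestronglyMeasurable).enorm
  rw [lintegral_add_left' hfh_meas, lintegral_indicator (hΩ.diff hK.measurableSet),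
    ← withDensity_apply _ (hΩ.diff hK.measurableSet)]
  exact (add_le_add hfh hNK.le).trans_eq (ENNReal.add_halves ε)

theorem exists_testFunction_lintegral_abs_sub_mul_le (m : Measure (Space n))
    (hm : m (Ω : Set (Space n))ᶜ = 0) {f : Space n → ℝ} (hfm : Measurable f)
    (hf : Integrable f m) {ε : ℝ≥0∞} (hε : ε ≠ 0) :
    ∃ φ : 𝓓(Ω, ℝ), ∫⁻ x, ‖|f x| - φ x * f x‖ₑ ∂m ≤ ε := by
  let M := m.withDensity fun x => ‖f x‖ₑ
  have : IsFiniteMeasure M := isFiniteMeasure_withDensity hf.2.ne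
  let τ : Space n → ℝ := fun x => if 0 ≤ f x then 1 else -1
  have hτ : Measurable τ :=
    Measurable.ite (measurableSet_le measurable_const hfm) measurable_const measurable_const
  have hτf (x : Space n) : |f x| = τ x * f x := by
    simp only [τ]
    split_ifs with hx
    · rw [one_mul, abs_of_nonneg hx]
    · rw [neg_one_mul, abs_of_neg (not_le.1 hx)]
  have hτ_int : Integrable τ M := .of_bound hτ.aestronglyMeasurable 1
    (ae_of_all _ fun x => by simp only [τ]; split_ifs <;> simp)
  obtain ⟨φ, hφ⟩ := exists_testFunction_lintegral_sub_le M
    (withDensity_absolutelyContinuous _ _ hm) hτ_int hε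
  refine ⟨φ, le_of_eq_of_le ?_ hφ⟩
  have hτφ : Measurable fun x => ‖τ x - φ x‖ₑ := (hτ.sub φ.continuous.measurable).enorm
  rw [lintegral_withDensity_eq_lintegral_mul _ hfm.enorm hτφ]
  refine lintegral_congr fun x => ?_
  rw [hτf, ← sub_mul, enorm_mul, mul_comm, Pi.mul_apply]

end TestFunctions

/-! ### Strain and capacity -/

section StrainEstimate

variable {n : ℕ}

theorem gradient_mul {f g : Space n → ℝ} {x : Space n} (hf : DifferentiableAt ℝ f x)
    (hg : DifferentiableAt ℝ g x) :
    ∇ (fun y => f y * g y) x = f x • ∇ g x + g x • ∇ f x := by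
  ext i
  simp [gradient_apply, fderiv_fun_mul hf hg]

theorem norm_symTensor_le (a b : Space n) : ‖symTensor a b‖ ≤ ‖a‖ * ‖b‖ := by
  have hprod : ∑ s : Fin n × Fin n, a s.1 ^ 2 * b s.2 ^ 2 = (‖a‖ * ‖b‖) ^ 2 := by
    simp only [mul_pow, EuclideanSpace.real_norm_sq_eq, Fintype.sum_prod_type, Finset.sum_mul_sum]
  have hswap : ∑ s : Fin n × Fin n, a s.2 ^ 2 * b s.1 ^ 2 = (‖a‖ * ‖b‖) ^ 2 := by
    rw [← hprod, ← (Equiv.prodComm _ _).sum_comp]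
    rfl
  refine le_of_sq_le_sq ?_ (by positivity)
  calc ‖symTensor a b‖ ^ 2 = ∑ s : Fin n × Fin n, ((a s.1 * b s.2 + a s.2 * b s.1) / 2) ^ 2 :=
        EuclideanSpace.real_norm_sq_eq _
    _ ≤ ∑ s : Fin n × Fin n, (a s.1 ^ 2 * b s.2 ^ 2 + a s.2 ^ 2 * b s.1 ^ 2) / 2 :=
        Finset.sum_le_sum fun s _ => by nlinarith [sq_nonneg (a s.1 * b s.2 - a s.2 * b s.1)]
    _ = (‖a‖ * ‖b‖) ^ 2 := by
        rw [← Finset.sum_div, Finset.sum_add_distrib, hprod, hswap, add_self_div_two]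

theorem tendsto_eLpNorm_gradient_mul {q : ℝ≥0∞} {μ : Measure (Space n)} {ψ : ℕ → Space n → ℝ}
    (hψ : ∀ k, ContDiff ℝ (⊤ : ℕ∞) (ψ k)) {Ω : Opens (Space n)} (φ : 𝓓(Ω, ℝ)) (hq : 1 ≤ q)
    (hψ0 : Tendsto (fun k => eLpNorm (ψ k) q μ) atTop (𝓝 0))
    (hψ1 : Tendsto (fun k => eLpNorm (∇ (ψ k)) q μ) atTop (𝓝 0)) :
    Tendsto (fun k => eLpNorm (∇ fun x => ψ k x * φ x) q μ) atTop (𝓝 0) := by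
  obtain ⟨C, hC⟩ := φ.continuous.bounded_above_of_compact_support φ.hasCompactSupport
  obtain ⟨C', hC'⟩ := (continuous_gradient φ.contDiff).bounded_above_of_compact_support
    (hasCompactSupport_gradient φ.hasCompactSupport)
  have hlim : Tendsto (fun k => ENNReal.ofReal C' * eLpNorm (ψ k) q μ +
      ENNReal.ofReal C * eLpNorm (∇ (ψ k)) q μ) atTop (𝓝 0) := by
    simpa using (ENNReal.Tendsto.const_mul hψ0 (Or.inr ENNReal.ofReal_ne_top)).add
      (ENNReal.Tendsto.const_mul hψ1 (Or.inr ENNReal.ofReal_ne_top))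
  refine tendsto_of_tendsto_of_tendsto_of_le_of_le tendsto_const_nhds hlim
    (fun _ => zero_le) fun k => ?_
  have hgrad : (∇ fun x => ψ k x * φ x) =
      (fun x => ψ k x • ∇ φ x) + fun x => φ x • ∇ (ψ k) x := by
    ext1 x
    exact gradient_mul ((hψ k).differentiable (by simp) x) (φ.contDiff.differentiable (by simp) x)
  rw [hgrad]
  refine (eLpNorm_add_le ((hψ k).continuous.smul
    (continuous_gradient φ.contDiff)).aestronglyMeasurable
    (φ.continuous.smul (continuous_gradient (hψ k))).aestronglyMeasurable hq).trans ?_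
  gcongr
  · refine eLpNorm_le_mul_eLpNorm_of_ae_le_mul (ae_of_all _ fun x => ?_) q
    rw [Pi.smul_apply', norm_smul, mul_comm]
    gcongr
    exact hC' x
  · refine eLpNorm_le_mul_eLpNorm_of_ae_le_mul (ae_of_all _ fun x => ?_) q
    rw [Pi.smul_apply', norm_smul]
    gcongr
    exact hC x

variable {Ω : Opens (Space n)} {u : Space n → Space n} {m : Measure (Space n)}
  {σ : Space n → Mat n} {p q : ℝ≥0∞} [p.HolderConjugate q]

namespace IsStrainDensity

theorem enorm_integral_mul_le (h : IsStrainDensity Ω u m σ)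
    (hu : AEStronglyMeasurable u (volume.restrict Ω)) (θ : 𝓓(Ω, ℝ)) (s : Fin n × Fin n) :
    ‖∫ x, θ x * σ x s ∂m‖ₑ ≤
      eLpNorm u p (volume.restrict Ω) * eLpNorm (∇ θ) q (volume.restrict Ω) := by
  calc ‖∫ x, θ x * σ x s ∂m‖ₑ
      = ‖∫ x in Ω, symTensor (u x) (∇ θ x) s‖ₑ := by
        rw [h.integral_eq θ s.1 s.2, enorm_neg]
        simp [symTensor]
    _ ≤ eLpNorm (fun x => symTensor (u x) (∇ θ x) s) 1 (volume.restrict Ω) := by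
        rw [eLpNorm_one_eq_lintegral_enorm]
        exact enorm_integral_le_lintegral_enorm _
    _ ≤ (1 : ℝ≥0) * eLpNorm u p (volume.restrict Ω) * eLpNorm (∇ θ) q (volume.restrict Ω) :=
        eLpNorm_le_eLpNorm_mul_eLpNorm'_of_norm hu
          (continuous_gradient θ.contDiff).aestronglyMeasurable (fun a b => symTensor a b s) 1
          (ae_of_all _ fun x => by
            simpa using (PiLp.norm_apply_le _ s).trans (norm_symTensor_le (u x) (∇ θ x)))
    _ = _ := by simp

theorem lintegral_mul_le (h : IsStrainDensity Ω u m σ)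
    (hu : AEStronglyMeasurable u (volume.restrict Ω)) (φ : 𝓓(Ω, ℝ)) {ψ : Space n → ℝ}
    (hψ : ContDiff ℝ (⊤ : ℕ∞) ψ) (hψ01 : ∀ x, ψ x ∈ Set.Icc (0 : ℝ) 1) (s : Fin n × Fin n) :
    ∫⁻ x, ‖ψ x‖ₑ * ‖σ x s‖ₑ ∂m ≤
      eLpNorm u p (volume.restrict Ω) * eLpNorm (∇ fun x => ψ x * φ x) q (volume.restrict Ω) +
        ∫⁻ x, ‖|σ x s| - φ x * σ x s‖ₑ ∂m := by
  have hσ : Integrable (fun x => σ x s) m := integrable_piLp_iff.1 h.integrable s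
  have hψ01' (x : Space n) : ‖ψ x‖ ≤ 1 := by
    rw [Real.norm_of_nonneg (hψ01 x).1]
    exact (hψ01 x).2
  let θ : 𝓓(Ω, ℝ) := ⟨fun x => ψ x * φ x, hψ.mul φ.contDiff, φ.hasCompactSupport.mul_left,
    (closure_mono (Function.support_mul_subset_right _ _)).trans φ.tsupport_subset⟩
  have hθσ : Integrable (fun x => θ x * σ x s) m := by
    simpa only [mul_comm] using
      integrable_mul_of_hasCompactSupport hσ θ.continuous θ.hasCompactSupport
  have hψσ : Integrable (fun x => ψ x * |σ x s|) m :=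
    hσ.abs.bdd_mul hψ.continuous.aestronglyMeasurable (ae_of_all _ hψ01')
  calc ∫⁻ x, ‖ψ x‖ₑ * ‖σ x s‖ₑ ∂m
      = ‖∫ x, ψ x * |σ x s| ∂m‖ₑ := by
        have hnonneg (x : Space n) : 0 ≤ ψ x * |σ x s| := mul_nonneg (hψ01 x).1 (abs_nonneg _)
        rw [Real.enorm_of_nonneg (integral_nonneg hnonneg),
          ofReal_integral_eq_lintegral_ofReal hψσ (ae_of_all _ hnonneg)]
        refine lintegral_congr fun x => ?_
        rw [← enorm_mul, Real.enorm_eq_ofReal_abs, abs_mul, abs_of_nonneg (hψ01 x).1]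
    _ = ‖∫ x, θ x * σ x s ∂m + ∫ x, (ψ x * |σ x s| - θ x * σ x s) ∂m‖ₑ := by
        rw [integral_sub hψσ hθσ]
        ring_nf
    _ ≤ ‖∫ x, θ x * σ x s ∂m‖ₑ + ∫⁻ x, ‖ψ x * |σ x s| - θ x * σ x s‖ₑ ∂m :=
        (enorm_add_le _ _).trans (by gcongr; exact enorm_integral_le_lintegral_enorm _)
    _ ≤ _ := by
        gcongr with x
        · exact h.enorm_integral_mul_le hu θ s
        · calc ‖ψ x * |σ x s| - ψ x * φ x * σ x s‖ₑ
              = ‖ψ x‖ₑ * ‖|σ x s| - φ x * σ x s‖ₑ := by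
                rw [← enorm_mul]
                congr 1
                ring
            _ ≤ _ := by
                refine mul_le_of_le_one_left' ?_
                rw [← ofReal_norm]
                exact ENNReal.ofReal_le_one.2 (hψ01' x)

theorem tendsto_lintegral_mul (h : IsStrainDensity Ω u m σ) (hu : MemLp u p (volume.restrict Ω))
    {ψ : ℕ → Space n → ℝ} (hψ : ∀ k, ContDiff ℝ (⊤ : ℕ∞) (ψ k))
    (hψ01 : ∀ k x, ψ k x ∈ Set.Icc (0 : ℝ) 1)
    (hψ0 : Tendsto (fun k => eLpNorm (ψ k) q (volume.restrict Ω)) atTop (𝓝 0))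
    (hψ1 : Tendsto (fun k => eLpNorm (∇ (ψ k)) q (volume.restrict Ω)) atTop (𝓝 0))
    (s : Fin n × Fin n) :
    Tendsto (fun k => ∫⁻ x, ‖ψ k x‖ₑ * ‖σ x s‖ₑ ∂m) atTop (𝓝 0) := by
  have hσ : Integrable (fun x => σ x s) m := integrable_piLp_iff.1 h.integrable s
  have hσm : Measurable fun x => σ x s :=
    (EuclideanSpace.proj (𝕜 := ℝ) s).continuous.measurable.comp h.measurable
  refine ENNReal.tendsto_nhds_zero.2 fun ε hε => ?_
  obtain ⟨φ, hφ⟩ := exists_testFunction_lintegral_abs_sub_mul_le m h.measure_compl hσm hσ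
    (ENNReal.half_pos hε.ne').ne'
  have hgrad : Tendsto (fun k => eLpNorm (∇ fun x => ψ k x * φ x) q (volume.restrict Ω)) atTop
      (𝓝 0) := tendsto_eLpNorm_gradient_mul hψ φ (ENNReal.HolderConjugate.one_le q p) hψ0 hψ1
  have hlim : Tendsto (fun k => eLpNorm u p (volume.restrict Ω) *
      eLpNorm (∇ fun x => ψ k x * φ x) q (volume.restrict Ω)) atTop (𝓝 0) := by
    simpa using ENNReal.Tendsto.const_mul hgrad (Or.inr hu.2.ne)
  filter_upwards [hlim.eventually_le_const (ENNReal.half_pos hε.ne').pos] with k hk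
  calc _ ≤ _ := h.lintegral_mul_le hu.1 φ (hψ k) (hψ01 k) s
    _ ≤ ε / 2 + ε / 2 := by gcongr
    _ = ε := ENNReal.add_halves ε

end IsStrainDensity

theorem enorm_le_sum_enorm {ι : Type*} [Fintype ι] (a : EuclideanSpace ℝ ι) :
    ‖a‖ₑ ≤ ∑ i, ‖a i‖ₑ := by
  classical
  calc ‖a‖ₑ = ‖∑ i, EuclideanSpace.single i (a i)‖ₑ := by
        congr 1
        ext i
        simp
    _ ≤ ∑ i, ‖EuclideanSpace.single i (a i)‖ₑ := enorm_sum_le _ _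
    _ = ∑ i, ‖a i‖ₑ := by simp [← ofReal_norm]

theorem HasStrain.tendsto_lintegral_variation {μ : VectorMeasure (Space n) (Mat n)}
    (h : HasStrain Ω u μ) (hu : MemLp u p (volume.restrict Ω))
    {ψ : ℕ → Space n → ℝ} (hψ : ∀ k, ContDiff ℝ (⊤ : ℕ∞) (ψ k))
    (hψ01 : ∀ k x, ψ k x ∈ Set.Icc (0 : ℝ) 1)
    (hψ0 : Tendsto (fun k => eLpNorm (ψ k) q (volume.restrict Ω)) atTop (𝓝 0))
    (hψ1 : Tendsto (fun k => eLpNorm (∇ (ψ k)) q (volume.restrict Ω)) atTop (𝓝 0)) :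
    Tendsto (fun k => ∫⁻ x, ‖ψ k x‖ₑ ∂μ.variation) atTop (𝓝 0) := by
  obtain ⟨σ, hσ, hσμ⟩ := h.exists_isStrainDensity
  have hvar : μ.variation = μ.variation.withDensity fun x => ‖σ x‖ₑ := by
    conv_lhs => rw [← hσμ, Measure.variation_withDensityᵥ hσ.integrable]
  have hσs (s : Fin n × Fin n) : Measurable fun x => σ x s :=
    (EuclideanSpace.proj (𝕜 := ℝ) s).continuous.measurable.comp hσ.measurable
  have hsum : Tendsto (fun k => ∑ s, ∫⁻ x, ‖ψ k x‖ₑ * ‖σ x s‖ₑ ∂μ.variation) atTop (𝓝 0) := by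
    simpa using tendsto_finsetSum Finset.univ fun s _ =>
      hσ.tendsto_lintegral_mul hu hψ hψ01 hψ0 hψ1 s
  refine tendsto_of_tendsto_of_tendsto_of_le_of_le tendsto_const_nhds hsum
    (fun _ => zero_le) fun k => ?_
  have hψm : Measurable fun x => ‖ψ k x‖ₑ := (hψ k).continuous.measurable.enorm
  calc ∫⁻ x, ‖ψ k x‖ₑ ∂μ.variation
      = ∫⁻ x, ‖ψ k x‖ₑ * ‖σ x‖ₑ ∂μ.variation := by
        conv_lhs => rw [hvar, lintegral_withDensity_eq_lintegral_mul _ hσ.measurable.enorm hψm]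
        exact lintegral_congr fun x => mul_comm ‖σ x‖ₑ ‖ψ k x‖ₑ
    _ ≤ ∫⁻ x, ∑ s, ‖ψ k x‖ₑ * ‖σ x s‖ₑ ∂μ.variation := by
        gcongr with x
        rw [← Finset.mul_sum]
        gcongr
        exact enorm_le_sum_enorm _
    _ = _ := lintegral_finsetSum _ fun s _ => hψm.mul (hσs s).enorm

end StrainEstimate

section SobolevZero

variable {n : ℕ} {Ω : Opens (Space n)} {q : ℝ≥0∞}

theorem tendsto_integral_mul_of_tendsto_eLpNorm {X : Type*} [MeasurableSpace X] {μ : Measure X}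
    {p : ℝ≥0∞} [p.HolderConjugate q] {f : ℕ → X → ℝ} {f₀ h : X → ℝ} (hf : ∀ k, MemLp (f k) q μ)
    (hf₀ : MemLp f₀ q μ) (hh : MemLp h p μ)
    (hlim : Tendsto (fun k => eLpNorm (fun x => f k x - f₀ x) q μ) atTop (𝓝 0)) :
    Tendsto (fun k => ∫ x, f k x * h x ∂μ) atTop (𝓝 (∫ x, f₀ x * h x ∂μ)) := by
  refine tendsto_integral_of_L1' _ (hf₀.1.mul hh.1) (Eventually.of_forall fun k =>
    (hf k).integrable_mul hh) ?_
  refine tendsto_of_tendsto_of_tendsto_of_le_of_le tendsto_const_nhds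
    (by simpa using ENNReal.Tendsto.mul_const hlim (Or.inr hh.2.ne)) (fun _ => zero_le) fun k => ?_
  calc eLpNorm ((fun x => f k x * h x) - fun x => f₀ x * h x) 1 μ
      = eLpNorm (fun x => (f k x - f₀ x) * h x) 1 μ := by
        congr 1
        ext x
        exact (sub_mul _ _ _).symm
    _ ≤ eLpNorm (fun x => f k x - f₀ x) q μ * eLpNorm h p μ :=
        (eLpNorm_le_eLpNorm_mul_eLpNorm'_of_norm (c := 1) ((hf k).1.sub hf₀.1) hh.1 (· * ·)
          (ae_of_all _ fun x => by simp)).trans_eq (by rw [ENNReal.coe_one, one_mul]; rfl)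

theorem memLp_gradient {f : Space n → ℝ} (hf : ContDiff ℝ (⊤ : ℕ∞) f) (hc : HasCompactSupport f)
    (q : ℝ≥0∞) (μ : Measure (Space n)) [IsFiniteMeasureOnCompacts μ] : MemLp (∇ f) q μ :=
  (continuous_gradient hf).memLp_of_hasCompactSupport (hasCompactSupport_gradient hc)

theorem testFunction_eq_zero (φ : 𝓓(Ω, ℝ)) {x : Space n} (hx : x ∉ Ω) : φ x = 0 :=
  image_eq_zero_of_notMem_tsupport fun h => hx (φ.tsupport_subset h)

theorem gradient_eq_zero_of_notMem_tsupport {f : Space n → ℝ} {x : Space n}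
    (hx : x ∉ tsupport f) : ∇ f x = 0 := by
  have : fderiv ℝ f x = 0 :=
    image_eq_zero_of_notMem_tsupport fun h => hx (tsupport_fderiv_subset ℝ h)
  simp [gradient, this]

theorem gradient_testFunction_eq_zero (φ : 𝓓(Ω, ℝ)) {x : Space n} (hx : x ∉ Ω) : ∇ φ x = 0 :=
  gradient_eq_zero_of_notMem_tsupport fun h => hx (φ.tsupport_subset h)

theorem isSobolev_of_contDiff {f : Space n → ℝ} (hf : ContDiff ℝ (⊤ : ℕ∞) f)
    (hc : HasCompactSupport f) : IsSobolev Ω q f (∇ f) where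
  memLp := hf.continuous.memLp_of_hasCompactSupport hc
  memLp_grad := memLp_gradient hf hc _ _
  integral_eq φ i := by
    have hf' := continuous_gradient_coord hf i
    have hφ' := continuous_gradient_coord φ.contDiff i
    have hleft : Integrable fun x => (∇ f x) i * φ x :=
      (hf'.mul φ.continuous).integrable_of_hasCompactSupport φ.hasCompactSupport.mul_left
    have hright : Integrable fun x => f x * (∇ φ x) i :=
      (hf.continuous.mul hφ').integrable_of_hasCompactSupport hc.mul_right
    have hprod : Integrable fun x => f x * φ x :=
      (hf.continuous.mul φ.continuous).integrable_of_hasCompactSupport hc.mul_right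
    rw [setIntegral_eq_integral_of_forall_compl_eq_zero fun x hx => by
        simp [gradient_testFunction_eq_zero φ hx],
      setIntegral_eq_integral_of_forall_compl_eq_zero fun x hx => by
        simp [testFunction_eq_zero φ hx]]
    simp only [gradient_apply] at hleft hright ⊢
    exact integral_mul_fderiv_eq_neg_fderiv_mul_of_integrable hleft hright hprod
      (fun x _ => hf.differentiable (by simp) x) fun x _ => φ.contDiff.differentiable (by simp) x

theorem isSobolevZero_of_tendsto (hq : 1 ≤ q) {φ : ℕ → 𝓓(Ω, ℝ)} {v : Space n → ℝ}
    {g : Space n → Space n} (hv : MemLp v q (volume.restrict Ω))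
    (hg : MemLp g q (volume.restrict Ω))
    (hφv : Tendsto (fun k => eLpNorm (fun x => φ k x - v x) q (volume.restrict Ω)) atTop (𝓝 0))
    (hφg : Tendsto (fun k => eLpNorm (fun x => ∇ (φ k) x - g x) q (volume.restrict Ω)) atTop
      (𝓝 0)) : IsSobolevZero Ω q v g := by
  refine ⟨⟨hv, hg, fun ψ i => ?_⟩, φ, hφv, hφg⟩
  obtain ⟨p, hp⟩ : ∃ p : ℝ≥0∞, p.HolderConjugate q :=
    ⟨_, (ENNReal.HolderConjugate.conjExponent hq).symm⟩
  have hφ (k) : IsSobolev Ω q (φ k) (∇ (φ k)) :=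
    isSobolev_of_contDiff (φ k).contDiff (φ k).hasCompactSupport
  have hleft := tendsto_integral_mul_of_tendsto_eLpNorm (p := p) (fun k => (hφ k).memLp) hv
    ((continuous_gradient_coord ψ.contDiff i).memLp_of_hasCompactSupport
      (hasCompactSupport_gradient_coord ψ.hasCompactSupport i)) hφv
  have hright := tendsto_integral_mul_of_tendsto_eLpNorm (p := p)
    (fun k => memLp_piLp_iff.1 (hφ k).memLp_grad i) (memLp_piLp_iff.1 hg i)
    (ψ.continuous.memLp_of_hasCompactSupport ψ.hasCompactSupport)
    (tendsto_of_tendsto_of_tendsto_of_le_of_le tendsto_const_nhds hφg (fun _ => zero_le)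
      fun k => eLpNorm_mono fun x => PiLp.norm_apply_le (∇ (φ k) x - g x) i)
  simp only [(hφ _).integral_eq] at hleft
  exact tendsto_nhds_unique hleft hright.neg

theorem isSobolevZero_testFunction (φ : 𝓓(Ω, ℝ)) : IsSobolevZero Ω q φ (∇ φ) where
  toIsSobolev := isSobolev_of_contDiff φ.contDiff φ.hasCompactSupport
  exists_approx := ⟨fun _ => φ, by simp, by simp⟩

theorem gradient_sub {f f' : Space n → ℝ} {x : Space n} (hf : DifferentiableAt ℝ f x)
    (hf' : DifferentiableAt ℝ f' x) : ∇ (fun y => f y - f' y) x = ∇ f x - ∇ f' x := by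
  simp [gradient, fderiv_fun_sub hf hf']

theorem gradient_testFunction_sub (φ φ' : 𝓓(Ω, ℝ)) (x : Space n) :
    ∇ (φ - φ' : 𝓓(Ω, ℝ)) x = ∇ φ x - ∇ φ' x :=
  gradient_sub (φ.contDiff.differentiable (by simp) x) (φ'.contDiff.differentiable (by simp) x)

theorem gradient_const_mul {f : Space n → ℝ} {x : Space n} (hf : DifferentiableAt ℝ f x) (c : ℝ) :
    ∇ (fun y => c * f y) x = c • ∇ f x := by
  simp [gradient, fderiv_const_mul hf]

theorem IsSobolevZero.sub (hq : 1 ≤ q) {v v' : Space n → ℝ} {g g' : Space n → Space n}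
    (h : IsSobolevZero Ω q v g) (h' : IsSobolevZero Ω q v' g') :
    IsSobolevZero Ω q (fun x => v x - v' x) (fun x => g x - g' x) := by
  obtain ⟨φ, hφ, hφg⟩ := h.exists_approx
  obtain ⟨φ', hφ', hφg'⟩ := h'.exists_approx
  refine isSobolevZero_of_tendsto hq (φ := fun k => φ k - φ' k) (h.memLp.sub h'.memLp)
    (h.memLp_grad.sub h'.memLp_grad) ?_ ?_
  · refine tendsto_of_tendsto_of_tendsto_of_le_of_le tendsto_const_nhds
      (by simpa using hφ.add hφ') (fun _ => zero_le) fun k => ?_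
    refine le_trans (eLpNorm_mono fun x => le_of_eq ?_) (eLpNorm_sub_le
      ((φ k).continuous.aestronglyMeasurable.sub h.memLp.1)
      ((φ' k).continuous.aestronglyMeasurable.sub h'.memLp.1) hq)
    exact congrArg _ (sub_sub_sub_comm _ _ _ _)
  · refine tendsto_of_tendsto_of_tendsto_of_le_of_le tendsto_const_nhds
      (by simpa using hφg.add hφg') (fun _ => zero_le) fun k => ?_
    refine le_trans (eLpNorm_mono fun x => le_of_eq ?_) (eLpNorm_sub_le
      ((continuous_gradient (φ k).contDiff).aestronglyMeasurable.sub h.memLp_grad.1)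
      ((continuous_gradient (φ' k).contDiff).aestronglyMeasurable.sub h'.memLp_grad.1) hq)
    rw [gradient_testFunction_sub]
    exact congrArg _ (sub_sub_sub_comm _ _ _ _)

theorem IsSobolevZero.const_smul (hq : 1 ≤ q) {v : Space n → ℝ} {g : Space n → Space n}
    (h : IsSobolevZero Ω q v g) (c : ℝ) :
    IsSobolevZero Ω q (fun x => c * v x) (fun x => c • g x) := by
  obtain ⟨φ, hφ, hφg⟩ := h.exists_approx
  refine isSobolevZero_of_tendsto hq (φ := fun k => c • φ k) (h.memLp.const_mul c)
    (h.memLp_grad.const_smul c) ?_ ?_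
  · convert ENNReal.Tendsto.const_mul (a := ‖c‖ₑ) hφ (Or.inr (by simp)) using 2 with k
    · rw [← eLpNorm_const_smul]
      congr 1
      ext x
      simp [mul_sub]
    · simp
  · convert ENNReal.Tendsto.const_mul (a := ‖c‖ₑ) hφg (Or.inr (by simp)) using 2 with k
    · rw [← eLpNorm_const_smul]
      congr 1
      ext1 x
      rw [show ∇ (c • φ k) x = c • ∇ (φ k) x from
        gradient_const_mul ((φ k).contDiff.differentiable (by simp) x) c]
      exact (smul_sub _ _ _).symm
    · simp

end SobolevZero

section CapacityEstimate

variable {n : ℕ} {Ω : Opens (Space n)} {p q : ℝ≥0∞}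

/-- A smooth truncation of the square: it vanishes at `0`, takes values in `[0, 1]`, is dominated
by `|t|` and is at least `1 / 2` outside `(-1, 1)`. -/
def softSq (t : ℝ) : ℝ := t ^ 2 / (1 + t ^ 2)

theorem contDiff_softSq : ContDiff ℝ (⊤ : ℕ∞) softSq :=
  (contDiff_id.pow 2).div (contDiff_const.add (contDiff_id.pow 2)) fun t => by
    have := sq_nonneg t
    positivity

theorem softSq_zero : softSq 0 = 0 := by simp [softSq]

theorem softSq_nonneg (t : ℝ) : 0 ≤ softSq t := by unfold softSq; positivity

theorem softSq_le_one (t : ℝ) : softSq t ≤ 1 := by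
  unfold softSq
  rw [div_le_one (by positivity)]
  linarith

theorem half_le_softSq {t : ℝ} (ht : 1 ≤ |t|) : 1 / 2 ≤ softSq t := by
  unfold softSq
  rw [div_le_div_iff₀ (by norm_num) (by positivity), ← sq_abs]
  nlinarith

/-- The derivative of `softSq`. -/
def softSqDeriv (t : ℝ) : ℝ := 2 * t / (1 + t ^ 2) ^ 2

theorem hasDerivAt_softSq (t : ℝ) : HasDerivAt softSq (softSqDeriv t) t := by
  have h0 : (1 + t ^ 2) ≠ 0 := by positivity
  have h := ((hasDerivAt_id t).pow 2).div (((hasDerivAt_id t).pow 2).const_add 1) h0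
  refine h.congr_deriv ?_
  simp [softSqDeriv]
  field_simp
  ring

theorem abs_softSqDeriv_le (t : ℝ) : |softSqDeriv t| ≤ 1 := by
  unfold softSqDeriv
  rw [abs_div, abs_of_nonneg (by positivity : (0 : ℝ) ≤ (1 + t ^ 2) ^ 2),
    div_le_one (by positivity), abs_mul, abs_two]
  have h : t ^ 2 = |t| ^ 2 := (sq_abs t).symm
  rw [h]
  nlinarith [sq_nonneg (|t| - 1), sq_nonneg (|t|), sq_nonneg (|t| ^ 2)]

theorem abs_softSq_sub_le (s t : ℝ) : |softSq s - softSq t| ≤ |s - t| := by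
  have := Convex.norm_image_sub_le_of_norm_hasDerivWithin_le (C := 1) (s := Set.univ)
    (fun t _ => (hasDerivAt_softSq t).hasDerivWithinAt) (fun t _ => abs_softSqDeriv_le t)
    convex_univ (Set.mem_univ t) (Set.mem_univ s)
  simpa using this

theorem softSq_le_abs (t : ℝ) : softSq t ≤ |t| := by
  simpa [softSq_zero, abs_of_nonneg (softSq_nonneg t)] using abs_softSq_sub_le t 0

theorem gradient_softSq_comp {f : Space n → ℝ} {x : Space n} (hf : DifferentiableAt ℝ f x) :
    ∇ (fun y => softSq (f y)) x = softSqDeriv (f x) • ∇ f x := by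
  have h : fderiv ℝ (fun y => softSq (f y)) x = _ :=
    ((hasDerivAt_softSq (f x)).comp_hasFDerivAt x hf.hasFDerivAt).fderiv
  simp [gradient, h]

theorem contDiff_softSq_comp (φ : 𝓓(Ω, ℝ)) : ContDiff ℝ (⊤ : ℕ∞) fun x => softSq (φ x) :=
  contDiff_softSq.comp φ.contDiff

theorem hasCompactSupport_softSq_comp (φ : 𝓓(Ω, ℝ)) : HasCompactSupport fun x => softSq (φ x) :=
  φ.hasCompactSupport.comp_left softSq_zero

theorem IsMollifier.gradient_mollify {g : Space n → ℝ} {δ : ℝ} (hg : IsMollifier g δ)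
    {f : Space n → ℝ} (hf : ContDiff ℝ (⊤ : ℕ∞) f) (hc : HasCompactSupport f) (x : Space n) :
    ∇ (mollify g f) x = mollify g (∇ f) x := by
  have hsob : IsSobolev ⊤ 1 f (∇ f) := isSobolev_of_contDiff hf hc
  simpa using hsob.gradient_mollify le_rfl hg (x := x) (by simp)

theorem IsMollifier.enorm_mollify_le [p.HolderConjugate q] {g : Space n → ℝ} {δ : ℝ}
    (hg : IsMollifier g δ) {f : Space n → ℝ} (hf : AEStronglyMeasurable f) (x : Space n) :
    ‖mollify g f x‖ₑ ≤ eLpNorm g p volume * eLpNorm f q volume := by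
  have hmp : MeasurePreserving (fun y : Space n => x - y) :=
    Measure.measurePreserving_sub_left volume x
  calc ‖mollify g f x‖ₑ ≤ eLpNorm (fun y => g (x - y) * f y) 1 volume := by
        rw [mollify_apply, eLpNorm_one_eq_lintegral_enorm]
        exact enorm_integral_le_lintegral_enorm _
    _ ≤ eLpNorm (fun y => g (x - y)) p volume * eLpNorm f q volume :=
        (eLpNorm_le_eLpNorm_mul_eLpNorm'_of_norm (c := 1)
          (hg.continuous.comp (continuous_sub_left x)).aestronglyMeasurable hf (· * ·)
          (ae_of_all _ fun x => by simp)).trans_eq (by rw [ENNReal.coe_one, one_mul]; rfl)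
    _ = eLpNorm g p volume * eLpNorm f q volume := by
        rw [← eLpNorm_comp_measurePreserving hg.continuous.aestronglyMeasurable hmp]
        rfl

theorem IsMollifier.eLpNorm_mollify_softSq_le {g : Space n → ℝ} {δ : ℝ} (hg : IsMollifier g δ)
    (hq1 : 1 ≤ q) (hq : q ≠ ∞) (φ : 𝓓(Ω, ℝ)) :
    eLpNorm (mollify g fun x => softSq (φ x)) q volume ≤ eLpNorm φ q (volume.restrict Ω) := by
  rw [eLpNorm_restrict_eq_of_support_subset
    ((subset_tsupport _).trans φ.tsupport_subset : Function.support φ ⊆ Ω)]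
  refine (hg.eLpNorm_mollify_le (contDiff_softSq_comp φ).continuous.aestronglyMeasurable hq1
    hq).trans (eLpNorm_mono fun x => ?_)
  rw [Real.norm_of_nonneg (softSq_nonneg _)]
  exact softSq_le_abs _

theorem IsMollifier.eLpNorm_gradient_mollify_softSq_le {g : Space n → ℝ} {δ : ℝ}
    (hg : IsMollifier g δ) (hq1 : 1 ≤ q) (hq : q ≠ ∞) (φ : 𝓓(Ω, ℝ)) :
    eLpNorm (∇ (mollify g fun x => softSq (φ x))) q volume ≤
      eLpNorm (∇ φ) q (volume.restrict Ω) := by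
  have hsupp : Function.support (∇ φ) ⊆ Ω := fun x hx => by
    by_contra h
    exact hx (gradient_testFunction_eq_zero φ h)
  rw [eLpNorm_restrict_eq_of_support_subset hsupp, funext (hg.gradient_mollify
    (contDiff_softSq_comp φ) (hasCompactSupport_softSq_comp φ))]
  refine (hg.eLpNorm_mollify_le (continuous_gradient
    (contDiff_softSq_comp φ)).aestronglyMeasurable hq1 hq).trans (eLpNorm_mono fun x => ?_)
  rw [gradient_softSq_comp (φ.contDiff.differentiable (by simp) x), norm_smul]
  exact mul_le_of_le_one_left (norm_nonneg _) (abs_softSqDeriv_le _)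

theorem locallyIntegrable_indicator_softSq {v : Space n → ℝ}
    (hv : AEStronglyMeasurable v (volume.restrict Ω)) :
    LocallyIntegrable ((Ω : Set (Space n)).indicator fun x => softSq (v x)) := by
  have hm : AEStronglyMeasurable ((Ω : Set (Space n)).indicator fun x => softSq (v x)) :=
    (aestronglyMeasurable_indicator_iff Ω.isOpen.measurableSet).2
      (contDiff_softSq.continuous.comp_aestronglyMeasurable hv)
  refine (memLp_top_of_bound hm 1 (ae_of_all _ fun x => ?_)).locallyIntegrable le_top
  refine (norm_indicator_le_norm_self _ x).trans ?_
  rw [Real.norm_of_nonneg (softSq_nonneg _)]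
  exact softSq_le_one _

theorem eLpNorm_indicator_softSq_sub_le (v : Space n → ℝ) (φ : 𝓓(Ω, ℝ)) :
    eLpNorm ((Ω : Set (Space n)).indicator (fun x => softSq (v x)) - fun x => softSq (φ x)) q
      volume ≤ eLpNorm (fun x => φ x - v x) q (volume.restrict Ω) := by
  rw [← eLpNorm_indicator_eq_eLpNorm_restrict Ω.isOpen.measurableSet]
  refine eLpNorm_mono fun x => ?_
  by_cases hx : x ∈ (Ω : Set (Space n))
  · simpa [Set.indicator_of_mem hx, abs_sub_comm (v x)] using abs_softSq_sub_le (v x) (φ x)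
  · simp [Set.indicator_of_notMem hx, testFunction_eq_zero φ hx, softSq_zero]

theorem eLpNorm_le_eLpNorm_add_eLpNorm_sub {X F : Type*} [MeasurableSpace X] {μ : Measure X}
    [NormedAddCommGroup F] {f f' : X → F} (hf : AEStronglyMeasurable f μ)
    (hf' : AEStronglyMeasurable f' μ) (hq : 1 ≤ q) :
    eLpNorm f' q μ ≤ eLpNorm f q μ + eLpNorm (fun x => f' x - f x) q μ := by
  calc eLpNorm f' q μ = eLpNorm (f + (f' - f)) q μ := by rw [add_sub_cancel]
    _ ≤ _ := eLpNorm_add_le hf (hf'.sub hf) hq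

theorem IsSobolevZero.exists_contDiff_mollify_softSq_le (hq1 : 1 ≤ q) (hq : q ≠ ∞)
    {v : Space n → ℝ} {G : Space n → Space n} (hv : IsSobolevZero Ω q v G) {g : Space n → ℝ}
    {δ : ℝ} (hg : IsMollifier g δ) {ε : ℝ≥0} (hε : ε ≠ 0) :
    ∃ ψ : Space n → ℝ, ContDiff ℝ (⊤ : ℕ∞) ψ ∧ (∀ x, ψ x ∈ Set.Icc 0 1) ∧
      eLpNorm ψ q volume ≤ eLpNorm v q (volume.restrict Ω) + ε ∧
      eLpNorm (∇ ψ) q volume ≤ eLpNorm G q (volume.restrict Ω) + ε ∧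
      ∀ x, mollify g ((Ω : Set (Space n)).indicator fun x => softSq (v x)) x ≤ ψ x + ε := by
  obtain ⟨p, hp⟩ : ∃ p : ℝ≥0∞, p.HolderConjugate q :=
    ⟨_, (ENNReal.HolderConjugate.conjExponent hq1).symm⟩
  obtain ⟨φ, hφ, hφG⟩ := hv.exists_approx
  have hgp : eLpNorm g p volume ≠ ∞ :=
    (hg.continuous.memLp_of_hasCompactSupport hg.hasCompactSupport).2.ne
  have hlim : Tendsto (fun k => eLpNorm g p volume *
      eLpNorm (fun x => φ k x - v x) q (volume.restrict Ω)) atTop (𝓝 0) := by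
    simpa using ENNReal.Tendsto.const_mul hφ (Or.inr hgp)
  have hε' : (0 : ℝ≥0∞) < ε := by exact_mod_cast pos_iff_ne_zero.2 hε
  obtain ⟨k, hk, hkG, hkg⟩ := ((hφ.eventually_le_const hε').and
    ((hφG.eventually_le_const hε').and (hlim.eventually_le_const hε'))).exists
  have hloc := locallyIntegrable_indicator_softSq hv.memLp.1
  have hf := contDiff_softSq_comp (φ k)
  refine ⟨mollify g fun x => softSq (φ k x), hg.contDiff_mollify hf.continuous.locallyIntegrable,
    fun x => ⟨hg.le_mollify hf.continuous.locallyIntegrable (ae_of_all _ fun y _ =>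
      softSq_nonneg _), (Real.le_norm_self _).trans
      (hg.norm_mollify_le (M := 1) (ae_of_all _ fun y => ?_) x)⟩,
    (hg.eLpNorm_mollify_softSq_le hq1 hq (φ k)).trans ?_,
    (hg.eLpNorm_gradient_mollify_softSq_le hq1 hq (φ k)).trans ?_, fun x => ?_⟩
  · rw [Real.norm_of_nonneg (softSq_nonneg _)]
    exact softSq_le_one _
  · exact (eLpNorm_le_eLpNorm_add_eLpNorm_sub hv.memLp.1
      (φ k).continuous.aestronglyMeasurable hq1).trans (by gcongr)
  · exact (eLpNorm_le_eLpNorm_add_eLpNorm_sub hv.memLp_grad.1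
      (continuous_gradient (φ k).contDiff).aestronglyMeasurable hq1).trans (by gcongr)
  · have h := (hg.enorm_mollify_le (p := p) (q := q)
      (hloc.aestronglyMeasurable.sub hf.continuous.aestronglyMeasurable) x).trans
      ((mul_le_mul_right (eLpNorm_indicator_softSq_sub_le v (φ k)) _).trans hkg)
    rw [hg.mollify_sub hloc hf.continuous.locallyIntegrable, Pi.sub_apply,
      enorm_le_coe, ← NNReal.coe_le_coe, coe_nnnorm] at h
    exact sub_le_iff_le_add'.1 ((Real.le_norm_self _).trans h)

theorem exists_contDiff_add_ge (hq1 : 1 ≤ q) (hq : q ≠ ∞) {v w : Space n → ℝ}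
    {G H : Space n → Space n} (hv : IsSobolevZero Ω q v G) (hw : IsSobolevZero Ω q w H)
    {W K : Set (Space n)} (hW : IsOpen W) (hWΩ : W ⊆ Ω)
    (hvw : ∀ᵐ x ∂(volume.restrict W), 1 ≤ |v x| ∨ 1 ≤ |w x|) (hK : IsCompact K) (hKW : K ⊆ W)
    {ε : ℝ≥0} (hε : ε ≠ 0) (hε' : ε ≤ 1 / 8) :
    ∃ ψ χ : Space n → ℝ, ContDiff ℝ (⊤ : ℕ∞) ψ ∧ ContDiff ℝ (⊤ : ℕ∞) χ ∧
      (∀ x, ψ x ∈ Set.Icc 0 1) ∧ (∀ x, χ x ∈ Set.Icc 0 1) ∧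
      eLpNorm ψ q volume ≤ eLpNorm v q (volume.restrict Ω) + ε ∧
      eLpNorm χ q volume ≤ eLpNorm w q (volume.restrict Ω) + ε ∧
      eLpNorm (∇ ψ) q volume ≤ eLpNorm G q (volume.restrict Ω) + ε ∧
      eLpNorm (∇ χ) q volume ≤ eLpNorm H q (volume.restrict Ω) + ε ∧
      ∀ x ∈ K, 1 / 4 ≤ ψ x + χ x := by
  obtain ⟨δ, hδ, hδW⟩ := hK.exists_cthickening_subset_open hW hKW
  obtain ⟨g, hg, -⟩ := exists_isMollifier (0 : Space n) hδ
  rw [norm_zero, add_zero] at hg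
  obtain ⟨ψ, hψ, hψ01, hψv, hψG, hvψ⟩ := hv.exists_contDiff_mollify_softSq_le hq1 hq hg hε
  obtain ⟨χ, hχ, hχ01, hχw, hχH, hwχ⟩ := hw.exists_contDiff_mollify_softSq_le hq1 hq hg hε
  refine ⟨ψ, χ, hψ, hχ, hψ01, hχ01, hψv, hχw, hψG, hχH, fun x hx => ?_⟩
  let f := (Ω : Set (Space n)).indicator fun x => softSq (v x)
  let f' := (Ω : Set (Space n)).indicator fun x => softSq (w x)
  have hf : LocallyIntegrable f := locallyIntegrable_indicator_softSq hv.memLp.1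
  have hf' : LocallyIntegrable f' := locallyIntegrable_indicator_softSq hw.memLp.1
  have hhalf : 1 / 2 ≤ mollify g (f + f') x := by
    refine hg.le_mollify (hf.add hf') ?_
    filter_upwards [(ae_restrict_iff' hW.measurableSet).1 hvw] with y hy hyx
    have hyW : y ∈ W := hδW (Metric.mem_cthickening_of_dist_le y x δ K hx hyx.le)
    simp only [Pi.add_apply, f, f', Set.indicator_of_mem (hWΩ hyW)]
    rcases hy hyW with hy | hy
    · linarith [half_le_softSq hy, softSq_nonneg (w y)]
    · linarith [half_le_softSq hy, softSq_nonneg (v y)]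
  have hadd : mollify g (f + f') x = mollify g f x + mollify g f' x := by
    simp only [mollify_apply, Pi.add_apply, smul_add]
    exact integral_add (hg.integrable_smul hf x) (hg.integrable_smul hf' x)
  have hε8 : (ε : ℝ) ≤ 1 / 8 := by exact_mod_cast hε'
  linarith only [hvψ x, hwχ x, hhalf, hadd, hε8]

theorem measure_le_four_mul_lintegral_add_lintegral {X : Type*} [MeasurableSpace X]
    {M : Measure X} {ψ χ : X → ℝ} (hψ : Measurable ψ) (hχ : Measurable χ) (hψ0 : ∀ x, 0 ≤ ψ x)
    (hχ0 : ∀ x, 0 ≤ χ x) {K : Set X} (hK : MeasurableSet K) (hψχ : ∀ x ∈ K, 1 / 4 ≤ ψ x + χ x) :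
    M K ≤ 4 * (∫⁻ x, ‖ψ x‖ₑ ∂M + ∫⁻ x, ‖χ x‖ₑ ∂M) := by
  rw [← lintegral_add_left hψ.enorm,
    ← lintegral_const_mul _ (f := fun x => ‖ψ x‖ₑ + ‖χ x‖ₑ) (hψ.enorm.add hχ.enorm),
    ← one_mul (M K), ← setLIntegral_const]
  refine (setLIntegral_mono' hK fun x hx => ?_).trans (setLIntegral_le_lintegral _ _)
  rw [Real.enorm_of_nonneg (hψ0 x), Real.enorm_of_nonneg (hχ0 x),
    ← ENNReal.ofReal_add (hψ0 x) (hχ0 x), ← ENNReal.ofReal_ofNat,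
    ← ENNReal.ofReal_mul (by norm_num), ENNReal.one_le_ofReal]
  linarith [hψχ x hx]

theorem HasStrain.tendsto_variation_of_isSobolevZero [p.HolderConjugate q] (hq : q ≠ ∞)
    {u : Space n → Space n} {μ : VectorMeasure (Space n) (Mat n)} (h : HasStrain Ω u μ)
    (hu : MemLp u p (volume.restrict Ω)) {v w : ℕ → Space n → ℝ} {G H : ℕ → Space n → Space n}
    (hv : ∀ k, IsSobolevZero Ω q (v k) (G k)) (hw : ∀ k, IsSobolevZero Ω q (w k) (H k))
    (hv0 : Tendsto (fun k => eLpNorm (v k) q (volume.restrict Ω)) atTop (𝓝 0))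
    (hw0 : Tendsto (fun k => eLpNorm (w k) q (volume.restrict Ω)) atTop (𝓝 0))
    (hG0 : Tendsto (fun k => eLpNorm (G k) q (volume.restrict Ω)) atTop (𝓝 0))
    (hH0 : Tendsto (fun k => eLpNorm (H k) q (volume.restrict Ω)) atTop (𝓝 0))
    {W : ℕ → Set (Space n)} (hW : ∀ k, IsOpen (W k)) (hWΩ : ∀ k, W k ⊆ Ω)
    (hvw : ∀ k, ∀ᵐ x ∂(volume.restrict (W k)), 1 ≤ |v k x| ∨ 1 ≤ |w k x|) :
    Tendsto (fun k => μ.variation (W k)) atTop (𝓝 0) := by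
  have hq1 : 1 ≤ q := ENNReal.HolderConjugate.one_le q p
  have : IsFiniteMeasure μ.variation := ⟨h.variation_lt_top⟩
  let ε : ℕ → ℝ≥0 := fun k => 1 / 8 * (1 / (k + 1))
  have hε0 (k) : ε k ≠ 0 := by positivity
  have hε8 (k) : ε k ≤ 1 / 8 :=
    mul_le_of_le_one_right' ((div_le_one (by positivity)).2 (by simp))
  have hε : Tendsto (fun k => (ε k : ℝ≥0∞)) atTop (𝓝 0) := by
    have : Tendsto ε atTop (𝓝 (1 / 8 * 0)) :=
      tendsto_one_div_add_atTop_nhds_zero_nat.const_mul _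
    rw [mul_zero] at this
    exact ENNReal.tendsto_coe.2 this
  choose K hKW hK hWK using fun k => (hW k).measurableSet.exists_isCompact_lt_add
    (measure_ne_top μ.variation (W k)) (ENNReal.coe_ne_zero.2 (hε0 k))
  choose ψ χ hψ hχ hψ01 hχ01 hψv hχw hψG hχH hψχ using fun k =>
    exists_contDiff_add_ge hq1 hq (hv k) (hw k) (hW k) (hWΩ k) (hvw k) (hK k) (hKW k) (hε0 k)
      (hε8 k)
  have hsmall {θ : ℕ → ℝ≥0∞} (hθ : Tendsto θ atTop (𝓝 0)) {E : Type} [NormedAddCommGroup E]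
      {f : ℕ → Space n → E} (hf : ∀ k, eLpNorm (f k) q volume ≤ θ k + ε k) :
      Tendsto (fun k => eLpNorm (f k) q (volume.restrict (Ω : Set (Space n)))) atTop (𝓝 0) :=
    tendsto_of_tendsto_of_tendsto_of_le_of_le tendsto_const_nhds
      (by simpa using hθ.add hε) (fun _ => zero_le)
      fun k => (eLpNorm_mono_measure _ Measure.restrict_le_self).trans (hf k)
  have hlim := (ENNReal.Tendsto.const_mul (a := 4)
    ((h.tendsto_lintegral_variation hu hψ hψ01 (hsmall hv0 hψv) (hsmall hG0 hψG)).add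
      (h.tendsto_lintegral_variation hu hχ hχ01 (hsmall hw0 hχw) (hsmall hH0 hχH)))
    (Or.inr (by simp))).add hε
  simp only [add_zero, mul_zero] at hlim
  refine tendsto_of_tendsto_of_tendsto_of_le_of_le tendsto_const_nhds hlim (fun _ => zero_le)
    fun k => (hWK k).le.trans ?_
  gcongr
  exact measure_le_four_mul_lintegral_add_lintegral (hψ k).continuous.measurable
    (hχ k).continuous.measurable (fun x => (hψ01 k x).1) (fun x => (hχ01 k x).1)
    (hK k).measurableSet (hψχ k)

end CapacityEstimate

section Poincare

variable {n : ℕ} {Ω : Opens (Space n)} {q : ℝ≥0∞}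

theorem norm_gradient (f : Space n → ℝ) (x : Space n) : ‖∇ f x‖ = ‖fderiv ℝ f x‖ := by
  simp [gradient]

theorem eLpNorm_fderiv_testFunction (φ : 𝓓(Ω, ℝ)) (q : ℝ≥0∞) :
    eLpNorm (fderiv ℝ φ) q volume = eLpNorm (∇ φ) q (volume.restrict Ω) := by
  rw [← eLpNorm_restrict_eq_of_support_subset (s := (Ω : Set (Space n))) (f := fderiv ℝ φ)]
  · exact eLpNorm_congr_norm_ae (ae_of_all _ fun x => (norm_gradient φ x).symm)
  · exact ((subset_tsupport _).trans (tsupport_fderiv_subset ℝ)).trans φ.tsupport_subset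

theorem exists_eLpNorm_testFunction_le_gradient (hn : 2 ≤ n)
    (hb : Bornology.IsBounded (Ω : Set (Space n))) :
    ∃ C : ℝ≥0∞, C ≠ ∞ ∧ ∀ φ : 𝓓(Ω, ℝ),
      eLpNorm φ n (volume.restrict Ω) ≤ C * eLpNorm (∇ φ) n (volume.restrict Ω) := by
  -- The Sobolev conjugate of the exponent `n / 2` is `n`.
  let r : ℝ≥0 := n / 2
  have hn' : (2 : ℝ≥0) ≤ n := by exact_mod_cast hn
  have hr1 : 1 ≤ r := (one_le_div (by norm_num)).2 hn'
  have hrn : r < n := half_lt_self (by positivity)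
  have hrconj : (r : ℝ)⁻¹ - (Module.finrank ℝ (Space n) : ℝ)⁻¹ ≤ ((n : ℝ≥0) : ℝ)⁻¹ := by
    simp only [finrank_euclideanSpace, Fintype.card_fin, r, NNReal.coe_div, NNReal.coe_natCast,
      NNReal.coe_ofNat]
    field_simp
    norm_num
  set c : ℝ≥0 := eLpNormLESNormFDerivOfLeConst ℝ (volume : Measure (Space n)) Ω r n
  set V : ℝ≥0∞ := volume (Ω : Set (Space n)) ^ (1 / (r : ℝ≥0∞).toReal - 1 / (n : ℝ≥0∞).toReal)
  have hV : V ≠ ∞ := by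
    refine ENNReal.rpow_ne_top_of_nonneg (sub_nonneg.2 ?_) hb.measure_lt_top.ne
    rw [ENNReal.coe_toReal, ENNReal.toReal_natCast]
    gcongr
    exact hrn.le
  refine ⟨c * V, ENNReal.mul_ne_top ENNReal.coe_ne_top hV, fun φ => ?_⟩
  have hGNS := eLpNorm_le_eLpNorm_fderiv_of_le (μ := (volume : Measure (Space n))) (p := r)
    (q := n) (φ.contDiff.of_le (by simp)) ((subset_tsupport _).trans φ.tsupport_subset) hr1
    (by simpa using hrn) hrconj hb
  have hHolder := eLpNorm_le_eLpNorm_mul_rpow_measure_univ (p := r) (q := n)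
    (μ := volume.restrict (Ω : Set (Space n))) (by exact_mod_cast hrn.le)
    (continuous_gradient φ.contDiff).aestronglyMeasurable
  rw [Measure.restrict_apply_univ, mul_comm] at hHolder
  rw [eLpNorm_fderiv_testFunction] at hGNS
  calc eLpNorm φ n (volume.restrict Ω) ≤ eLpNorm φ (n : ℝ≥0) volume :=
        eLpNorm_mono_measure _ Measure.restrict_le_self
    _ ≤ c * (V * eLpNorm (∇ φ) n (volume.restrict Ω)) := hGNS.trans (mul_le_mul_right hHolder _)
    _ = c * V * eLpNorm (∇ φ) n (volume.restrict Ω) := (mul_assoc _ _ _).symm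

theorem IsSobolevZero.eLpNorm_le_gradient (hq : 1 ≤ q) {C : ℝ≥0∞} (hC : C ≠ ∞)
    (hpoincare : ∀ φ : 𝓓(Ω, ℝ),
      eLpNorm φ q (volume.restrict Ω) ≤ C * eLpNorm (∇ φ) q (volume.restrict Ω))
    {v : Space n → ℝ} {G : Space n → Space n} (hv : IsSobolevZero Ω q v G) :
    eLpNorm v q (volume.restrict Ω) ≤ C * eLpNorm G q (volume.restrict Ω) := by
  obtain ⟨φ, hφ, hφG⟩ := hv.exists_approx
  have hlim : Tendsto (fun k => C * (eLpNorm G q (volume.restrict Ω) +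
      eLpNorm (fun x => ∇ (φ k) x - G x) q (volume.restrict Ω)) +
      eLpNorm (fun x => φ k x - v x) q (volume.restrict Ω)) atTop
      (𝓝 (C * (eLpNorm G q (volume.restrict Ω) + 0) + 0)) :=
    (ENNReal.Tendsto.const_mul (tendsto_const_nhds.add hφG) (Or.inr hC)).add hφ
  rw [add_zero, add_zero] at hlim
  refine ge_of_tendsto' hlim fun k => ?_
  have hφm := (φ k).continuous.aestronglyMeasurable (μ := volume.restrict (Ω : Set (Space n)))
  have hgm := (continuous_gradient (φ k).contDiff).aestronglyMeasurable
    (μ := volume.restrict (Ω : Set (Space n)))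
  calc eLpNorm v q (volume.restrict Ω)
      ≤ eLpNorm (φ k) q (volume.restrict Ω) +
          eLpNorm (fun x => v x - φ k x) q (volume.restrict Ω) :=
        eLpNorm_le_eLpNorm_add_eLpNorm_sub hφm hv.memLp.1 hq
    _ ≤ _ := by
        gcongr
        · exact (hpoincare _).trans (mul_le_mul_right
            (eLpNorm_le_eLpNorm_add_eLpNorm_sub hv.memLp_grad.1 hgm hq) _)
        · exact (eLpNorm_sub_comm _ _ _ _).le

theorem exists_isSobolevZero_of_capacity_lt (hq0 : q ≠ 0) (hq : q ≠ ∞) {A : Set (Space n)}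
    {ε : ℝ≥0∞} (h : capacity q A Ω < ε ^ q.toReal) :
    ∃ (v : Space n → ℝ) (G : Space n → Space n) (U : Set (Space n)),
      IsSobolevZero Ω q v G ∧ eLpNorm G q (volume.restrict Ω) < ε ∧
      IsOpen U ∧ A ⊆ U ∧ U ⊆ Ω ∧ ∀ᵐ x ∂(volume.restrict U), 1 ≤ v x := by
  simp only [capacity, iInf_lt_iff] at h
  obtain ⟨v, G, hv, ⟨U, hU, hAU, hUΩ, hUv⟩, hG⟩ := h
  refine ⟨v, G, U, hv, ?_, hU, hAU, hUΩ, hUv⟩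
  rwa [eLpNorm_eq_lintegral_rpow_enorm_toReal hq0 hq, one_div,
    ENNReal.rpow_inv_lt_iff (ENNReal.toReal_pos hq0 hq)]

end Poincare

section Smoothing

variable {n : ℕ} {Ω : Opens (Space n)} {q : ℝ≥0∞} {F : Type*} [NormedAddCommGroup F]
  [NormedSpace ℝ F]

theorem exists_isMollifier_one_div (n k : ℕ) :
    ∃ g : Space n → ℝ, IsMollifier g (1 / ((k : ℝ) + 1)) := by
  obtain ⟨g, hg, -⟩ := exists_isMollifier (0 : Space n) (Nat.one_div_pos_of_nat (n := k) (α := ℝ))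
  exact ⟨g, by simpa using hg⟩

/-- A chosen mollifier of radius `1 / (k + 1)`. -/
def stdMollifier (n k : ℕ) : Space n → ℝ := (exists_isMollifier_one_div n k).choose

theorem isMollifier_stdMollifier (k : ℕ) : IsMollifier (stdMollifier n k) (1 / ((k : ℝ) + 1)) :=
  (exists_isMollifier_one_div n k).choose_spec

/-- The smooth approximations of a function on `Ω` obtained by mollifying its extension by zero. -/
def smoothing (Ω : Opens (Space n)) (f : Space n → F) (k : ℕ) : Space n → F :=
  mollify (stdMollifier n k) ((Ω : Set (Space n)).indicator f)

theorem contDiff_smoothing (hq : 1 ≤ q) {f : Space n → F} (hf : MemLp f q (volume.restrict Ω))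
    (k : ℕ) : ContDiff ℝ (⊤ : ℕ∞) (smoothing Ω f k) :=
  (isMollifier_stdMollifier k).contDiff_mollify
    (((memLp_indicator_iff_restrict Ω.isOpen.measurableSet).2 hf).locallyIntegrable hq)

theorem tendsto_eLpNorm_smoothing_sub [CompleteSpace F] (hq : 1 ≤ q) (hq' : q ≠ ∞) {f : Space n → F}
    (hf : MemLp f q (volume.restrict Ω)) :
    Tendsto (fun k => eLpNorm (fun x => smoothing Ω f k x - f x) q (volume.restrict Ω)) atTop
      (𝓝 0) := by
  have hf' : MemLp ((Ω : Set (Space n)).indicator f) q :=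
    (memLp_indicator_iff_restrict Ω.isOpen.measurableSet).2 hf
  have hlim := tendsto_eLpNorm_mollify_sub (isMollifier_stdMollifier (n := n))
    tendsto_one_div_add_atTop_nhds_zero_nat hq hq' hf'
  refine tendsto_of_tendsto_of_tendsto_of_le_of_le tendsto_const_nhds hlim
    (fun _ => zero_le) fun k => ?_
  refine le_trans (le_of_eq (eLpNorm_congr_ae ?_)) (eLpNorm_mono_measure _ Measure.restrict_le_self)
  filter_upwards [ae_restrict_mem Ω.isOpen.measurableSet] with x hx
  rw [Pi.sub_apply, Set.indicator_of_mem hx]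
  rfl

theorem exists_norm_smoothing_le {f : Space n → F} (hf : MemLp f ∞ (volume.restrict Ω)) :
    ∃ M : ℝ, ∀ k x, ‖smoothing Ω f k x‖ ≤ M := by
  have hf' : MemLp ((Ω : Set (Space n)).indicator f) ∞ :=
    (memLp_indicator_iff_restrict Ω.isOpen.measurableSet).2 hf
  have hbound : ∀ᵐ x, ‖(Ω : Set (Space n)).indicator f x‖ ≤
      (eLpNorm ((Ω : Set (Space n)).indicator f) ∞).toReal := by
    filter_upwards [ae_le_eLpNormEssSup (f := (Ω : Set (Space n)).indicator f) (μ := volume)]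
      with x hx
    rw [← eLpNorm_exponent_top] at hx
    exact (toReal_enorm _).symm.trans_le (ENNReal.toReal_mono hf'.2.ne hx)
  exact ⟨_, fun k x => (isMollifier_stdMollifier k).norm_mollify_le hbound x⟩

theorem IsSobolev.gradient_smoothing (hq : 1 ≤ q) {v : Space n → ℝ} {G : Space n → Space n}
    (hv : IsSobolev Ω q v G) {K : Set (Space n)} (hK : IsCompact K) (hKΩ : K ⊆ Ω) :
    ∀ᶠ k in atTop, ∀ x ∈ K, ∇ (smoothing Ω v k) x = smoothing Ω G k x := by
  obtain ⟨δ, hδ, hKδ⟩ := hK.exists_cthickening_subset_open Ω.isOpen hKΩ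
  filter_upwards [(tendsto_one_div_add_atTop_nhds_zero_nat (𝕜 := ℝ)).eventually_lt_const hδ]
    with k hk x hx
  refine hv.gradient_mollify hq (isMollifier_stdMollifier k) fun y hy => hKδ ?_
  exact Metric.mem_cthickening_of_dist_le y x δ K hx ((Metric.mem_closedBall.1 hy).trans hk.le)

/-- The product of a test function and a smooth function. -/
def testMul (χ : 𝓓(Ω, ℝ)) {f : Space n → ℝ} (hf : ContDiff ℝ (⊤ : ℕ∞) f) : 𝓓(Ω, ℝ) :=
  ⟨fun x => χ x * f x, χ.contDiff.mul hf, χ.hasCompactSupport.mul_right,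
    (closure_mono (Function.support_mul_subset_left _ _)).trans χ.tsupport_subset⟩

theorem testMul_apply (χ : 𝓓(Ω, ℝ)) {f : Space n → ℝ} (hf : ContDiff ℝ (⊤ : ℕ∞) f)
    (x : Space n) : testMul χ hf x = χ x * f x := rfl

theorem gradient_testMul (χ : 𝓓(Ω, ℝ)) {f : Space n → ℝ} (hf : ContDiff ℝ (⊤ : ℕ∞) f)
    (x : Space n) : ∇ (testMul χ hf) x = χ x • ∇ f x + f x • ∇ χ x :=
  gradient_mul (χ.contDiff.differentiable (by simp) x) (hf.differentiable (by simp) x)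

theorem tendsto_eLpNorm_zero_of_norm_le_mul {X E' F' : Type*} [MeasurableSpace X] {μ : Measure X}
    [NormedAddCommGroup E'] [NormedAddCommGroup F'] {f : ℕ → X → E'} {g : ℕ → X → F'} (c : ℝ)
    (hf : Tendsto (fun k => eLpNorm (f k) q μ) atTop (𝓝 0))
    (hgf : ∀ k x, ‖g k x‖ ≤ c * ‖f k x‖) : Tendsto (fun k => eLpNorm (g k) q μ) atTop (𝓝 0) :=
  tendsto_of_tendsto_of_tendsto_of_le_of_le tendsto_const_nhds
    (by simpa using ENNReal.Tendsto.const_mul hf (Or.inr ENNReal.ofReal_ne_top))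
    (fun _ => zero_le) fun k => eLpNorm_le_mul_eLpNorm_of_ae_le_mul (ae_of_all _ (hgf k)) q

theorem tendsto_eLpNorm_testMul_smoothing_sub (hq : 1 ≤ q) (hq' : q ≠ ∞) {f : Space n → ℝ}
    (hf : MemLp f q (volume.restrict Ω)) (χ : 𝓓(Ω, ℝ)) :
    Tendsto (fun k => eLpNorm (fun x => testMul χ (contDiff_smoothing hq hf k) x - χ x * f x) q
      (volume.restrict Ω)) atTop (𝓝 0) := by
  obtain ⟨C, hC⟩ := χ.continuous.bounded_above_of_compact_support χ.hasCompactSupport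
  refine tendsto_eLpNorm_zero_of_norm_le_mul C (tendsto_eLpNorm_smoothing_sub hq hq' hf)
    fun k x => ?_
  rw [testMul_apply, ← mul_sub, norm_mul]
  gcongr
  exact hC x

theorem IsSobolev.tendsto_eLpNorm_gradient_testMul_smoothing_sub (hq : 1 ≤ q) (hq' : q ≠ ∞)
    {v : Space n → ℝ} {G : Space n → Space n} (hv : IsSobolev Ω q v G) (χ : 𝓓(Ω, ℝ)) :
    Tendsto (fun k => eLpNorm (fun x => ∇ (testMul χ (contDiff_smoothing hq hv.memLp k)) x -
      (χ x • G x + v x • ∇ χ x)) q (volume.restrict Ω)) atTop (𝓝 0) := by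
  obtain ⟨C, hC⟩ := χ.continuous.bounded_above_of_compact_support χ.hasCompactSupport
  obtain ⟨C', hC'⟩ := (continuous_gradient χ.contDiff).bounded_above_of_compact_support
    (hasCompactSupport_gradient χ.hasCompactSupport)
  have hsm (k) : AEStronglyMeasurable (smoothing Ω G k) (volume.restrict Ω) :=
    (contDiff_smoothing hq hv.memLp_grad k).continuous.aestronglyMeasurable
  have hG : Tendsto (fun k => eLpNorm (fun x => χ x • (smoothing Ω G k x - G x)) q
      (volume.restrict Ω)) atTop (𝓝 0) :=
    tendsto_eLpNorm_zero_of_norm_le_mul C (tendsto_eLpNorm_smoothing_sub hq hq' hv.memLp_grad)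
      fun k x => (norm_smul _ _).trans_le (by gcongr; exact hC x)
  have hv0 : Tendsto (fun k => eLpNorm (fun x => (smoothing Ω v k x - v x) • ∇ χ x) q
      (volume.restrict Ω)) atTop (𝓝 0) :=
    tendsto_eLpNorm_zero_of_norm_le_mul C' (tendsto_eLpNorm_smoothing_sub hq hq' hv.memLp)
      fun k x => (norm_smul _ _).trans_le ((mul_comm _ _).trans_le (by gcongr; exact hC' x))
  refine tendsto_of_tendsto_of_tendsto_of_le_of_le' tendsto_const_nhds
    (by simpa using hG.add hv0) (Eventually.of_forall fun _ => zero_le) ?_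
  filter_upwards [hv.gradient_smoothing hq χ.hasCompactSupport χ.tsupport_subset] with k hk
  refine le_trans (le_of_eq (congrArg (eLpNorm · q _) (funext fun x => ?_)))
    (eLpNorm_add_le
      (χ.continuous.aestronglyMeasurable.smul ((hsm k).sub hv.memLp_grad.1))
      (((contDiff_smoothing hq hv.memLp k).continuous.aestronglyMeasurable.sub hv.memLp.1).smul
        (continuous_gradient χ.contDiff).aestronglyMeasurable) hq)
  rw [gradient_testMul]
  by_cases hx : x ∈ tsupport χ
  · rw [hk x hx]
    simp only [Pi.add_apply, smul_sub, sub_smul]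
    abel
  · simp [image_eq_zero_of_notMem_tsupport hx, gradient_eq_zero_of_notMem_tsupport hx]

theorem IsSobolev.isSobolevZero_testFunction_mul (hq : 1 ≤ q) (hq' : q ≠ ∞) {v : Space n → ℝ}
    {G : Space n → Space n} (hv : IsSobolev Ω q v G) (χ : 𝓓(Ω, ℝ)) :
    IsSobolevZero Ω q (fun x => χ x * v x) fun x => χ x • G x + v x • ∇ χ x := by
  refine isSobolevZero_of_tendsto hq ?_ ?_ (tendsto_eLpNorm_testMul_smoothing_sub hq hq' hv.memLp χ)
    (hv.tendsto_eLpNorm_gradient_testMul_smoothing_sub hq hq' χ)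
  · exact hv.memLp.mul (χ.continuous.memLp_top_of_hasCompactSupport χ.hasCompactSupport _)
  · exact (hv.memLp_grad.smul
      (χ.continuous.memLp_top_of_hasCompactSupport χ.hasCompactSupport _)).add
      ((memLp_gradient χ.contDiff χ.hasCompactSupport ∞ _).smul hv.memLp)

end Smoothing

/-! ### Quasicontinuous representatives and the strain -/

section Quasicontinuous

variable {n : ℕ} {Ω : Opens (Space n)} {p : ℝ≥0∞} [p.HolderConjugate (n : ℝ≥0∞)]
  {u : Space n → Space n} {μ : VectorMeasure (Space n) (Mat n)} {α αt : Space n → ℝ}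
  {G : Space n → Space n}

theorem exists_isOpen_superset_deviation {A U O : Set (Space n)} (hU : IsOpen U) (hUΩ : U ⊆ Ω)
    (hAU : A ⊆ U) (hO : IsOpen O) (hOΩ : O ⊆ Ω) (hcont : ContinuousOn αt (Ω \ A))
    (hαt : αt =ᵐ[volume.restrict Ω] α) {f : Space n → ℝ} (hf : Continuous f) {v : Space n → ℝ}
    (hv : ∀ᵐ x ∂(volume.restrict U), 1 ≤ v x) (t : ℝ) :
    ∃ W, IsOpen W ∧ W ⊆ Ω ∧ {x | t < ‖f x - αt x‖} ∩ O ⊆ W ∧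
      ∀ᵐ x ∂(volume.restrict W), 1 ≤ |v x| ∨ (x ∈ O ∧ t ≤ |f x - α x|) := by
  obtain ⟨V, hV, hVeq⟩ := continuousOn_iff'.1 (hf.continuousOn.sub hcont).norm _
    (isOpen_Ioi (a := t))
  have hdev {x} (hx : x ∈ O) (hxU : x ∉ U) : t < ‖f x - αt x‖ ↔ x ∈ V := by
    have hxA : x ∈ (Ω : Set (Space n)) \ A := ⟨hOΩ hx, fun hxA => hxU (hAU hxA)⟩
    simpa [hxA] using Set.ext_iff.1 hVeq x
  refine ⟨(V ∩ O) ∪ U, (hV.inter hO).union hU,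
    Set.union_subset (Set.inter_subset_right.trans hOΩ) hUΩ, fun x hx => ?_, ?_⟩
  · by_cases hxU : x ∈ U
    · exact Or.inr hxU
    · exact Or.inl ⟨(hdev hx.2 hxU).1 hx.1, hx.2⟩
  · rw [ae_restrict_iff' ((hV.inter hO).union hU).measurableSet]
    filter_upwards [(ae_restrict_iff' hU.measurableSet).1 hv,
      (ae_restrict_iff' Ω.isOpen.measurableSet).1 hαt] with x hxv hxα hx
    by_cases hxU : x ∈ U
    · exact Or.inl ((hxv hxU).trans (le_abs_self _))
    · have hxO := (hx.resolve_right hxU).2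
      rw [← hxα (hOΩ hxO)]
      exact Or.inr ⟨hxO, ((hdev hxO hxU).2 (hx.resolve_right hxU).1).le⟩

theorem IsQuasicontinuous.exists_isSobolevZero_tendsto (hn : 2 ≤ n)
    (hb : Bornology.IsBounded (Ω : Set (Space n))) (hαt : IsQuasicontinuous n Ω αt) :
    ∃ (v : ℕ → Space n → ℝ) (H : ℕ → Space n → Space n) (A U : ℕ → Set (Space n)),
      (∀ k, IsSobolevZero Ω n (v k) (H k)) ∧
      Tendsto (fun k => eLpNorm (v k) n (volume.restrict Ω)) atTop (𝓝 0) ∧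
      Tendsto (fun k => eLpNorm (H k) n (volume.restrict Ω)) atTop (𝓝 0) ∧
      ∀ k, IsOpen (U k) ∧ A k ⊆ U k ∧ U k ⊆ Ω ∧ ContinuousOn αt (Ω \ A k) ∧
        ∀ᵐ x ∂(volume.restrict (U k)), 1 ≤ v k x := by
  have hn0 : (n : ℝ≥0∞) ≠ 0 := by simp; omega
  have hn1 : (1 : ℝ≥0∞) ≤ n := by exact_mod_cast (by omega : 1 ≤ n)
  let ε : ℕ → ℝ≥0∞ := fun k => ((k : ℝ≥0∞) + 1)⁻¹
  have hε0 (k) : ε k ≠ 0 := by simp [ε]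
  have hε : Tendsto ε atTop (𝓝 0) := by
    simpa [ε] using (tendsto_add_atTop_iff_nat 1).2 ENNReal.tendsto_inv_nat_nhds_zero
  choose A _ hA hcont using fun k => hαt (ε k ^ (n : ℝ≥0∞).toReal)
    (ENNReal.rpow_pos (pos_iff_ne_zero.2 (hε0 k)) (by simp [ε]))
  choose v H U hv hH hU hAU hUΩ hUv using fun k =>
    exists_isSobolevZero_of_capacity_lt hn0 (ENNReal.natCast_ne_top n) (hA k)
  obtain ⟨C, hC, hpoincare⟩ := exists_eLpNorm_testFunction_le_gradient hn hb
  have hH0 : Tendsto (fun k => eLpNorm (H k) n (volume.restrict Ω)) atTop (𝓝 0) :=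
    tendsto_of_tendsto_of_tendsto_of_le_of_le tendsto_const_nhds hε (fun _ => zero_le)
      fun k => (hH k).le
  refine ⟨v, H, A, U, hv, ?_, hH0, fun k => ⟨hU k, hAU k, hUΩ k, hcont k, hUv k⟩⟩
  exact tendsto_of_tendsto_of_tendsto_of_le_of_le tendsto_const_nhds
    (by simpa using ENNReal.Tendsto.const_mul hH0 (Or.inr hC)) (fun _ => zero_le)
    fun k => (hv k).eLpNorm_le_gradient hn1 hC hpoincare

theorem IsSobolev.exists_isSobolevZero_smoothing_sub {q : ℝ≥0∞} (hq : 1 ≤ q) (hq' : q ≠ ∞)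
    (hα : IsSobolev Ω q α G) (χ : 𝓓(Ω, ℝ)) (t : ℝ) : ∃ H : ℕ → Space n → Space n,
      let w := fun k x => t * (χ x * (smoothing Ω α k x - α x))
      (∀ k, IsSobolevZero Ω q (w k) (H k)) ∧
      Tendsto (fun k => eLpNorm (w k) q (volume.restrict Ω)) atTop (𝓝 0) ∧
      Tendsto (fun k => eLpNorm (H k) q (volume.restrict Ω)) atTop (𝓝 0) := by
  let sm := contDiff_smoothing hq hα.memLp
  refine ⟨fun k x => t • (∇ (testMul χ (sm k)) x - (χ x • G x + α x • ∇ χ x)), fun k => ?_,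
    tendsto_eLpNorm_zero_of_norm_le_mul ‖t‖ (tendsto_eLpNorm_testMul_smoothing_sub hq hq'
      hα.memLp χ) fun k x => ?_,
    tendsto_eLpNorm_zero_of_norm_le_mul ‖t‖ (hα.tendsto_eLpNorm_gradient_testMul_smoothing_sub hq
      hq' χ) fun k x => (norm_smul _ _).le⟩
  · have h := ((isSobolevZero_testFunction (q := q) (testMul χ (sm k))).sub hq
      (hα.isSobolevZero_testFunction_mul hq hq' χ)).const_smul hq t
    simpa only [testMul_apply, ← mul_sub] using h
  · rw [testMul_apply, ← mul_sub]
    exact (norm_mul _ _).le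

theorem HasStrain.tendstoInMeasure_smoothing (hn : 2 ≤ n)
    (hb : Bornology.IsBounded (Ω : Set (Space n))) (h : HasStrain Ω u μ)
    (hu : MemLp u p (volume.restrict Ω)) (hα : IsSobolev Ω n α G)
    (hαt : IsQuasicontinuousRep n Ω α αt) {χ : 𝓓(Ω, ℝ)} {O : Set (Space n)} (hO : IsOpen O)
    (hOΩ : O ⊆ Ω) (hχ : ∀ x ∈ O, χ x = 1) :
    TendstoInMeasure (μ.variation.restrict O) (smoothing Ω α) atTop αt := by
  have hn1 : (1 : ℝ≥0∞) ≤ n := by exact_mod_cast (by omega : 1 ≤ n)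
  rw [tendstoInMeasure_iff_norm]
  intro ε hε
  obtain ⟨v, H, A, U, hv, hv0, hH0, hAU⟩ := hαt.1.exists_isSobolevZero_tendsto hn hb
  obtain ⟨H', hw, hw0, hH'0⟩ := hα.exists_isSobolevZero_smoothing_sub hn1
    (ENNReal.natCast_ne_top n) χ (ε / 2)⁻¹
  choose W hW hWΩ hsub hWv using fun k =>
    have ⟨hU, hAU, hUΩ, hcont, hUv⟩ := hAU k
    exists_isOpen_superset_deviation hU hUΩ hAU hO hOΩ hcont hαt.2
      (contDiff_smoothing hn1 hα.memLp k).continuous hUv (ε / 2)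
  have hlim := h.tendsto_variation_of_isSobolevZero (ENNReal.natCast_ne_top n) hu hv hw hv0 hw0 hH0
    hH'0 hW hWΩ fun k => by
      filter_upwards [hWv k] with x hx
      refine hx.imp_right fun ⟨hxO, hx⟩ => ?_
      rwa [hχ x hxO, one_mul, abs_mul, abs_of_pos (by positivity), inv_mul_eq_div,
        le_div_iff₀ (by positivity), one_mul]
  refine tendsto_of_tendsto_of_tendsto_of_le_of_le tendsto_const_nhds hlim (fun _ => zero_le)
    fun k => ?_
  rw [Measure.restrict_apply' hO.measurableSet]
  exact measure_mono fun x hx => hsub k ⟨(half_lt_self hε).trans_le hx.1, hx.2⟩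

theorem HasStrain.exists_tendsto_smoothing (hn : 2 ≤ n)
    (hb : Bornology.IsBounded (Ω : Set (Space n))) (h : HasStrain Ω u μ)
    (hu : MemLp u p (volume.restrict Ω)) (hα : IsSobolev Ω n α G)
    (hαt : IsQuasicontinuousRep n Ω α αt) {K : Set (Space n)} (hK : IsCompact K) (hKΩ : K ⊆ Ω) :
    ∃ ns : ℕ → ℕ, StrictMono ns ∧ ∀ᵐ x ∂(μ.variation.restrict K),
      Tendsto (fun k => smoothing Ω α (ns k) x) atTop (𝓝 (αt x)) := by
  obtain ⟨χ, hχ, -⟩ := exists_testFunction_eventually_eq_one hK hKΩ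
  obtain ⟨O, hO, hKO, hχO⟩ := mem_nhdsSet_iff_exists.1 hχ
  obtain ⟨ns, hns, hae⟩ := (h.tendstoInMeasure_smoothing hn hb hu hα hαt (hO.inter Ω.isOpen)
    Set.inter_subset_right fun x hx => hχO hx.1).exists_seq_tendsto_ae
  exact ⟨ns, hns, ae_restrict_of_ae_restrict_of_subset (Set.subset_inter hKO hKΩ) hae⟩

theorem exists_compact_exhaustion (Ω : Opens (Space n)) :
    ∃ K : ℕ → Set (Space n), (∀ j, IsCompact (K j)) ∧ (∀ j, K j ⊆ interior (K (j + 1))) ∧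
      ⋃ j, K j = (Ω : Set (Space n)) := by
  have : LocallyCompactSpace Ω := Ω.isOpen.locallyCompactSpace
  let E := CompactExhaustion.choice Ω
  refine ⟨fun j => Subtype.val '' E j, fun j => (E.isCompact j).image continuous_subtype_val,
    fun j => ?_, ?_⟩
  · exact (Set.image_mono (E.subset_interior_succ j)).trans
      (interior_maximal (Set.image_mono interior_subset)
        (Ω.isOpen.isOpenMap_subtype_val _ isOpen_interior))
  · rw [← Set.image_iUnion, E.iUnion_eq, Set.image_univ, Subtype.range_coe]

theorem HasStrain.aestronglyMeasurable_quasicontinuousRep (hn : 2 ≤ n)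
    (hb : Bornology.IsBounded (Ω : Set (Space n))) (h : HasStrain Ω u μ)
    (hu : MemLp u p (volume.restrict Ω)) (hα : IsSobolev Ω n α G)
    (hαt : IsQuasicontinuousRep n Ω α αt) {M : ℝ} (hM : ∀ k x, ‖smoothing Ω α k x‖ ≤ M) :
    AEStronglyMeasurable αt μ.variation ∧ ∀ᵐ x ∂μ.variation, ‖αt x‖ ≤ M := by
  have hn1 : (1 : ℝ≥0∞) ≤ n := by exact_mod_cast (by omega : 1 ≤ n)
  obtain ⟨K, hK, -, hKΩ⟩ := exists_compact_exhaustion Ω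
  have hres : μ.variation.restrict (⋃ j, K j) = μ.variation := by
    rw [hKΩ]
    exact Measure.restrict_eq_self_of_ae_mem (ae_iff.2 h.variation_compl)
  choose ns _ hlim using fun j =>
    h.exists_tendsto_smoothing hn hb hu hα hαt (hK j) (hKΩ ▸ Set.subset_iUnion K j)
  rw [← hres, aestronglyMeasurable_iUnion_iff, ae_restrict_iUnion_iff]
  refine ⟨fun j => aestronglyMeasurable_of_tendsto_ae atTop
    (fun k => (contDiff_smoothing hn1 hα.memLp _).continuous.aestronglyMeasurable) (hlim j),
    fun j => ?_⟩
  filter_upwards [hlim j] with x hx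
  exact le_of_tendsto' hx.norm fun k => hM _ x

end Quasicontinuous

/-! ### The product rule -/

section ProductRule

variable {n : ℕ} {Ω : Opens (Space n)} {p q : ℝ≥0∞}

theorem continuous_symTensor : Continuous fun z : Space n × Space n => symTensor z.1 z.2 := by
  unfold symTensor
  fun_prop

theorem symTensor_add_left (a a' b : Space n) :
    symTensor (a + a') b = symTensor a b + symTensor a' b := by
  ext s
  simp only [symTensor, PiLp.add_apply]
  ring

theorem symTensor_sub_left (a a' b : Space n) :
    symTensor (a - a') b = symTensor a b - symTensor a' b := by
  ext s
  simp only [symTensor, PiLp.sub_apply]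
  ring

theorem symTensor_smul_left (c : ℝ) (a b : Space n) : symTensor (c • a) b = c • symTensor a b := by
  ext s
  simp only [symTensor, PiLp.smul_apply, smul_eq_mul]
  ring

theorem symTensor_smul_right (c : ℝ) (a b : Space n) :
    symTensor a (c • b) = symTensor (c • a) b := by
  ext s
  simp only [symTensor, PiLp.smul_apply, smul_eq_mul]
  ring

theorem integrable_symTensor [p.HolderConjugate q] {m : Measure (Space n)} {G u : Space n → Space n}
    (hG : MemLp G q m) (hu : MemLp u p m) : Integrable (fun x => symTensor (G x) (u x)) m :=
  memLp_one_iff_integrable.1 (hG.of_bilin symTensor 1 hu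
    (continuous_symTensor.comp_aestronglyMeasurable (hG.1.prodMk hu.1))
    (ae_of_all _ fun x => by simpa [← NNReal.coe_le_coe] using norm_symTensor_le (G x) (u x)))

theorem tendsto_integral_symTensor [p.HolderConjugate q] {m : Measure (Space n)}
    {G : ℕ → Space n → Space n} {G₀ u : Space n → Space n} (hG : ∀ k, MemLp (G k) q m)
    (hG₀ : MemLp G₀ q m) (hu : MemLp u p m)
    (hlim : Tendsto (fun k => eLpNorm (fun x => G k x - G₀ x) q m) atTop (𝓝 0)) :
    Tendsto (fun k => ∫ x, symTensor (G k x) (u x) ∂m) atTop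
      (𝓝 (∫ x, symTensor (G₀ x) (u x) ∂m)) := by
  refine tendsto_integral_of_L1' _ (integrable_symTensor hG₀ hu).1
    (Eventually.of_forall fun k => integrable_symTensor (hG k) hu) ?_
  refine tendsto_of_tendsto_of_tendsto_of_le_of_le tendsto_const_nhds
    (by simpa using ENNReal.Tendsto.mul_const hlim (Or.inr hu.2.ne)) (fun _ => zero_le)
    fun k => ?_
  rw [← one_mul (eLpNorm (fun x => G k x - G₀ x) q m)]
  refine le_trans (le_of_eq (congrArg (eLpNorm · 1 m) (funext fun x => ?_)))
    (eLpNorm_le_eLpNorm_mul_eLpNorm'_of_norm ((hG k).1.sub hG₀.1) hu.1 symTensor 1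
      (ae_of_all _ fun x => by simpa using norm_symTensor_le (G k x - G₀ x) (u x)))
  exact (symTensor_sub_left _ _ _).symm

variable {u : Space n → Space n} {μ : VectorMeasure (Space n) (Mat n)} {α αt : Space n → ℝ}
  {G : Space n → Space n}

theorem integral_euclideanSpace_apply {X ι : Type*} [MeasurableSpace X] [Fintype ι] {m : Measure X}
    {F : X → EuclideanSpace ℝ ι} (hF : Integrable F m) (i : ι) :
    (∫ x, F x ∂m) i = ∫ x, F x i ∂m :=
  ((EuclideanSpace.proj (𝕜 := ℝ) i).integral_comp_comm hF).symm

theorem HasStrain.integral_eq_symTensor [p.HolderConjugate q] (h : HasStrain Ω u μ)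
    (hu : MemLp u p (volume.restrict Ω)) (φ : 𝓓(Ω, ℝ)) :
    ∫ᵛ x, φ x ∂•μ = -∫ x in Ω, symTensor (∇ φ x) (u x) := by
  ext s
  rw [PiLp.neg_apply, integral_euclideanSpace_apply (integrable_symTensor
    (memLp_gradient φ.contDiff φ.hasCompactSupport q _) hu), h.integral_eq φ s.1 s.2]
  simp only [symTensor, mul_comm, add_comm]

theorem HasStrain.integral_mul_quasicontinuousRep [p.HolderConjugate (n : ℝ≥0∞)] (hn : 2 ≤ n)
    (hb : Bornology.IsBounded (Ω : Set (Space n))) (h : HasStrain Ω u μ)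
    (hu : MemLp u p (volume.restrict Ω)) (hα : IsSobolev Ω n α G)
    (hα_bdd : MemLp α ∞ (volume.restrict Ω)) (hαt : IsQuasicontinuousRep n Ω α αt) (φ : 𝓓(Ω, ℝ)) :
    ∫ᵛ x, φ x * αt x ∂•μ = -∫ x in Ω, symTensor (φ x • G x + α x • ∇ φ x) (u x) := by
  have hn1 : (1 : ℝ≥0∞) ≤ n := by exact_mod_cast (by omega : 1 ≤ n)
  have hn' := ENNReal.natCast_ne_top n
  have : IsFiniteMeasure μ.variation := ⟨h.variation_lt_top⟩
  let ψ (k : ℕ) : 𝓓(Ω, ℝ) := testMul φ (contDiff_smoothing hn1 hα.memLp k)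
  have hψ : Tendsto (fun k => ∫ᵛ x, ψ k x ∂•μ) atTop
      (𝓝 (-∫ x in Ω, symTensor (φ x • G x + α x • ∇ φ x) (u x))) := by
    simp_rw [h.integral_eq_symTensor (q := n) hu]
    exact (tendsto_integral_symTensor
      (fun k => memLp_gradient (ψ k).contDiff (ψ k).hasCompactSupport _ _)
      (hα.isSobolevZero_testFunction_mul hn1 hn' φ).memLp_grad hu
      (hα.tendsto_eLpNorm_gradient_testMul_smoothing_sub hn1 hn' φ)).neg
  obtain ⟨ns, hns, hae⟩ := h.exists_tendsto_smoothing hn hb hu hα hαt φ.hasCompactSupport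
    φ.tsupport_subset
  obtain ⟨M, hM⟩ := exists_norm_smoothing_le hα_bdd
  obtain ⟨C, hC⟩ := φ.continuous.bounded_above_of_compact_support φ.hasCompactSupport
  refine tendsto_nhds_unique ?_ (hψ.comp hns.tendsto_atTop)
  refine VectorMeasure.tendsto_integral_of_dominated_convergence (fun _ => C * M)
    (fun k => (ψ (ns k)).continuous.aestronglyMeasurable) (integrable_const _)
    (fun k => ae_of_all _ fun x => ?_) ?_
  · exact (norm_mul _ _).trans_le (mul_le_mul (hC x) (hM _ x) (norm_nonneg _)
      ((norm_nonneg _).trans (hC x)))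
  · filter_upwards [(ae_restrict_iff' (isClosed_tsupport φ).measurableSet).1 hae] with x hx
    by_cases hxs : x ∈ tsupport φ
    · exact (hx hxs).const_mul _
    · simp [ψ, testMul_apply, image_eq_zero_of_notMem_tsupport hxs]

theorem withDensityᵥ_apply_symm_iff {m : Measure (Space n)} {F : Space n → Mat n}
    (hF : Integrable F m) (i j : Fin n) :
    (∀ s, m.withDensityᵥ F s (i, j) = m.withDensityᵥ F s (j, i)) ↔
      ∀ᵐ x ∂m, F x (i, j) = F x (j, i) := by
  have hFs (s : Set (Space n)) (hs : MeasurableSet s) (t : Fin n × Fin n) :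
      m.withDensityᵥ F s t = ∫ x in s, F x t ∂m := by
    rw [withDensityᵥ_apply hF hs, integral_euclideanSpace_apply hF.integrableOn]
  refine ⟨fun h => ?_, fun h s => ?_⟩
  · refine (integrable_piLp_iff.1 hF _).ae_eq_of_forall_setIntegral_eq _ _
      (integrable_piLp_iff.1 hF _) fun s hs _ => ?_
    rw [← hFs s hs, ← hFs s hs, h]
  · by_cases hs : MeasurableSet s
    · rw [hFs s hs, hFs s hs, integral_congr_ae (ae_restrict_of_ae h)]
    · rw [VectorMeasure.not_measurable _ hs]
      rfl

section ScalarMul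

variable {f : Space n → ℝ} [IsFiniteMeasure μ.variation]

theorem exists_scalarMul_eq_withDensityᵥ (hf : μ.Integrable f) :
    ∃ σ : Space n → Mat n, Integrable σ μ.variation ∧ Integrable (fun x => f x • σ x) μ.variation ∧
      μ.variation.withDensityᵥ σ = μ ∧
      scalarMul f μ = μ.variation.withDensityᵥ fun x => f x • σ x := by
  obtain ⟨σ, -, hσ, hμ⟩ := exists_integrable_withDensityᵥ_variation_eq μ
  have hf' : (μ.variation.withDensityᵥ σ).Integrable f := hμ.symm ▸ hf
  refine ⟨σ, hσ, ?_, hμ, ?_⟩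
  · rw [VectorMeasure.Integrable, Measure.variation_withDensityᵥ hσ] at hf'
    exact integrable_smul_of_integrable_withDensity_enorm hσ.1 hf'
  · rw [← withDensity_withDensityᵥ hσ hf', hμ, scalarMul]

theorem isFiniteMeasure_variation_scalarMul (hf : μ.Integrable f) :
    IsFiniteMeasure (scalarMul f μ).variation := by
  obtain ⟨σ, -, hfσ, -, h⟩ := exists_scalarMul_eq_withDensityᵥ hf
  exact h ▸ isFiniteMeasure_variation_withDensityᵥ hfσ

theorem integral_scalarMul (hf : μ.Integrable f) {φ : Space n → ℝ} (hφ : StronglyMeasurable φ)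
    {C : ℝ} (hC : ∀ x, ‖φ x‖ ≤ C) : ∫ᵛ x, φ x ∂•(scalarMul f μ) = ∫ᵛ x, φ x * f x ∂•μ := by
  obtain ⟨σ, hσ, hfσ, hμ, h⟩ := exists_scalarMul_eq_withDensityᵥ hf
  have := isFiniteMeasure_variation_scalarMul hf
  have hφf : (μ.variation.withDensityᵥ σ).Integrable fun x => φ x * f x := by
    rw [hμ]
    exact Integrable.bdd_mul hf hφ.aestronglyMeasurable (ae_of_all _ hC)
  have hφfσ : (μ.variation.withDensityᵥ fun x => f x • σ x).Integrable φ := by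
    rw [← h]
    exact Integrable.of_bound hφ.aestronglyMeasurable C (ae_of_all _ hC)
  calc ∫ᵛ x, φ x ∂•(scalarMul f μ) = ∫ x, φ x • f x • σ x ∂μ.variation := by
        rw [h, integral_withDensityᵥ hfσ hφfσ]
    _ = ∫ x, (φ x * f x) • σ x ∂μ.variation := by simp_rw [mul_smul]
    _ = ∫ᵛ x, φ x * f x ∂•μ := by rw [← integral_withDensityᵥ hσ hφf, hμ]

theorem scalarMul_apply_symm (hf : μ.Integrable f) (hμ : ∀ s (i j : Fin n), μ s (i, j) = μ s (j, i))
    (s : Set (Space n)) (i j : Fin n) : scalarMul f μ s (i, j) = scalarMul f μ s (j, i) := by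
  obtain ⟨σ, hσ, hfσ, hσμ, h⟩ := exists_scalarMul_eq_withDensityᵥ hf
  have hsymm := (withDensityᵥ_apply_symm_iff hσ i j).1 fun s => by rw [hσμ, hμ]
  rw [h]
  refine (withDensityᵥ_apply_symm_iff hfσ i j).2 ?_ s
  filter_upwards [hsymm] with x hx
  rw [PiLp.smul_apply, PiLp.smul_apply, hx]

end ScalarMul

theorem HasStrain.restrict_scalarMul_add (h : HasStrain Ω u μ) (hαt : μ.Integrable αt)
    {F : Space n → Mat n} (hF : IntegrableOn F Ω) :
    (scalarMul αt μ + lebesgueDensity Ω F).restrict Ω = scalarMul αt μ + lebesgueDensity Ω F := by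
  have hΩ : MeasurableSet (Ω : Set (Space n)) := Ω.isOpen.measurableSet
  rw [VectorMeasure.restrict_add, scalarMul, VectorMeasure.restrict_withDensity hαt, h.restrict_eq]
  congr 1
  ext1 s hs
  rw [VectorMeasure.restrict_apply _ hΩ hs, lebesgueDensity, withDensityᵥ_apply hF (hs.inter hΩ),
    withDensityᵥ_apply hF hs, Measure.restrict_restrict (hs.inter hΩ), Measure.restrict_restrict hs,
    Set.inter_assoc, Set.inter_self]

theorem HasStrain.integral_scalarMul_add [p.HolderConjugate (n : ℝ≥0∞)] (hn : 2 ≤ n)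
    (hb : Bornology.IsBounded (Ω : Set (Space n))) (h : HasStrain Ω u μ)
    (hu : MemLp u p (volume.restrict Ω)) (hα : IsSobolev Ω n α G)
    (hα_bdd : MemLp α ∞ (volume.restrict Ω)) (hαt : IsQuasicontinuousRep n Ω α αt)
    (hαti : μ.Integrable αt) (φ : 𝓓(Ω, ℝ)) :
    ∫ᵛ x, φ x ∂•(scalarMul αt μ + lebesgueDensity Ω fun x => symTensor (G x) (u x)) =
      -∫ x in Ω, symTensor (∇ φ x) (α x • u x) := by
  have : IsFiniteMeasure μ.variation := ⟨h.variation_lt_top⟩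
  have hGu := integrable_symTensor hα.memLp_grad hu
  have hfin := isFiniteMeasure_variation_scalarMul hαti
  have hfin' : IsFiniteMeasure (lebesgueDensity Ω fun x => symTensor (G x) (u x)).variation :=
    isFiniteMeasure_variation_withDensityᵥ hGu
  obtain ⟨C, hC⟩ := φ.continuous.bounded_above_of_compact_support φ.hasCompactSupport
  have hφ {ν : VectorMeasure (Space n) (Mat n)} [IsFiniteMeasure ν.variation] : ν.Integrable φ :=
    Integrable.of_bound φ.continuous.aestronglyMeasurable C (ae_of_all _ hC)
  have hφG : MemLp (fun x => φ x • G x) n (volume.restrict Ω) :=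
    hα.memLp_grad.smul (φ.continuous.memLp_top_of_hasCompactSupport φ.hasCompactSupport _)
  have hαφ : MemLp (fun x => α x • ∇ φ x) n (volume.restrict Ω) :=
    (memLp_gradient φ.contDiff φ.hasCompactSupport ∞ _).smul hα.memLp
  calc ∫ᵛ x, φ x ∂•(scalarMul αt μ + lebesgueDensity Ω fun x => symTensor (G x) (u x))
      = ∫ᵛ x, φ x * αt x ∂•μ + ∫ x in Ω, φ x • symTensor (G x) (u x) := by
        rw [VectorMeasure.integral_add_vectorMeasure hφ hφ,
          integral_scalarMul hαti φ.continuous.stronglyMeasurable hC]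
        exact congrArg _ (integral_withDensityᵥ hGu (@hφ _ hfin'))
    _ = -∫ x in Ω, symTensor (α x • ∇ φ x) (u x) := by
        rw [h.integral_mul_quasicontinuousRep hn hb hu hα hα_bdd hαt]
        simp_rw [symTensor_add_left, ← symTensor_smul_left]
        rw [integral_add (integrable_symTensor hφG hu) (integrable_symTensor hαφ hu)]
        abel
    _ = -∫ x in Ω, symTensor (∇ φ x) (α x • u x) := by simp_rw [symTensor_smul_right]

theorem HasStrain.integrable_quasicontinuousRep [p.HolderConjugate (n : ℝ≥0∞)] (hn : 2 ≤ n)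
    (hb : Bornology.IsBounded (Ω : Set (Space n))) (h : HasStrain Ω u μ)
    (hu : MemLp u p (volume.restrict Ω)) (hα : IsSobolev Ω n α G)
    (hα_bdd : MemLp α ∞ (volume.restrict Ω)) (hαt : IsQuasicontinuousRep n Ω α αt) :
    μ.Integrable αt := by
  have : IsFiniteMeasure μ.variation := ⟨h.variation_lt_top⟩
  obtain ⟨M, hM⟩ := exists_norm_smoothing_le hα_bdd
  obtain ⟨hmeas, hbound⟩ := h.aestronglyMeasurable_quasicontinuousRep hn hb hu hα hαt hM
  exact Integrable.of_bound hmeas M hbound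

theorem HasStrain.smul [p.HolderConjugate (n : ℝ≥0∞)] (hn : 2 ≤ n)
    (hb : Bornology.IsBounded (Ω : Set (Space n))) (h : HasStrain Ω u μ)
    (hu : MemLp u p (volume.restrict Ω)) (hα : IsSobolev Ω n α G)
    (hα_bdd : MemLp α ∞ (volume.restrict Ω)) (hαt : IsQuasicontinuousRep n Ω α αt) :
    HasStrain Ω (fun x => α x • u x)
      (scalarMul αt μ + lebesgueDensity Ω fun x => symTensor (G x) (u x)) := by
  have : IsFiniteMeasure μ.variation := ⟨h.variation_lt_top⟩
  have hαti := h.integrable_quasicontinuousRep hn hb hu hα hα_bdd hαt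
  have hGu := integrable_symTensor hα.memLp_grad hu
  have hfin := isFiniteMeasure_variation_scalarMul hαti
  have hfin' : IsFiniteMeasure (lebesgueDensity Ω fun x => symTensor (G x) (u x)).variation :=
    isFiniteMeasure_variation_withDensityᵥ hGu
  refine ⟨h.restrict_scalarMul_add hαti hGu, ?_, fun s i j => ?_, fun φ i j => ?_⟩
  · exact (VectorMeasure.variation_add_le Set.univ).trans_lt
      (ENNReal.add_lt_top.2 ⟨measure_lt_top _ _, measure_lt_top _ _⟩)
  · rw [add_apply, PiLp.add_apply, PiLp.add_apply,
      scalarMul_apply_symm hαti h.isSymm s i j]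
    congr 1
    exact (withDensityᵥ_apply_symm_iff hGu i j).2
      (ae_of_all _ fun x => by simp only [symTensor, add_comm]) s
  · have hαu : MemLp (fun x => α x • u x) p (volume.restrict Ω) := hu.smul hα_bdd
    rw [h.integral_scalarMul_add hn hb hu hα hα_bdd hαt hαti, PiLp.neg_apply,
      integral_euclideanSpace_apply (integrable_symTensor
        (memLp_gradient φ.contDiff φ.hasCompactSupport (n : ℝ≥0∞) _) hαu)]
    simp only [symTensor, mul_comm, add_comm]

end ProductRule

/-! ### Existence of quasicontinuous representatives -/

section Existence

variable {n : ℕ} {Ω : Opens (Space n)} {q : ℝ≥0∞}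

theorem exists_tendsto_eLpNorm_sum_sub {X E : Type*} [MeasurableSpace X] [NormedAddCommGroup E]
    [CompleteSpace E] {μ : Measure X} (hq : 1 ≤ q) {F : ℕ → X → E} (hF : ∀ j, MemLp (F j) q μ)
    (hsum : ∑' j, eLpNorm (F j) q μ ≠ ∞) :
    ∃ f : X → E, MemLp f q μ ∧
      Tendsto (fun k => eLpNorm (fun x => ∑ j ∈ Finset.range k, F j x - f x) q μ) atTop (𝓝 0) ∧
      eLpNorm f q μ ≤ ∑' j, eLpNorm (F j) q μ := by
  have : Fact (1 ≤ q) := ⟨hq⟩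
  have hnorm : Summable fun j => ‖(hF j).toLp (F j)‖ := by
    simpa only [Lp.norm_toLp] using ENNReal.summable_toReal hsum
  refine ⟨_, Lp.memLp (∑' j, (hF j).toLp (F j)), ?_, ?_⟩
  · have h := (Lp.tendsto_Lp_iff_tendsto_eLpNorm' _ _).1 hnorm.of_norm.hasSum.tendsto_sum_nat
    refine h.congr fun k => eLpNorm_congr_ae ?_
    have hpart := Lp.coeFn_finsetSum (Finset.range k) fun j => (hF j).toLp (F j)
    filter_upwards [hpart, ae_all_iff.2 fun j => (hF j).coeFn_toLp] with x hx hFx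
    rw [Pi.sub_apply, hx, Finset.sum_apply]
    simp only [hFx]
  · rw [← Lp.enorm_def]
    exact enorm_tsum_le_tsum_enorm.trans_eq (tsum_congr fun j => Lp.enorm_toLp _)

theorem gradient_sum {ι : Type*} (s : Finset ι) (θ : ι → 𝓓(Ω, ℝ)) (x : Space n) :
    ∇ (∑ j ∈ s, θ j : 𝓓(Ω, ℝ)) x = ∑ j ∈ s, ∇ (θ j) x := by
  rw [FunLike.coe_sum, gradient, fderiv_sum fun j _ => (θ j).contDiff.differentiable (by simp) x,
    map_sum]
  rfl

theorem exists_isSobolevZero_ge (hq : 1 ≤ q) {θ : ℕ → 𝓓(Ω, ℝ)} (h0 : ∀ j x, 0 ≤ θ j x)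
    (hθ : ∑' j, eLpNorm (θ j) q (volume.restrict Ω) ≠ ∞)
    (hθ' : ∑' j, eLpNorm (∇ (θ j)) q (volume.restrict Ω) ≠ ∞) :
    ∃ (v : Space n → ℝ) (g : Space n → Space n), IsSobolevZero Ω q v g ∧
      (∀ᵐ x ∂(volume.restrict Ω), ∀ j, θ j x ≤ v x) ∧
      eLpNorm v q (volume.restrict Ω) ≤ ∑' j, eLpNorm (θ j) q (volume.restrict Ω) ∧
      eLpNorm g q (volume.restrict Ω) ≤ ∑' j, eLpNorm (∇ (θ j)) q (volume.restrict Ω) := by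
  have hsob (j) := isSobolevZero_testFunction (q := q) (θ j)
  obtain ⟨v, hv, hvlim, hvn⟩ := exists_tendsto_eLpNorm_sum_sub hq (fun j => (hsob j).memLp) hθ
  obtain ⟨g, hg, hglim, hgn⟩ := exists_tendsto_eLpNorm_sum_sub hq (fun j => (hsob j).memLp_grad) hθ'
  have hsum (k x) : (∑ j ∈ Finset.range k, θ j : 𝓓(Ω, ℝ)) x = ∑ j ∈ Finset.range k, θ j x := by
    rw [FunLike.coe_sum, Finset.sum_apply]
  refine ⟨v, g, isSobolevZero_of_tendsto hq (φ := fun k => ∑ j ∈ Finset.range k, θ j) hv hg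
    (by simpa only [hsum] using hvlim) (by simpa only [gradient_sum] using hglim), ?_, hvn, hgn⟩
  have hmeas (k) : AEStronglyMeasurable (fun x => ∑ j ∈ Finset.range k, θ j x)
      (volume.restrict Ω) :=
    (continuous_finsetSum _ fun j _ => (θ j).continuous).aestronglyMeasurable
  obtain ⟨ns, hns, hae⟩ := (tendstoInMeasure_of_tendsto_eLpNorm (zero_lt_one.trans_le hq).ne'
    hmeas hv.1 hvlim).exists_seq_tendsto_ae
  filter_upwards [hae] with x hx j
  refine ge_of_tendsto hx ?_
  filter_upwards [hns.tendsto_atTop.eventually_gt_atTop j] with k hk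
  exact Finset.single_le_sum (f := fun j => θ j x) (fun j _ => h0 j x) (Finset.mem_range.2 hk)

/-- The test function `2 softSq (c ψ)`, a smooth substitute for the truncation of `|c ψ|` at
height `1`: it is at least `1` where `1 ≤ |c ψ|`. -/
def softTest (c : ℝ) (ψ : 𝓓(Ω, ℝ)) : 𝓓(Ω, ℝ) :=
  ⟨fun x => 2 * softSq (c * ψ x),
    contDiff_const.mul (contDiff_softSq.comp (contDiff_const.mul ψ.contDiff)),
    ψ.hasCompactSupport.comp_left (g := fun t => 2 * softSq (c * t)) (by simp [softSq_zero]),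
    (closure_mono (Function.support_comp_subset (g := fun t => 2 * softSq (c * t))
      (by simp [softSq_zero]) ψ)).trans ψ.tsupport_subset⟩

theorem softTest_apply (c : ℝ) (ψ : 𝓓(Ω, ℝ)) (x : Space n) :
    softTest c ψ x = 2 * softSq (c * ψ x) := rfl

theorem softTest_nonneg (c : ℝ) (ψ : 𝓓(Ω, ℝ)) (x : Space n) : 0 ≤ softTest c ψ x :=
  mul_nonneg zero_le_two (softSq_nonneg _)

theorem one_le_softTest {c : ℝ} {ψ : 𝓓(Ω, ℝ)} {x : Space n} (h : 1 ≤ |c * ψ x|) :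
    1 ≤ softTest c ψ x := by
  rw [softTest_apply]
  linarith [half_le_softSq h]

theorem gradient_softTest (c : ℝ) (ψ : 𝓓(Ω, ℝ)) (x : Space n) :
    ∇ (softTest c ψ) x = (2 * softSqDeriv (c * ψ x) * c) • ∇ ψ x := by
  have hψ : DifferentiableAt ℝ ψ x := ψ.contDiff.differentiable (by simp) x
  have hsoft : DifferentiableAt ℝ (fun y => softSq (c * ψ y)) x :=
    (hasDerivAt_softSq _).differentiableAt.comp x (hψ.const_mul c)
  change ∇ (fun y => 2 * softSq (c * ψ y)) x = _
  rw [gradient_const_mul hsoft, gradient_softSq_comp (hψ.const_mul c), gradient_const_mul hψ,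
    smul_smul, smul_smul, mul_assoc]

theorem enorm_two : ‖(2 : ℝ)‖ₑ = 2 := by
  rw [Real.enorm_of_nonneg zero_le_two, ENNReal.ofReal_ofNat]

theorem eLpNorm_softTest_le (c : ℝ) (ψ : 𝓓(Ω, ℝ)) (μ : Measure (Space n)) :
    eLpNorm (softTest c ψ) q μ ≤ 2 * (‖c‖ₑ * eLpNorm ψ q μ) := by
  refine (eLpNorm_mono (g := (2 * c) • (ψ : Space n → ℝ)) fun x => ?_).trans_eq
    (by rw [eLpNorm_const_smul, enorm_mul, mul_assoc, enorm_two])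
  rw [Real.norm_of_nonneg (softTest_nonneg c ψ x), softTest_apply, Pi.smul_apply, smul_eq_mul,
    mul_assoc, norm_mul, Real.norm_two]
  gcongr
  exact softSq_le_abs _

theorem eLpNorm_gradient_softTest_le (c : ℝ) (ψ : 𝓓(Ω, ℝ)) (μ : Measure (Space n)) :
    eLpNorm (∇ (softTest c ψ)) q μ ≤ 2 * (‖c‖ₑ * eLpNorm (∇ ψ) q μ) := by
  refine (eLpNorm_mono (g := (2 * c) • ∇ ψ) fun x => ?_).trans_eq
    (by rw [eLpNorm_const_smul, enorm_mul, mul_assoc, enorm_two])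
  rw [gradient_softTest, Pi.smul_apply, norm_smul, norm_smul, norm_mul, norm_mul, norm_mul]
  gcongr
  exact mul_le_of_le_one_right (norm_nonneg _) (abs_softSqDeriv_le _)

theorem exists_isSobolevZero_one_le (hq : 1 ≤ q) {ψ : ℕ → 𝓓(Ω, ℝ)} {c : ℕ → ℝ}
    {s : ℝ≥0∞} (hs : s ≠ ∞)
    (hψ : ∑' j, 2 * (‖c j‖ₑ * eLpNorm (ψ j) q (volume.restrict Ω)) ≤ s)
    (hψ' : ∑' j, 2 * (‖c j‖ₑ * eLpNorm (∇ (ψ j)) q (volume.restrict Ω)) ≤ s) :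
    ∃ (v : Space n → ℝ) (g : Space n → Space n), IsSobolevZero Ω q v g ∧
      (∀ᵐ x ∂(volume.restrict Ω), x ∈ ⋃ j, {x | 1 < |c j * ψ j x|} → 1 ≤ v x) ∧
      eLpNorm v q (volume.restrict Ω) ≤ s ∧ eLpNorm g q (volume.restrict Ω) ≤ s := by
  have hθ := (ENNReal.tsum_le_tsum fun j =>
    eLpNorm_softTest_le (q := q) (c j) (ψ j) (volume.restrict Ω)).trans hψ
  have hθ' := (ENNReal.tsum_le_tsum fun j =>
    eLpNorm_gradient_softTest_le (q := q) (c j) (ψ j) (volume.restrict Ω)).trans hψ'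
  obtain ⟨v, g, hvg, hv, hvn, hgn⟩ := exists_isSobolevZero_ge hq
    (fun j => softTest_nonneg (c j) (ψ j)) (ne_top_of_le_ne_top hs hθ)
    (ne_top_of_le_ne_top hs hθ')
  refine ⟨v, g, hvg, ?_, hvn.trans hθ, hgn.trans hθ'⟩
  filter_upwards [hv] with x hx hxA
  obtain ⟨j, hj⟩ := Set.mem_iUnion.1 hxA
  exact (one_le_softTest hj.le).trans (hx j)

theorem capacity_le (hq : 1 ≤ q) (hq' : q ≠ ∞) {v : Space n → ℝ} {g : Space n → Space n}
    (hv : IsSobolevZero Ω q v g) {A : Set (Space n)} (hA : IsOpen A) (hAΩ : A ⊆ Ω)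
    (hvA : ∀ᵐ x ∂(volume.restrict A), 1 ≤ v x) :
    capacity q A Ω ≤ eLpNorm g q (volume.restrict Ω) ^ q.toReal := by
  have hq0 : q ≠ 0 := (zero_lt_one.trans_le hq).ne'
  rw [eLpNorm_eq_lintegral_rpow_enorm_toReal hq0 hq', ← ENNReal.rpow_mul,
    one_div_mul_cancel (ENNReal.toReal_pos hq0 hq').ne', ENNReal.rpow_one]
  exact iInf₂_le_of_le v g (iInf₂_le_of_le hv ⟨A, hA, subset_rfl, hAΩ, hvA⟩ le_rfl)

/-- The set where one of the `|ψ j|` with `j ≥ N` exceeds `2⁻ʲ`; off this set the series `∑ ψ j`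
converges uniformly. -/
def exceptionalSet (ψ : ℕ → 𝓓(Ω, ℝ)) (N : ℕ) : Set (Space n) :=
  ⋃ j, {x | 1 < |2 ^ (N + j) * ψ (N + j) x|}

theorem isOpen_exceptionalSet (ψ : ℕ → 𝓓(Ω, ℝ)) (N : ℕ) : IsOpen (exceptionalSet ψ N) :=
  isOpen_iUnion fun j =>
    isOpen_lt continuous_const (continuous_const.mul (ψ (N + j)).continuous).abs

theorem exceptionalSet_subset (ψ : ℕ → 𝓓(Ω, ℝ)) (N : ℕ) : exceptionalSet ψ N ⊆ Ω := by
  refine Set.iUnion_subset fun j x hx => ?_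
  by_contra hxΩ
  rw [Set.mem_ofPred_eq, testFunction_eq_zero _ hxΩ, mul_zero, abs_zero] at hx
  exact not_lt.2 zero_le_one hx

theorem abs_le_of_notMem_exceptionalSet {ψ : ℕ → 𝓓(Ω, ℝ)} {N j : ℕ} (hj : N ≤ j) {x : Space n}
    (hx : x ∉ exceptionalSet ψ N) : |ψ j x| ≤ 2⁻¹ ^ j := by
  obtain ⟨i, rfl⟩ := Nat.exists_eq_add_of_le hj
  have h : ¬ 1 < |2 ^ (N + i) * ψ (N + i) x| := fun h => hx (Set.mem_iUnion.2 ⟨i, h⟩)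
  rw [not_lt, abs_mul, abs_of_pos (by positivity)] at h
  rwa [inv_pow, ← one_div, le_div_iff₀' (by positivity)]

theorem tsum_two_mul_two_pow_mul_le {s : ℕ → ℝ≥0∞} (hs : ∀ j, s j ≤ 2⁻¹ ^ (2 * j + 1)) (N : ℕ) :
    ∑' j, 2 * (‖(2 : ℝ) ^ (N + j)‖ₑ * s (N + j)) ≤ 2 * 2⁻¹ ^ N := by
  have hterm (j : ℕ) : 2 * (‖(2 : ℝ) ^ j‖ₑ * 2⁻¹ ^ (2 * j + 1)) = (2⁻¹ : ℝ≥0∞) ^ j := by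
    have h2 : (2 : ℝ≥0∞) ^ j * 2⁻¹ ^ j = 1 := by
      rw [← mul_pow, ENNReal.mul_inv_cancel (by simp) (by simp), one_pow]
    calc 2 * (‖(2 : ℝ) ^ j‖ₑ * 2⁻¹ ^ (2 * j + 1))
        = (2 * 2⁻¹) * (2 ^ j * 2⁻¹ ^ j) * (2⁻¹ : ℝ≥0∞) ^ j := by
          rw [enorm_pow, enorm_two]
          ring
      _ = 2⁻¹ ^ j := by rw [ENNReal.mul_inv_cancel (by simp) (by simp), h2, one_mul, one_mul]
  calc ∑' j, 2 * (‖(2 : ℝ) ^ (N + j)‖ₑ * s (N + j)) ≤ ∑' j, (2⁻¹ : ℝ≥0∞) ^ (N + j) :=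
        ENNReal.tsum_le_tsum fun j => by
          rw [← hterm]
          gcongr
          exact hs _
    _ = 2 * 2⁻¹ ^ N := by
        simp_rw [pow_add]
        rw [ENNReal.tsum_mul_left, ENNReal.tsum_geometric, ENNReal.one_sub_inv_two, inv_inv,
          mul_comm]

theorem exists_isSobolevZero_exceptionalSet (hq : 1 ≤ q) {ψ : ℕ → 𝓓(Ω, ℝ)}
    (hψ : ∀ j, eLpNorm (ψ j) q (volume.restrict Ω) ≤ 2⁻¹ ^ (2 * j + 1))
    (hψ' : ∀ j, eLpNorm (∇ (ψ j)) q (volume.restrict Ω) ≤ 2⁻¹ ^ (2 * j + 1)) (N : ℕ) :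
    ∃ (v : Space n → ℝ) (g : Space n → Space n), IsSobolevZero Ω q v g ∧
      (∀ᵐ x ∂(volume.restrict (exceptionalSet ψ N)), 1 ≤ v x) ∧
      eLpNorm v q (volume.restrict Ω) ≤ 2 * 2⁻¹ ^ N ∧
      eLpNorm g q (volume.restrict Ω) ≤ 2 * 2⁻¹ ^ N := by
  obtain ⟨v, g, hvg, hv, hvn, hgn⟩ := exists_isSobolevZero_one_le hq
    (ENNReal.mul_ne_top (by simp) (by simp)) (tsum_two_mul_two_pow_mul_le hψ N)
    (tsum_two_mul_two_pow_mul_le hψ' N)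
  refine ⟨v, g, hvg, ?_, hvn, hgn⟩
  filter_upwards [ae_restrict_of_ae_restrict_of_subset (exceptionalSet_subset ψ N) hv,
    ae_restrict_mem (isOpen_exceptionalSet ψ N).measurableSet] with x hx hxA using hx hxA

theorem tendsto_two_mul_two_inv_pow_rpow (hq : 1 ≤ q) (hq' : q ≠ ∞) :
    Tendsto (fun N : ℕ => (2 * (2⁻¹ : ℝ≥0∞) ^ N) ^ q.toReal) atTop (𝓝 0) := by
  have hpos : 0 < q.toReal := ENNReal.toReal_pos (zero_lt_one.trans_le hq).ne' hq'
  have h : Tendsto (fun N : ℕ => 2 * (2⁻¹ : ℝ≥0∞) ^ N) atTop (𝓝 0) := by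
    simpa using ENNReal.Tendsto.const_mul (a := 2)
      (ENNReal.tendsto_pow_atTop_nhds_zero_of_lt_one (r := 2⁻¹) (by simp)) (Or.inr (by simp))
  simpa [hpos] using h.ennrpow_const q.toReal

theorem tendsto_capacity_exceptionalSet (hq : 1 ≤ q) (hq' : q ≠ ∞) {ψ : ℕ → 𝓓(Ω, ℝ)}
    (hψ : ∀ j, eLpNorm (ψ j) q (volume.restrict Ω) ≤ 2⁻¹ ^ (2 * j + 1))
    (hψ' : ∀ j, eLpNorm (∇ (ψ j)) q (volume.restrict Ω) ≤ 2⁻¹ ^ (2 * j + 1)) :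
    Tendsto (fun N => capacity q (exceptionalSet ψ N) Ω) atTop (𝓝 0) := by
  refine tendsto_of_tendsto_of_tendsto_of_le_of_le tendsto_const_nhds
    (tendsto_two_mul_two_inv_pow_rpow hq hq') (fun _ => zero_le) fun N => ?_
  obtain ⟨v, g, hvg, hv, -, hgn⟩ := exists_isSobolevZero_exceptionalSet hq hψ hψ' N
  exact (capacity_le hq hq' hvg (isOpen_exceptionalSet ψ N) (exceptionalSet_subset ψ N) hv).trans
    (by gcongr)

theorem tendsto_volume_exceptionalSet (hq : 1 ≤ q) (hq' : q ≠ ∞) {ψ : ℕ → 𝓓(Ω, ℝ)}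
    (hψ : ∀ j, eLpNorm (ψ j) q (volume.restrict Ω) ≤ 2⁻¹ ^ (2 * j + 1))
    (hψ' : ∀ j, eLpNorm (∇ (ψ j)) q (volume.restrict Ω) ≤ 2⁻¹ ^ (2 * j + 1)) :
    Tendsto (fun N => volume (exceptionalSet ψ N)) atTop (𝓝 0) := by
  refine tendsto_of_tendsto_of_tendsto_of_le_of_le tendsto_const_nhds
    (tendsto_two_mul_two_inv_pow_rpow hq hq') (fun _ => zero_le) fun N => ?_
  obtain ⟨v, g, hvg, hv, hvn, -⟩ := exists_isSobolevZero_exceptionalSet hq hψ hψ' N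
  have hle : volume.restrict (exceptionalSet ψ N) ≤ volume.restrict Ω :=
    Measure.restrict_mono_set _ (exceptionalSet_subset ψ N)
  calc volume (exceptionalSet ψ N)
      = volume.restrict (exceptionalSet ψ N) Set.univ := by rw [Measure.restrict_apply_univ]
    _ ≤ volume.restrict (exceptionalSet ψ N) {x | 1 ≤ ‖v x‖ₑ} := by
        refine measure_mono_ae ?_
        filter_upwards [hv] with x hx _
        change 1 ≤ ‖v x‖ₑ
        rw [Real.enorm_eq_ofReal_abs, ENNReal.one_le_ofReal]
        exact hx.trans (le_abs_self _)
    _ ≤ eLpNorm v q (volume.restrict (exceptionalSet ψ N)) ^ q.toReal := by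
        simpa using mul_meas_ge_le_pow_eLpNorm' (volume.restrict (exceptionalSet ψ N))
          (zero_lt_one.trans_le hq).ne' hq' (hvg.memLp.1.mono_measure hle) 1
    _ ≤ (2 * 2⁻¹ ^ N) ^ q.toReal := by
        gcongr
        exact (eLpNorm_mono_measure v hle).trans hvn

theorem tendsto_limUnder_of_dist_le {a : ℕ → ℝ} {N : ℕ}
    (ha : ∀ j, N ≤ j → dist (a j) (a (j + 1)) ≤ 2⁻¹ ^ j) :
    Tendsto a atTop (𝓝 (limUnder atTop a)) ∧
      ∀ j, N ≤ j → dist (a j) (limUnder atTop a) ≤ 2 * 2⁻¹ ^ j := by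
  have hstep (j : ℕ) (hj : N ≤ j) (k : ℕ) :
      dist (a (j + k)) (a (j + k + 1)) ≤ 2⁻¹ ^ j * 2⁻¹ ^ k := by
    rw [← pow_add]
    exact ha _ (by omega)
  have hcauchy : CauchySeq a := (cauchySeq_shift N).1 (by
    simpa only [add_comm] using
      cauchySeq_of_le_geometric 2⁻¹ (2⁻¹ ^ N) (by norm_num) (hstep N le_rfl))
  refine ⟨hcauchy.tendsto_limUnder, fun j hj => ?_⟩
  have h := dist_le_of_le_geometric_of_tendsto₀ 2⁻¹ (2⁻¹ ^ j) (by norm_num) (hstep j hj)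
    ((tendsto_add_atTop_iff_nat j).2 hcauchy.tendsto_limUnder |>.congr fun k => by rw [add_comm])
  norm_num at h ⊢
  linarith

theorem continuousOn_limUnder_of_dist_le {X : Type*} [TopologicalSpace X] {K : ℕ → Set X}
    (hK : ∀ m, K m ⊆ interior (K (m + 1))) {a : ℕ → X → ℝ} (hcont : ∀ j, Continuous (a j))
    {A : Set X} {N : ℕ}
    (ha : ∀ j, N ≤ j → ∀ x ∈ K j \ A, dist (a j x) (a (j + 1) x) ≤ 2⁻¹ ^ j) :
    (∀ x ∈ (⋃ m, K m) \ A, Tendsto (fun j => a j x) atTop (𝓝 (limUnder atTop fun j => a j x))) ∧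
      ContinuousOn (fun x => limUnder atTop fun j => a j x) ((⋃ m, K m) \ A) := by
  have hmono : Monotone K := monotone_nat_of_le_succ fun m => (hK m).trans interior_subset
  have hlim (m : ℕ) (x) (hx : x ∈ K m \ A) := tendsto_limUnder_of_dist_le (N := max m N)
    (a := fun j => a j x) fun j hj => ha j (by omega) x ⟨hmono (by omega : m ≤ j) hx.1, hx.2⟩
  refine ⟨fun x ⟨hx, hxA⟩ => ?_, TendstoLocallyUniformlyOn.continuousOn (F := a) (p := atTop) ?_
    (Frequently.of_forall fun j => (hcont j).continuousOn)⟩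
  · obtain ⟨m, hm⟩ := Set.mem_iUnion.1 hx
    exact (hlim m x ⟨hm, hxA⟩).1
  rw [Metric.tendstoLocallyUniformlyOn_iff]
  intro r hr x ⟨hx, _⟩
  obtain ⟨m, hm⟩ := Set.mem_iUnion.1 hx
  refine ⟨K (m + 1) \ A, ?_, ?_⟩
  · filter_upwards [mem_nhdsWithin_of_mem_nhds (mem_interior_iff_mem_nhds.1 (hK m hm)),
      self_mem_nhdsWithin] with y hyK hy using ⟨hyK, hy.2⟩
  · have h0 : Tendsto (fun j : ℕ => (2 : ℝ) * 2⁻¹ ^ j) atTop (𝓝 0) := by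
      simpa using (tendsto_pow_atTop_nhds_zero_of_lt_one (r := (2⁻¹ : ℝ)) (by norm_num)
        (by norm_num)).const_mul 2
    filter_upwards [h0.eventually_lt_const hr, eventually_ge_atTop (max (m + 1) N)]
      with j hj hmj y hy
    rw [dist_comm]
    exact ((hlim _ y hy).2 j hmj).trans_lt hj

theorem eLpNorm_sub_le_of_le_half {X E : Type*} [MeasurableSpace X] [NormedAddCommGroup E]
    {μ : Measure X} (hq : 1 ≤ q) {f g h : X → E} (hf : AEStronglyMeasurable f μ)
    (hg : AEStronglyMeasurable g μ) (hh : AEStronglyMeasurable h μ) {δ : ℝ≥0∞}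
    (hfh : eLpNorm (fun x => f x - h x) q μ ≤ δ / 2)
    (hgh : eLpNorm (fun x => g x - h x) q μ ≤ δ / 2) :
    eLpNorm (fun x => f x - g x) q μ ≤ δ :=
  calc eLpNorm (fun x => f x - g x) q μ
      = eLpNorm ((fun x => f x - h x) - fun x => g x - h x) q μ := by
        congr with x
        exact (sub_sub_sub_cancel_right _ _ _).symm
    _ ≤ δ / 2 + δ / 2 :=
        (eLpNorm_sub_le (hf.sub hh) (hg.sub hh) hq).trans (add_le_add hfh hgh)
    _ = δ := ENNReal.add_halves δ

theorem IsSobolev.exists_forall_testFunction_eq_smoothing_sub (hq : 1 ≤ q) (hq' : q ≠ ∞)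
    {α : Space n → ℝ} {G : Space n → Space n} (hα : IsSobolev Ω q α G) {K : Set (Space n)}
    (hK : IsCompact K) (hKΩ : K ⊆ Ω) {δ : ℝ≥0∞} (hδ : δ ≠ 0) :
    ∃ m, ∀ k ≥ m, ∀ l ≥ m, ∃ ψ : 𝓓(Ω, ℝ),
      (∀ x ∈ K, ψ x = smoothing Ω α k x - smoothing Ω α l x) ∧
      eLpNorm ψ q (volume.restrict Ω) ≤ δ ∧ eLpNorm (∇ ψ) q (volume.restrict Ω) ≤ δ := by
  obtain ⟨χ, hχ, -⟩ := exists_testFunction_eventually_eq_one hK hKΩ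
  have hδ2 : 0 < δ / 2 := ENNReal.half_pos hδ
  have hprod := hα.isSobolevZero_testFunction_mul hq hq' χ
  let φ (k : ℕ) : 𝓓(Ω, ℝ) := testMul χ (contDiff_smoothing hq hα.memLp k)
  have hφ (k : ℕ) := isSobolevZero_testFunction (q := q) (φ k)
  obtain ⟨m, hm⟩ := eventually_atTop.1
    (((tendsto_eLpNorm_testMul_smoothing_sub hq hq' hα.memLp χ).eventually_le_const hδ2).and
      ((hα.tendsto_eLpNorm_gradient_testMul_smoothing_sub hq hq' χ).eventually_le_const hδ2))
  refine ⟨m, fun k hk l hl => ⟨φ k - φ l, fun x hx => ?_, ?_, ?_⟩⟩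
  · change χ x * smoothing Ω α k x - χ x * smoothing Ω α l x = _
    rw [hχ.self_of_nhdsSet x hx, one_mul, one_mul]
  · exact eLpNorm_sub_le_of_le_half hq (hφ k).memLp.1 (hφ l).memLp.1 hprod.memLp.1
      (hm k hk).1 (hm l hl).1
  · refine (eLpNorm_congr_ae (ae_of_all _ (gradient_testFunction_sub (φ k) (φ l)))).trans_le ?_
    exact eLpNorm_sub_le_of_le_half hq (hφ k).memLp_grad.1 (hφ l).memLp_grad.1 hprod.memLp_grad.1
      (hm k hk).2 (hm l hl).2

theorem IsSobolev.exists_strictMono_testFunction_eq_smoothing_sub (hq : 1 ≤ q) (hq' : q ≠ ∞)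
    {α : Space n → ℝ} {G : Space n → Space n} (hα : IsSobolev Ω q α G) {K : ℕ → Set (Space n)}
    (hK : ∀ j, IsCompact (K j)) (hKΩ : ∀ j, K j ⊆ Ω) {δ : ℕ → ℝ≥0∞} (hδ : ∀ j, δ j ≠ 0) :
    ∃ ns : ℕ → ℕ, StrictMono ns ∧ ∃ ψ : ℕ → 𝓓(Ω, ℝ),
      (∀ j, ∀ x ∈ K j, ψ j x = smoothing Ω α (ns j) x - smoothing Ω α (ns (j + 1)) x) ∧
      (∀ j, eLpNorm (ψ j) q (volume.restrict Ω) ≤ δ j) ∧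
      ∀ j, eLpNorm (∇ (ψ j)) q (volume.restrict Ω) ≤ δ j := by
  choose m hm using fun j =>
    hα.exists_forall_testFunction_eq_smoothing_sub hq hq' (hK j) (hKΩ j) (hδ j)
  obtain ⟨ns, hns, hmns⟩ := extraction_forall_of_eventually' fun j => ⟨m j, fun _ hk => hk⟩
  choose ψ hψK hψ hψ' using fun j =>
    hm j (ns j) (hmns j) (ns (j + 1)) ((hmns j).trans (hns.monotone j.le_succ))
  exact ⟨ns, hns, ψ, hψK, hψ, hψ'⟩

theorem ae_eq_of_tendsto_eLpNorm {X E : Type*} [MeasurableSpace X] [NormedAddCommGroup E]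
    {μ : Measure X} (hq : q ≠ 0) {f : ℕ → X → E} {g h : X → E}
    (hf : ∀ j, AEStronglyMeasurable (f j) μ) (hg : AEStronglyMeasurable g μ)
    (hfg : Tendsto (fun j => eLpNorm (fun x => f j x - g x) q μ) atTop (𝓝 0))
    (hfh : ∀ᵐ x ∂μ, Tendsto (fun j => f j x) atTop (𝓝 (h x))) : h =ᵐ[μ] g := by
  obtain ⟨ns, hns, hae⟩ :=
    (tendstoInMeasure_of_tendsto_eLpNorm hq hf hg hfg).exists_seq_tendsto_ae
  filter_upwards [hfh, hae] with x hx hx'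
  exact tendsto_nhds_unique (hx.comp hns.tendsto_atTop) hx'

/-- A fast subsequence of the mollifications of `α` converges locally uniformly off sets of small
capacity. -/
theorem IsSobolev.exists_isQuasicontinuousRep (hq : 1 ≤ q) (hq' : q ≠ ∞) {α : Space n → ℝ}
    {G : Space n → Space n} (hα : IsSobolev Ω q α G) :
    ∃ αt, IsQuasicontinuousRep q Ω α αt := by
  obtain ⟨K, hK, hKint, hKΩ⟩ := exists_compact_exhaustion Ω
  obtain ⟨ns, hns, ψ, hψK, hψ, hψ'⟩ :=
    hα.exists_strictMono_testFunction_eq_smoothing_sub hq hq' hK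
      (fun j => hKΩ ▸ Set.subset_iUnion K j) (δ := fun j => 2⁻¹ ^ (2 * j + 1))
      fun j => pow_ne_zero _ (by simp)
  have hcont (j : ℕ) : Continuous (smoothing Ω α (ns j)) :=
    (contDiff_smoothing hq hα.memLp _).continuous
  have hlim (N : ℕ) := continuousOn_limUnder_of_dist_le hKint hcont (A := exceptionalSet ψ N)
    (N := N) fun j hj x hx => by
      rw [Real.dist_eq, ← hψK j x hx.1]
      exact abs_le_of_notMem_exceptionalSet hj hx.2
  rw [hKΩ] at hlim
  refine ⟨fun x => limUnder atTop fun j => smoothing Ω α (ns j) x, fun ε hε => ?_,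
    ae_eq_of_tendsto_eLpNorm (zero_lt_one.trans_le hq).ne'
    (fun j => (hcont j).aestronglyMeasurable) hα.memLp.1
    ((tendsto_eLpNorm_smoothing_sub hq hq' hα.memLp).comp hns.tendsto_atTop) ?_⟩
  · obtain ⟨N, hN⟩ :=
      ((tendsto_capacity_exceptionalSet hq hq' hψ hψ').eventually_lt_const hε).exists
    exact ⟨exceptionalSet ψ N, exceptionalSet_subset ψ N, hN, (hlim N).2⟩
  · have hnull : volume (⋂ N, exceptionalSet ψ N) = 0 :=
      le_antisymm (ge_of_tendsto' (tendsto_volume_exceptionalSet hq hq' hψ hψ') fun N =>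
        measure_mono (Set.iInter_subset _ N)) zero_le
    filter_upwards [ae_restrict_mem Ω.isOpen.measurableSet,
      ae_restrict_of_ae (measure_eq_zero_iff_ae_notMem.1 hnull)] with x hxΩ hx
    obtain ⟨N, hN⟩ := not_forall.1 (mt Set.mem_iInter.2 hx)
    exact (hlim N).1 x ⟨hxΩ, hN⟩

end Existence


theorem holderConjugate_ofReal_div_sub_one {n : ℕ} (hn : 2 ≤ n) :
    (ENNReal.ofReal ((n : ℝ) / (n - 1))).HolderConjugate n := by
  have hn1 : (1 : ℝ) < n := by exact_mod_cast hn
  simpa only [ENNReal.ofReal_natCast] using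
    ((Real.holderConjugate_iff_eq_conjExponent hn1).2 rfl).symm.ennrealOfReal

end BDProduct

end

theorem proposition3p5 {n : ℕ} (hn : 2 ≤ n)
    (Ω : TopologicalSpace.Opens (BDProduct.Space n))
    (hΩb : Bornology.IsBounded (Ω : Set (BDProduct.Space n)))
    (hΩL : BDProduct.HasLipschitzBoundary (Ω : Set (BDProduct.Space n)))
    (α : BDProduct.Space n → ℝ) (gradα : BDProduct.Space n → BDProduct.Space n)
    (hα : BDProduct.IsSobolev Ω (n : ℝ≥0∞) α gradα)
    (hα_bdd : MemLp α ∞ (volume.restrict (Ω : Set (BDProduct.Space n))))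
    (u : BDProduct.Space n → BDProduct.Space n) (hu : BDProduct.MemBD Ω u) :
    BDProduct.MemBD Ω (fun x => α x • u x) ∧
    (∃ αt : BDProduct.Space n → ℝ, BDProduct.IsQuasicontinuousRep (n : ℝ≥0∞) Ω α αt) ∧
    IntegrableOn (fun x => BDProduct.symTensor (gradα x) (u x)) (Ω : Set (BDProduct.Space n)) ∧
    ∀ αt : BDProduct.Space n → ℝ, BDProduct.IsQuasicontinuousRep (n : ℝ≥0∞) Ω α αt →
      ∀ Eu : VectorMeasure (BDProduct.Space n) (BDProduct.Mat n), BDProduct.HasStrain Ω u Eu →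
        Eu.Integrable αt ∧
        BDProduct.HasStrain Ω (fun x => α x • u x)
          (BDProduct.scalarMul αt Eu +
            BDProduct.lebesgueDensity Ω
              (fun x => BDProduct.symTensor (gradα x) (u x))) := by
  obtain ⟨hu1, Eu₀, hEu₀⟩ := hu
  have : IsFiniteMeasure Eu₀.variation := ⟨hEu₀.variation_lt_top⟩
  have hn1 : (1 : ℝ≥0∞) ≤ n := by exact_mod_cast (by omega : 1 ≤ n)
  have := BDProduct.holderConjugate_ofReal_div_sub_one hn
  obtain ⟨σ, hσ, -⟩ := hEu₀.exists_isStrainDensity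
  have hup := hσ.memLp hn hu1 hΩb hΩL
  obtain ⟨α₀, hα₀⟩ := hα.exists_isQuasicontinuousRep hn1 (ENNReal.natCast_ne_top n)
  exact ⟨⟨hu1.smul hα_bdd, _, hEu₀.smul hn hΩb hup hα hα_bdd hα₀⟩, ⟨α₀, hα₀⟩,
    BDProduct.integrable_symTensor hα.memLp_grad hup, fun αt hαt Eu hEu =>
      ⟨hEu.integrable_quasicontinuousRep hn hΩb hup hα hα_bdd hαt,
        hEu.smul hn hΩb hup hα hα_bdd hαt⟩⟩
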